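/- **The variety.** Over $\mathbb{Q}$, let $X_0=\mathbb{P}^1\times\mathbb{P}^1\times\mathbb{P}^1$ with coordinates $(a_0:a_1)$, $(b_0:b_1)$, $(c_0:c_1)$, and let $l_1=V(a_1,b_1)$, $l_2=V(a_1,c_1)$. Let $X\to X_0$ be the toric threefold obtained by blowing up $l_1$ and then the strict transform of $l_2$. Equivalently, $X$ is the toric variety of the fan obtained from the fan of $X_0$ (rays $\pm e_1,\pm e_2,\pm e_3$, where $e_1,-e_1,e_2,-e_2,e_3,-e_3$ correspond to $a_0,a_1,b_0,b_1,c_0,c_1$) by star subdivision, first of the cone $\langle -e_1,-e_2\rangle$ with the new ray through $-e_1-e_2$, and then of the cone $\langle -e_1,-e_3\rangle$ with the new ray through $-e_1-e_3$. Let $E_1,E_2\subset X$ be the exceptional divisors above $l_1$ and $l_2$ (the torus-invariant divisors of these two new rays), let $M$ be the preimage of $V(a_0)$, and put $D=E_1+E_2+M$ and $U=X\setminus D$. **Clemens complex.** The $\mathbb{R}$-analytic Clemens complex of $D$ is the set of pairs $(A,Z)$, where $A\subseteq\{E_1,E_2,M\}$ and $Z$ is an irreducible component of $\big(\bigcap_{E\in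 A}E\big)_{\mathbb{C}}$ (of $X_{\mathbb{C}}$ if $A=\emptyset$) that is defined over $\mathbb{R}$ and has a real point. It is ordered by $(A,Z)\preceq(A',Z')$ if $A\subseteq A'$ and $Z\supseteq Z'$, and the face $(A,Z)$ has dimension $\#A-1$. **Cones and constants.** For an open subset $V\subseteq X$ and a finite set $A$ of prime divisors not meeting $V$, put $$\operatorname{Pic}(V;A)=\big(\operatorname{Div}(V)\oplus\mathbb{Z}^A\big)\big/\big\{\big(\operatorname{div}_V f,(\operatorname{ord}_E f)_{E\in A}\big) : f\in\mathbb{Q}(X)^\times\big\},$$ so that $\operatorname{Pic}(V;\emptyset)=\operatorname{Pic}(V)$, and let $\pi_A\colon\operatorname{Pic}(X)\to\operatorname{Pic}(U;A)$ be the natural map. Let $\operatorname{Eff}_A\subset\operatorname{Pic}(U;A)_{\mathbb{R}}$ be the cone generated by the classes of effective elements of $\operatorname{Div}(U)\oplus\mathbb{Z}^A$, and let $\overline{\operatorname{Eff}}_V\subset\operatorname{Pic}(V)_{\mathbb{R}}$ be the closure of the cone generated by the classes of effective divisors on $V$. A cone in $\Lambda_{\mathbb{R}}$, for a lattice $\Lambda$,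 is *smooth* if it is generated by a $\mathbb{Z}$-basis of $\Lambda$, and *strictly convex* if it does not contain a line. The characteristic function of a cone $C\subset\Lambda_{\mathbb{R}}$ is $$\mathcal{X}_C(v)=\int_{C^\vee}e^{-\langle v,t\rangle}\,dt\in[0,\infty],$$ where $C^\vee\subset\Lambda_{\mathbb{R}}^\vee$ is the dual cone and $dt$ is the Haar measure for which $\Lambda^\vee$ has covolume $1$. Put $E(U)=\mathcal{O}(U)^\times/\mathbb{Q}^\times$ and $$b_A=\operatorname{rk}\operatorname{Pic}(U)-\operatorname{rk}E(U)+\#A,\qquad b'_A=\operatorname{rk}\operatorname{Pic}(U;A),\qquad \alpha_A=\frac{1}{(b'_A-1)!}\,\mathcal{X}_{\operatorname{Eff}_A}\big(\pi_A(\omega_X(D)^\vee)\big),$$ where $\omega_X(D)^\vee$ is the log anticanonical class. For $A=\{M\}$ write $\operatorname{Eff}_M,b_M,b'_M,\alpha_M$. **Proposition.** The $\mathbb{R}$-analytic Clemens complex of $D$ has exactly two maximal faces. One has the vertex set $A=\{E_1,E_2\}$ and is the unique face of maximal dimension; the other has the vertex set $\{M\}$. 1. There is an isomorphism $\operatorname{Pic}(U;A)\cong\operatorname{Pic}(X\setminus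 M)$ compatible with the natural maps from $\operatorname{Pic}(X)$ to both groups, and the induced isomorphism of real vector spaces maps $\operatorname{Eff}_A$ onto $\overline{\operatorname{Eff}}_{X\setminus M}$. The cone $\operatorname{Eff}_A$ is not strictly convex. 2. The cone $\operatorname{Eff}_M$ is smooth and strictly convex. The groups $\operatorname{Pic}(U)$, $E(U)$ and $\operatorname{Pic}(U;\{M\})$ are finitely generated, $\alpha_M=1/8$, and $b_M=b'_M=3$. -/

import Mathlib

open CategoryTheory CategoryTheory.Limits AlgebraicGeometry
open scoped TensorProduct ENNReal

/-! ## Toric schemes of smooth fans -/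

namespace LogPair

/-- A smooth (unimodular) fan in `ℤⁿ`. The rays are indexed by `ι`, with primitive generators
`ray ρ`, and a cone is recorded as the finite set of its rays. `unimodular` says that the generators
of each cone are part of a `ℤ`-basis of `ℤⁿ` (they admit a partial dual basis); `separated` says that
two cones are separated by a linear form that vanishes precisely on their common face, so that they
intersect along that common face. -/
structure SmoothFan (n : ℕ) (ι : Type) [DecidableEq ι] where
  ray : ι → Fin n → ℤ
  cones : Finset (Finset ι)
  empty_mem : ∅ ∈ cones
  mem_of_subset : ∀ σ ∈ cones, ∀ τ ⊆ σ, τ ∈ cones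
  unimodular : ∀ σ ∈ cones, ∀ ρ ∈ σ, ∃ m : Fin n → ℤ,
    m ⬝ᵥ ray ρ = 1 ∧ ∀ ρ' ∈ σ, ρ' ≠ ρ → m ⬝ᵥ ray ρ' = 0
  separated : ∀ σ ∈ cones, ∀ τ ∈ cones, ∃ m : Fin n → ℤ,
    (∀ ρ ∈ σ ∩ τ, m ⬝ᵥ ray ρ = 0) ∧ (∀ ρ ∈ σ \ τ, 0 < m ⬝ᵥ ray ρ) ∧
      ∀ ρ ∈ τ \ σ, m ⬝ᵥ ray ρ < 0

namespace SmoothFan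

variable {n : ℕ} {ι : Type} [DecidableEq ι] (Δ : SmoothFan n ι)

/-- The cones of the fan, ordered by inclusion of faces. -/
abbrev Cone : Type := {σ : Finset ι // σ ∈ Δ.cones}

/-- The monoid `σ^∨ ∩ M` of characters that are nonnegative on the cone spanned by `σ`. -/
def dual (σ : Finset ι) : AddSubmonoid (Fin n → ℤ) where
  carrier := {m | ∀ ρ ∈ σ, 0 ≤ m ⬝ᵥ Δ.ray ρ}
  zero_mem' := fun ρ _ => by simp
  add_mem' := fun {a b} ha hb ρ hρ => by
    rw [add_dotProduct]; exact add_nonneg (ha ρ hρ) (hb ρ hρ)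

theorem dual_anti {σ τ : Finset ι} (h : σ ⊆ τ) : Δ.dual τ ≤ Δ.dual σ :=
  fun _ hm ρ hρ => hm ρ (h hρ)

/-- The coordinate ring `ℚ[σ^∨ ∩ M]` of the affine toric chart of `σ`. -/
abbrev CoordRing (σ : Finset ι) : Type := AddMonoidAlgebra ℚ (Δ.dual σ)

/-- The inclusion `ℚ[τ^∨ ∩ M] → ℚ[σ^∨ ∩ M]` for a face `σ` of `τ`. -/
noncomputable def restrict {σ τ : Finset ι} (h : σ ⊆ τ) : Δ.CoordRing τ →+* Δ.CoordRing σ :=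
  AddMonoidAlgebra.mapDomainRingHom ℚ (AddSubmonoid.inclusion (Δ.dual_anti h))


@[simp] theorem restrict_single {σ τ : Finset ι} (h : σ ⊆ τ) (m : Δ.dual τ) (r : ℚ) :
    Δ.restrict h (AddMonoidAlgebra.single m r) =
      AddMonoidAlgebra.single (⟨m.1, Δ.dual_anti h m.2⟩ : Δ.dual σ) r := by
  simp [restrict, AddMonoidAlgebra.mapDomainRingHom, AddSubmonoid.inclusion]

theorem restrict_injective {σ τ : Finset ι} (h : σ ⊆ τ) : Function.Injective (Δ.restrict h) :=
  AddMonoidAlgebra.mapDomain_injective (AddSubmonoid.inclusion_injective _)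

/-- The diagram of affine toric charts `Spec ℚ[σ^∨ ∩ M]`, indexed by the cones of the fan. -/
noncomputable def charts : Δ.Cone ⥤ Scheme.{0} where
  obj σ := Spec (.of (Δ.CoordRing σ.1))
  map f := Spec.map (CommRingCat.ofHom (Δ.restrict (leOfHom f)))
  map_id σ := by
    rw [← Spec.map_id]
    congr 1
    ext1
    exact AddMonoidAlgebra.ringHom_ext (fun r => by simp; rfl) (by simp)
  map_comp f g := by
    rw [← Spec.map_comp]
    congr 1
    ext1
    exact AddMonoidAlgebra.ringHom_ext (by simp) (by simp)

/-- A linear form exhibiting `τ` as a face of the cone `σ`. -/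
theorem exists_face {σ τ : Finset ι} (hσ : σ ∈ Δ.cones) (h : τ ⊆ σ) :
    ∃ m : Δ.dual σ, (∀ ρ ∈ τ, m.1 ⬝ᵥ Δ.ray ρ = 0) ∧
      ∀ ρ ∈ σ, ρ ∉ τ → m.1 ⬝ᵥ Δ.ray ρ = 1 := by
  classical
  choose! e he1 he0 using Δ.unimodular σ hσ
  have h0 : ∀ ρ ∈ τ, (∑ ρ ∈ σ \ τ, e ρ) ⬝ᵥ Δ.ray ρ = 0 := fun ρ hρ => by
    rw [sum_dotProduct]
    refine Finset.sum_eq_zero fun r hr => he0 r (Finset.mem_sdiff.1 hr).1 ρ (h hρ) ?_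
    rintro rfl; exact (Finset.mem_sdiff.1 hr).2 hρ
  have h1 : ∀ ρ ∈ σ, ρ ∉ τ → (∑ ρ ∈ σ \ τ, e ρ) ⬝ᵥ Δ.ray ρ = 1 := fun ρ hρ hρ' => by
    rw [sum_dotProduct, Finset.sum_eq_single ρ]
    · exact he1 ρ hρ
    · intro r hr hne
      exact he0 r (Finset.mem_sdiff.1 hr).1 ρ hρ hne.symm
    · intro hn; exact absurd (Finset.mem_sdiff.2 ⟨hρ, hρ'⟩) hn
  refine ⟨⟨∑ ρ ∈ σ \ τ, e ρ, fun ρ hρ => ?_⟩, h0, h1⟩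
  by_cases hρ' : ρ ∈ τ
  · rw [h0 ρ hρ']
  · rw [h1 ρ hρ hρ']; exact zero_le_one

theorem isLocalization {σ τ : Finset ι} (h : τ ⊆ σ) (m : Δ.dual σ)
    (h0 : ∀ ρ ∈ τ, m.1 ⬝ᵥ Δ.ray ρ = 0) (h1 : ∀ ρ ∈ σ, ρ ∉ τ → m.1 ⬝ᵥ Δ.ray ρ = 1) :
    letI := (Δ.restrict h).toAlgebra
    IsLocalization.Away (AddMonoidAlgebra.single m 1 : Δ.CoordRing σ) (Δ.CoordRing τ) := by
  let := (Δ.restrict h).toAlgebra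
  have halg : ∀ f, algebraMap (Δ.CoordRing σ) (Δ.CoordRing τ) f = Δ.restrict h f := fun _ => rfl
  have hneg : -m.1 ∈ Δ.dual τ := fun ρ hρ => by rw [neg_dotProduct, h0 ρ hρ, neg_zero]
  have hpos : m.1 ∈ Δ.dual τ := Δ.dual_anti h m.2
  have key : ∀ f : Δ.CoordRing τ, ∃ (k : ℕ) (g : Δ.CoordRing σ),
      f * Δ.restrict h (AddMonoidAlgebra.single m 1 ^ k) = Δ.restrict h g := by
    intro f
    induction f using AddMonoidAlgebra.induction_linear with
    | zero => exact ⟨0, 0, by simp⟩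
    | add f g hf hg =>
      obtain ⟨k, a, ha⟩ := hf
      obtain ⟨l, b, hb⟩ := hg
      refine ⟨k + l, a * AddMonoidAlgebra.single m 1 ^ l + b * AddMonoidAlgebra.single m 1 ^ k, ?_⟩
      rw [map_add, map_mul, map_mul, ← ha, ← hb, pow_add, map_mul]
      ring
    | single u r =>
      have hu : ∃ k : ℕ, u.1 + k • m.1 ∈ Δ.dual σ := by
        refine ⟨∑ ρ ∈ σ, (u.1 ⬝ᵥ Δ.ray ρ).natAbs, fun ρ hρ => ?_⟩
        rw [add_dotProduct, smul_dotProduct]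
        by_cases hρ' : ρ ∈ τ
        · rw [h0 ρ hρ', smul_zero, add_zero]; exact u.2 ρ hρ'
        · have h2 : (u.1 ⬝ᵥ Δ.ray ρ).natAbs ≤ ∑ ρ ∈ σ, (u.1 ⬝ᵥ Δ.ray ρ).natAbs :=
            Finset.single_le_sum (f := fun ρ => (u.1 ⬝ᵥ Δ.ray ρ).natAbs)
              (fun _ _ => Nat.zero_le _) hρ
          rw [h1 ρ hρ hρ', nsmul_eq_mul, mul_one]
          omega
      obtain ⟨k, hk⟩ := hu
      refine ⟨k, AddMonoidAlgebra.single ⟨_, hk⟩ r, ?_⟩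
      rw [AddMonoidAlgebra.single_pow, restrict_single, restrict_single,
        AddMonoidAlgebra.single_mul_single]
      congr 1
      simp
  refine (isLocalization_iff _ _).2 ⟨?_, ?_, ?_⟩
  · rintro ⟨_, k, rfl⟩
    rw [halg]
    simp only [map_pow, restrict_single]
    refine IsUnit.pow _ (IsUnit.of_mul_eq_one (AddMonoidAlgebra.single ⟨_, hneg⟩ 1) ?_)
    rw [AddMonoidAlgebra.single_mul_single, AddMonoidAlgebra.one_def]
    congr 1
    · ext; simp
    · simp
  · intro f
    obtain ⟨k, g, hg⟩ := key f
    exact ⟨(g, ⟨_, k, rfl⟩), hg⟩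
  · intro a b hab
    exact ⟨1, by rw [Δ.restrict_injective h hab]⟩

instance {σ τ : Δ.Cone} (f : σ ⟶ τ) : IsOpenImmersion (Δ.charts.map f) := by
  obtain ⟨m, h0, h1⟩ := Δ.exists_face τ.2 (leOfHom f)
  let := (Δ.restrict (leOfHom f)).toAlgebra
  have := Δ.isLocalization (leOfHom f) m h0 h1
  exact IsOpenImmersion.of_isLocalization (AddMonoidAlgebra.single m 1 : Δ.CoordRing τ.1)

theorem range_charts_map {σ τ : Δ.Cone} (f : σ ⟶ τ) (m : Δ.dual τ.1)
    (h0 : ∀ ρ ∈ σ.1, m.1 ⬝ᵥ Δ.ray ρ = 0) (h1 : ∀ ρ ∈ τ.1, ρ ∉ σ.1 → m.1 ⬝ᵥ Δ.ray ρ = 1)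
    (p : Spec (.of (Δ.CoordRing τ.1))) :
    p ∈ Set.range (Δ.charts.map f) ↔
      (AddMonoidAlgebra.single m 1 : Δ.CoordRing τ.1) ∉ p.asIdeal := by
  let := (Δ.restrict (leOfHom f)).toAlgebra
  have := Δ.isLocalization (leOfHom f) m h0 h1
  have := PrimeSpectrum.localization_away_comap_range (Δ.CoordRing σ.1)
    (AddMonoidAlgebra.single m 1 : Δ.CoordRing τ.1)
  exact Set.ext_iff.1 this p

instance : (Δ.charts ⋙ Scheme.forget).IsLocallyDirected where
  cond {i j k} fi fj xi xj hx := by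
    let l : Δ.Cone := ⟨i.1 ∩ j.1, Δ.mem_of_subset _ i.2 _ Finset.inter_subset_left⟩
    let fli : l ⟶ i := homOfLE (show l.1 ⊆ i.1 from Finset.inter_subset_left)
    let flj : l ⟶ j := homOfLE (show l.1 ⊆ j.1 from Finset.inter_subset_right)
    obtain ⟨mi, hi0, hi1⟩ := Δ.exists_face k.2 (leOfHom fi)
    obtain ⟨mj, hj0, hj1⟩ := Δ.exists_face k.2 (leOfHom fj)
    obtain ⟨m, h0, h1⟩ := Δ.exists_face k.2 (leOfHom (fli ≫ fi))
    change Δ.charts.map fi xi = Δ.charts.map fj xj at hx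
    have hpi := (Δ.range_charts_map fi mi hi0 hi1 _).1 ⟨xi, rfl⟩
    have hpj := (Δ.range_charts_map fj mj hj0 hj1 _).1 ⟨xj, hx.symm⟩
    have hp : Δ.charts.map fi xi ∈ Set.range (Δ.charts.map (fli ≫ fi)) := by
      refine (Δ.range_charts_map (fli ≫ fi) m h0 h1 _).2 fun hm => ?_
      have hprime := (Δ.charts.map fi xi : Spec (.of (Δ.CoordRing k.1))).isPrime
      -- `mi + mj = m + u` with `u` in the dual monoid of `k`
      have hu : mi.1 + mj.1 - m.1 ∈ Δ.dual k.1 := fun ρ hρ => by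
        rw [sub_dotProduct, add_dotProduct]
        by_cases hρi : ρ ∈ i.1 <;> by_cases hρj : ρ ∈ j.1
        · rw [hi0 ρ hρi, hj0 ρ hρj, h0 ρ (Finset.mem_inter.2 ⟨hρi, hρj⟩)]; simp
        · rw [hi0 ρ hρi, hj1 ρ hρ hρj, h1 ρ hρ fun h => hρj (Finset.mem_inter.1 h).2]; simp
        · rw [hi1 ρ hρ hρi, hj0 ρ hρj, h1 ρ hρ fun h => hρi (Finset.mem_inter.1 h).1]; simp
        · rw [hi1 ρ hρ hρi, hj1 ρ hρ hρj, h1 ρ hρ fun h => hρi (Finset.mem_inter.1 h).1]; simp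
      have hmul : (AddMonoidAlgebra.single mi 1 * AddMonoidAlgebra.single mj 1 :
          Δ.CoordRing k.1) =
          AddMonoidAlgebra.single m 1 * AddMonoidAlgebra.single ⟨_, hu⟩ 1 := by
        rw [AddMonoidAlgebra.single_mul_single, AddMonoidAlgebra.single_mul_single]
        congr 1
        ext; simp
      have hmem := Ideal.mul_mem_right (AddMonoidAlgebra.single ⟨_, hu⟩ 1) _ hm
      rw [← hmul] at hmem
      exact (hprime.mem_or_mem hmem).elim hpi hpj
    obtain ⟨x, hx'⟩ := hp
    rw [Functor.map_comp, Scheme.Hom.comp_apply] at hx'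
    refine ⟨l, fli, flj, x, ?_, ?_⟩
    · exact (Δ.charts.map fi).isOpenEmbedding.injective hx'
    · apply (Δ.charts.map fj).isOpenEmbedding.injective
      change Δ.charts.map fj (Δ.charts.map flj x) = Δ.charts.map fj xj
      rw [← hx, ← hx', ← Scheme.Hom.comp_apply, ← Scheme.Hom.comp_apply,
        ← Functor.map_comp, ← Functor.map_comp]
      rfl

/-- The toric variety of the fan over `ℚ`: the affine charts glued along the charts of common
faces. -/
noncomputable def toricScheme : Scheme.{0} := colimit Δ.charts

/-- The open immersion of the affine chart of a cone. -/
noncomputable def chartMap (σ : Δ.Cone) : Spec (.of (Δ.CoordRing σ.1)) ⟶ Δ.toricScheme :=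
  colimit.ι Δ.charts σ

instance (σ : Δ.Cone) : IsOpenImmersion (Δ.chartMap σ) :=
  inferInstanceAs (IsOpenImmersion (colimit.ι Δ.charts σ))

/-- The structure morphism to `Spec ℚ`. -/
noncomputable def structureMap : Δ.toricScheme ⟶ Spec (.of ℚ) :=
  colimit.desc Δ.charts
    { pt := Spec (.of ℚ)
      ι :=
        { app := fun σ => Spec.map (CommRingCat.ofHom (algebraMap ℚ (Δ.CoordRing σ.1)))
          naturality := fun σ τ f => by
            change Spec.map _ ≫ Spec.map _ = Spec.map _ ≫ 𝟙 _
            rw [Category.comp_id, ← Spec.map_comp, ← CommRingCat.ofHom_comp]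
            congr 2
            exact Subsingleton.elim _ _ } }

instance (σ : Finset ι) : IsDomain (Δ.CoordRing σ) :=
  have : TwoUniqueSums (Δ.dual σ) := TwoUniqueSums.of_injective_addHom
    (Δ.dual σ).subtype.toAddHom Subtype.val_injective inferInstance
  IsDomain.mk

theorem dual_fg {σ : Finset ι} (hσ : σ ∈ Δ.cones) : AddMonoid.FG (Δ.dual σ) := by
  classical
  choose! e he1 he0 using Δ.unimodular σ hσ
  let perp : AddSubgroup (Fin n → ℤ) :=
    { carrier := {m | ∀ ρ ∈ σ, m ⬝ᵥ Δ.ray ρ = 0}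
      zero_mem' := fun ρ _ => by simp
      add_mem' := fun {a b} ha hb ρ hρ => by rw [add_dotProduct, ha ρ hρ, hb ρ hρ, add_zero]
      neg_mem' := fun {a} ha ρ hρ => by rw [neg_dotProduct, ha ρ hρ, neg_zero] }
  have hperp : AddMonoid.FG perp := by
    have : Module.Finite ℤ (AddSubgroup.toIntSubmodule perp) := inferInstance
    exact AddGroup.fg_iff_addMonoid_fg.1 (Module.Finite.iff_addGroup_fg.1 this)
  have hnat : AddMonoid.FG (σ → ℕ) := Module.Finite.iff_addMonoid_fg.1 inferInstance
  have hdot : ∀ (c : σ → ℕ) (ρ : σ), (∑ r : σ, c r • e r.1) ⬝ᵥ Δ.ray ρ.1 = c ρ := fun c ρ => by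
    rw [sum_dotProduct, Finset.sum_eq_single ρ]
    · rw [smul_dotProduct, he1 ρ.1 ρ.2]; simp
    · intro r _ hr
      rw [smul_dotProduct, he0 r.1 r.2 ρ.1 ρ.2 fun h => hr (Subtype.ext h.symm), smul_zero]
    · simp
  let φ : (σ → ℕ) × perp →+ Δ.dual σ :=
    { toFun := fun p => ⟨∑ r : σ, p.1 r • e r.1 + p.2.1, fun ρ hρ => by
        rw [add_dotProduct, hdot p.1 ⟨ρ, hρ⟩, p.2.2 ρ hρ, add_zero]; exact Int.natCast_nonneg _⟩
      map_zero' := by ext; simp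
      map_add' := fun p q => by
        ext i
        simp [add_smul, Finset.sum_add_distrib]
        ring }
  refine AddMonoid.fg_of_surjective φ fun u => ?_
  let c : σ → ℕ := fun ρ => (u.1 ⬝ᵥ Δ.ray ρ.1).toNat
  refine ⟨(c, ⟨u.1 - ∑ r : σ, c r • e r.1, fun ρ hρ => ?_⟩), ?_⟩
  · rw [sub_dotProduct, hdot c ⟨ρ, hρ⟩, Int.toNat_of_nonneg (u.2 ρ hρ), sub_self]
  · ext; simp [φ]

theorem isNoetherianRing {σ : Finset ι} (hσ : σ ∈ Δ.cones) : IsNoetherianRing (Δ.CoordRing σ) :=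
  have := Δ.dual_fg hσ
  Algebra.FiniteType.isNoetherianRing ℚ _

instance : IsLocallyNoetherian Δ.toricScheme := by
  refine (isLocallyNoetherian_iff_openCover
    (Scheme.IsLocallyDirected.openCover Δ.charts)).2 fun σ => ?_
  have := Δ.isNoetherianRing (σ : Δ.Cone).2
  exact inferInstanceAs (IsLocallyNoetherian (Spec (.of (Δ.CoordRing (σ : Δ.Cone).1))))

instance : IsReduced Δ.toricScheme := by
  have : ∀ σ, IsReduced ((Scheme.IsLocallyDirected.openCover Δ.charts).X σ) := fun σ =>
    inferInstanceAs (IsReduced (Spec (.of (Δ.CoordRing (σ : Δ.Cone).1))))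
  exact IsReduced.of_openCover _ (Scheme.IsLocallyDirected.openCover Δ.charts)

theorem chartMap_charts_map {σ τ : Δ.Cone} (f : σ ⟶ τ) (p : Spec (.of (Δ.CoordRing σ.1))) :
    Δ.chartMap τ (Δ.charts.map f p) = Δ.chartMap σ p := by
  have h : Δ.charts.map f ≫ Δ.chartMap τ = Δ.chartMap σ := colimit.w Δ.charts f
  rw [← h]
  rfl

/-- The generic point of a chart. -/
noncomputable def zeroPoint (σ : Finset ι) : Spec (.of (Δ.CoordRing σ)) := ⟨⊥, Ideal.isPrime_bot⟩

instance : IrreducibleSpace Δ.toricScheme := by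
  let o : Δ.Cone := ⟨∅, Δ.empty_mem⟩
  let η : Δ.toricScheme := Δ.chartMap o (Δ.zeroPoint o.1)
  have hη : closure {η} = Set.univ := by
    refine Set.eq_univ_of_forall fun x => ?_
    obtain ⟨σ, y, rfl⟩ := Scheme.IsLocallyDirected.ι_jointly_surjective Δ.charts x
    let f : o ⟶ σ := homOfLE (Finset.empty_subset σ.1)
    have h1 : η = Δ.chartMap σ (Δ.zeroPoint σ.1) := by
      have h2 : Δ.charts.map f (Δ.zeroPoint o.1) = Δ.zeroPoint σ.1 :=
        PrimeSpectrum.ext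
          ((RingHom.injective_iff_ker_eq_bot _).1 (Δ.restrict_injective (leOfHom f)))
      rw [← h2]
      exact (Δ.chartMap_charts_map f _).symm
    rw [h1]
    refine specializes_iff_mem_closure.1 (Specializes.map ?_ (Δ.chartMap σ).continuous)
    exact (PrimeSpectrum.le_iff_specializes (Δ.zeroPoint σ.1) y).1
      (bot_le : (⊥ : Ideal (Δ.CoordRing σ.1)) ≤ y.asIdeal)
  have : PreirreducibleSpace Δ.toricScheme := ⟨by
    rw [← hη]; exact isPreirreducible_singleton.closure⟩
  exact ⟨⟨η⟩⟩

instance : IsIntegral Δ.toricScheme := isIntegral_of_irreducibleSpace_of_isReduced _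

/-- In the chart `𝔸¹ × 𝔾ₘⁿ⁻¹` of a ray `ρ`, the ideal generated by the characters that are positive
on `ρ`; it is the ideal of the unique invariant prime divisor of this chart. -/
noncomputable def rayIdeal (ρ : ι) : Ideal (Δ.CoordRing {ρ}) :=
  Ideal.span {f | ∃ m : Δ.dual {ρ}, 0 < m.1 ⬝ᵥ Δ.ray ρ ∧ f = AddMonoidAlgebra.single m 1}

/-- Restriction of functions from the chart of `ρ` to its invariant divisor. -/
noncomputable def rayRes (ρ : ι) : Δ.CoordRing {ρ} →ₐ[ℚ] AddMonoidAlgebra ℚ (Fin n → ℤ) :=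
  AddMonoidAlgebra.lift ℚ _ _
    { toFun := fun m => if m.toAdd.1 ⬝ᵥ Δ.ray ρ = 0 then AddMonoidAlgebra.single m.toAdd.1 1 else 0
      map_one' := by simp [AddMonoidAlgebra.one_def]
      map_mul' := fun a b => by
        have ha := a.toAdd.2 ρ (Finset.mem_singleton_self ρ)
        have hb := b.toAdd.2 ρ (Finset.mem_singleton_self ρ)
        have hab : (a * b).toAdd.1 ⬝ᵥ Δ.ray ρ = a.toAdd.1 ⬝ᵥ Δ.ray ρ + b.toAdd.1 ⬝ᵥ Δ.ray ρ := by
          rw [← add_dotProduct]; rfl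
        rw [hab]
        by_cases h1 : a.toAdd.1 ⬝ᵥ Δ.ray ρ = 0 <;> by_cases h2 : b.toAdd.1 ⬝ᵥ Δ.ray ρ = 0
        · simp [h1, h2, AddMonoidAlgebra.single_mul_single]
        · simp [h1, h2]
        · simp [h1, h2]
        · rw [if_neg (by omega), if_neg h1, zero_mul] }

theorem rayRes_single (ρ : ι) (m : Δ.dual {ρ}) (r : ℚ) :
    Δ.rayRes ρ (AddMonoidAlgebra.single m r) =
      if m.1 ⬝ᵥ Δ.ray ρ = 0 then AddMonoidAlgebra.single m.1 r else 0 := by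
  rw [rayRes, AddMonoidAlgebra.lift_single]
  simp only [MonoidHom.coe_mk, OneHom.coe_mk, toAdd_ofAdd]
  split_ifs <;> simp

theorem rayIdeal_eq_ker (ρ : ι) : Δ.rayIdeal ρ = RingHom.ker (Δ.rayRes ρ).toRingHom := by
  apply le_antisymm
  · rw [rayIdeal, Ideal.span_le]
    rintro _ ⟨m, hm, rfl⟩
    change Δ.rayRes ρ _ = 0
    rw [rayRes_single, if_neg hm.ne']
  · intro f hf
    replace hf : Δ.rayRes ρ f = 0 := hf
    have hc : ∀ (f : Δ.CoordRing {ρ}) (m : Δ.dual {ρ}), m.1 ⬝ᵥ Δ.ray ρ = 0 →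
        (Δ.rayRes ρ f).coeff m.1 = f.coeff m := by
      intro f m hm
      induction f using AddMonoidAlgebra.induction_linear with
      | zero => simp
      | add f g hf hg => simp [hf, hg]
      | single u r =>
        rw [rayRes_single]
        by_cases hu : u = m
        · subst hu; simp [hm]
        · have hu' : u.1 ≠ m.1 := fun h => hu (Subtype.ext h)
          split_ifs <;> simp [hu, hu']
    rw [← AddMonoidAlgebra.sum_coeff_single f]
    refine Ideal.sum_mem _ fun m hm => ?_
    have hm0 : m.1 ⬝ᵥ Δ.ray ρ ≠ 0 := fun h => by
      have := hc f m h
      rw [hf] at this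
      exact (Finsupp.mem_support_iff.1 hm) this.symm
    have hpos : 0 < m.1 ⬝ᵥ Δ.ray ρ :=
      lt_of_le_of_ne (m.2 ρ (Finset.mem_singleton_self ρ)) hm0.symm
    have : (AddMonoidAlgebra.single m (f.coeff m) : Δ.CoordRing {ρ}) =
        AddMonoidAlgebra.single 0 (f.coeff m) * AddMonoidAlgebra.single m 1 := by
      rw [AddMonoidAlgebra.single_mul_single]; simp
    rw [this]
    exact Ideal.mul_mem_left _ _ (Ideal.subset_span ⟨m, hpos, rfl⟩)

instance (ρ : ι) : (Δ.rayIdeal ρ).IsPrime := by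
  rw [rayIdeal_eq_ker]; exact RingHom.ker_isPrime _

theorem height_rayIdeal {ρ : ι} (hρ : {ρ} ∈ Δ.cones) : (Δ.rayIdeal ρ).height = 1 := by
  have := Δ.isNoetherianRing hρ
  obtain ⟨e, he, -⟩ := Δ.unimodular _ hρ ρ (Finset.mem_singleton_self ρ)
  have hed : e ∈ Δ.dual {ρ} := fun r hr => by
    rw [Finset.mem_singleton.1 hr, he]; exact zero_le_one
  have hspan : Δ.rayIdeal ρ = Ideal.span {AddMonoidAlgebra.single ⟨e, hed⟩ 1} := by
    apply le_antisymm
    · rw [rayIdeal, Ideal.span_le]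
      rintro _ ⟨m, hm, rfl⟩
      have hd : m.1 - e ∈ Δ.dual {ρ} := fun r hr => by
        rw [Finset.mem_singleton.1 hr, sub_dotProduct, he]; omega
      refine Ideal.mem_span_singleton.2 ⟨AddMonoidAlgebra.single ⟨_, hd⟩ 1, ?_⟩
      rw [AddMonoidAlgebra.single_mul_single]
      congr 1
      · ext; simp
      · simp
    · rw [Ideal.span_le, Set.singleton_subset_iff]
      exact Ideal.subset_span ⟨⟨e, hed⟩, by rw [he]; exact one_pos, rfl⟩
  have hne : Δ.rayIdeal ρ ≠ ⊥ := fun h => by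
    rw [hspan, Ideal.span_singleton_eq_bot] at h
    simp at h
  apply le_antisymm
  · rw [hspan]
    refine Ideal.height_le_one_of_isPrincipal_of_mem_minimalPrimes
      (Ideal.span {AddMonoidAlgebra.single ⟨e, hed⟩ 1}) _ ?_
    rw [← hspan]
    rw [Ideal.minimalPrimes_eq_subsingleton_self]; rfl
  · rw [Order.one_le_iff_ne_zero, Ne, Ideal.height_eq_zero_iff,
      IsDomain.minimalPrimes_eq_singleton_bot]
    exact hne

/-- The generic point of the torus-invariant prime divisor associated with the ray `ρ`. -/
noncomputable def rayPoint {ρ : ι} (hρ : {ρ} ∈ Δ.cones) : Δ.toricScheme :=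
  Δ.chartMap ⟨{ρ}, hρ⟩ ⟨Δ.rayIdeal ρ, inferInstance⟩

theorem coheight_rayPoint {ρ : ι} (hρ : {ρ} ∈ Δ.cones) :
    Order.coheight (Δ.rayPoint hρ) = 1 := by
  rw [← Δ.height_rayIdeal hρ, rayPoint]
  refine (coheight_eq_of_isOpenImmersion _).trans ?_
  exact (idealHeight_eq_coheight (.of (Δ.CoordRing {ρ})) ⟨Δ.rayIdeal ρ, inferInstance⟩).symm

end SmoothFan

/-! ## Divisors, divisor class groups and effective cones -/

section Divisors

variable {X : Scheme.{0}}

/-- A prime divisor, given by its generic point (a point of codimension `1`). -/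
def PrimeDivisor (X : Scheme.{0}) : Type := {z : X // Order.coheight z = 1}

noncomputable instance (X : Scheme.{0}) : DecidableEq (PrimeDivisor X) := Classical.decEq _

/-- The underlying closed subset of a prime divisor. -/
def PrimeDivisor.support (E : PrimeDivisor X) : Set X := closure {E.1}

/-- The open subscheme `X ∖ ⋃_{E ∈ S} E`. -/
def complement (S : Finset (PrimeDivisor X)) : X.Opens :=
  ⟨(⋃ E ∈ S, E.support)ᶜ,
    (S.finite_toSet.isClosed_biUnion fun _ _ => isClosed_closure).isOpen_compl⟩

/-- The group of Weil divisors. -/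
abbrev WeilDiv (X : Scheme.{0}) : Type := PrimeDivisor X →₀ ℤ

/-- The group `Div(V; A) = Div(V) ⊕ ℤ^A` of `A`-divisors on an open `V ⊆ X`, for a finite set `A` of
prime divisors of `X` (which in practice do not meet `V`). For `A = ∅` this is `Div(V)`. -/
abbrev ADiv (V : X.Opens) (A : Finset (PrimeDivisor X)) : Type :=
  ({E : PrimeDivisor X // E.1 ∈ V} →₀ ℤ) × ({E : PrimeDivisor X // E ∈ A} →₀ ℤ)

/-- `L ↦ (L ∩ V, the part of L supported on A)`. -/
noncomputable def toADiv (V : X.Opens) (A : Finset (PrimeDivisor X)) : WeilDiv X →+ ADiv V A :=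
  AddMonoidHom.prod (Finsupp.subtypeDomainAddMonoidHom (p := fun E : PrimeDivisor X => E.1 ∈ V))
    (Finsupp.subtypeDomainAddMonoidHom (p := fun E : PrimeDivisor X => E ∈ A))

variable [IsIntegral X] [IsLocallyNoetherian X]

theorem ord_inverse {f : X.functionField} (hf : f ≠ 0) (z : X) :
    Scheme.ord f⁻¹ z = - Scheme.ord f z := by
  have h := Scheme.ord_mul (x := z) hf (inv_ne_zero hf)
  have h1 := Scheme.ord_mul (x := z) (one_ne_zero (α := X.functionField)) one_ne_zero
  rw [mul_inv_cancel₀ hf] at h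
  rw [one_mul] at h1
  omega

/-- The group of principal divisors `div(f)`, for `f` a nonzero rational function. -/
noncomputable def principal (X : Scheme.{0}) [IsIntegral X] [IsLocallyNoetherian X] :
    AddSubgroup (WeilDiv X) where
  carrier := {L | ∃ f : X.functionField, f ≠ 0 ∧ ∀ E, L E = Scheme.ord f E.1}
  zero_mem' := ⟨1, one_ne_zero, fun E => by
    have h1 := Scheme.ord_mul (x := E.1) (one_ne_zero (α := X.functionField)) one_ne_zero
    rw [one_mul] at h1
    simp only [Finsupp.coe_zero, Pi.zero_apply]
    omega⟩
  add_mem' := by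
    rintro a b ⟨f, hf, hf'⟩ ⟨g, hg, hg'⟩
    exact ⟨f * g, mul_ne_zero hf hg, fun E => by
      rw [Scheme.ord_mul hf hg, ← hf', ← hg']; rfl⟩
  neg_mem' := by
    rintro a ⟨f, hf, hf'⟩
    exact ⟨f⁻¹, inv_ne_zero hf, fun E => by rw [ord_inverse hf, ← hf']; rfl⟩

/-- The group of principal `A`-divisors `(div_V(f), (ord_E(f))_{E ∈ A})`. -/
noncomputable def principalA (V : X.Opens) (A : Finset (PrimeDivisor X)) :
    AddSubgroup (ADiv V A) where
  carrier := {L | ∃ f : X.functionField, f ≠ 0 ∧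
    (∀ E, L.1 E = Scheme.ord f E.1.1) ∧ ∀ E, L.2 E = Scheme.ord f E.1.1}
  zero_mem' := by
    have h (z : X) : Scheme.ord (1 : X.functionField) z = 0 := by
      have h1 := Scheme.ord_mul (x := z) (one_ne_zero (α := X.functionField)) one_ne_zero
      rw [one_mul] at h1
      omega
    exact ⟨1, one_ne_zero, fun E => (h _).symm, fun E => (h _).symm⟩
  add_mem' := by
    rintro a b ⟨f, hf, hf1, hf2⟩ ⟨g, hg, hg1, hg2⟩
    refine ⟨f * g, mul_ne_zero hf hg, fun E => ?_, fun E => ?_⟩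
    · rw [Scheme.ord_mul hf hg, ← hf1, ← hg1]; rfl
    · rw [Scheme.ord_mul hf hg, ← hf2, ← hg2]; rfl
  neg_mem' := by
    rintro a ⟨f, hf, hf1, hf2⟩
    refine ⟨f⁻¹, inv_ne_zero hf, fun E => ?_, fun E => ?_⟩
    · rw [ord_inverse hf, ← hf1]; rfl
    · rw [ord_inverse hf, ← hf2]; rfl

/-- Divisors modulo linear equivalence; for a smooth variety this is the Picard group. -/
abbrev Pic (X : Scheme.{0}) [IsIntegral X] [IsLocallyNoetherian X] : Type := WeilDiv X ⧸ principal X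

/-- The group `Pic(V; A)` of `A`-divisor classes. For `A = ∅` this is `Pic(V)`. -/
abbrev APic (V : X.Opens) (A : Finset (PrimeDivisor X)) : Type := ADiv V A ⧸ principalA V A

/-- The canonical homomorphism `π_A : Pic(X) → Pic(V; A)`; for `A = ∅` this is restriction to `V`. -/
noncomputable def toAPic (V : X.Opens) (A : Finset (PrimeDivisor X)) : Pic X →+ APic V A :=
  QuotientAddGroup.map _ _ (toADiv V A) (by
    rintro L ⟨f, hf, h⟩
    exact ⟨f, hf, fun E => h E.1, fun E => h E.1⟩)

/-- The effective cone in `Pic(V; A)_ℝ`: the cone generated by the classes of effective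
`A`-divisors. -/
noncomputable def Eff (V : X.Opens) (A : Finset (PrimeDivisor X)) :
    PointedCone ℝ (ℝ ⊗[ℤ] APic V A) :=
  PointedCone.hull ℝ {v | ∃ L : ADiv V A, 0 ≤ L ∧ v = 1 ⊗ₜ (QuotientAddGroup.mk L : APic V A)}

/-- The closure of the effective cone in `Pic(V)_ℝ`, for the canonical topology of this real vector
space. -/
def closedEff (V : X.Opens) : Set (ℝ ⊗[ℤ] APic V ∅) :=
  @closure _ (moduleTopology ℝ (ℝ ⊗[ℤ] APic V ∅)) (Eff V ∅)

end Divisors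

/-! ## Cones in `Λ_ℝ` for a lattice `Λ` -/

section Cones

variable {Λ : Type} [AddCommGroup Λ] {ι : Type} [Fintype ι]

/-- A cone is strictly convex if it contains no line through `0`. -/
def StrictlyConvex {V : Type} [AddCommGroup V] [Module ℝ V] (C : PointedCone ℝ V) : Prop :=
  (C : ConvexCone ℝ V).Salient

/-- A cone in `Λ_ℝ` is smooth if it is generated by a `ℤ`-basis of `Λ`. -/
def IsSmoothCone (C : PointedCone ℝ (ℝ ⊗[ℤ] Λ)) : Prop :=
  ∃ (r : ℕ) (b : Module.Basis (Fin r) ℤ Λ),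
    C = PointedCone.hull ℝ (Set.range fun i => 1 ⊗ₜ b i)

/-- The linear form on `Λ_ℝ` with coordinates `t` in the basis dual to the `ℤ`-basis `b` of `Λ`. -/
noncomputable def functional (b : Module.Basis ι ℤ Λ) (t : ι → ℝ) : (ℝ ⊗[ℤ] Λ) →ₗ[ℝ] ℝ :=
  (b.baseChange ℝ).constr ℝ t

/-- The characteristic function `v ↦ ∫_{C^∨} exp(-⟨v, t⟩) dt` of a cone `C ⊆ Λ_ℝ`, where the dual space
carries the Haar measure for which the dual lattice has covolume `1`: this is Lebesgue measure in
the coordinates with respect to the dual of any `ℤ`-basis `b` of `Λ`. -/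
noncomputable def charFun (b : Module.Basis ι ℤ Λ) (C : PointedCone ℝ (ℝ ⊗[ℤ] Λ))
    (v : ℝ ⊗[ℤ] Λ) : ℝ≥0∞ :=
  ∫⁻ t in {t : ι → ℝ | ∀ y ∈ C, 0 ≤ functional b t y},
    ENNReal.ofReal (Real.exp (-functional b t v))

end Cones

/-! ## Canonical divisors -/

section Canonical

variable {X : Scheme.{0}} [IsIntegral X] [IsLocallyNoetherian X]

/-- Rational differential `n`-forms on `X`. (For rational functions on a scheme over `ℚ`, Kähler
differentials over `ℤ` and over `ℚ` coincide.) -/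
abbrev RatForm (X : Scheme.{0}) [IsIntegral X] (n : ℕ) : Type :=
  ⋀[X.functionField]^n Ω[X.functionField⁄ℤ]

/-- The rational `n`-form `dh₁ ∧ ⋯ ∧ dhₙ` for `h₁, …, hₙ` in the local ring at `z`. -/
noncomputable def wedgeD (z : X) {n : ℕ} (h : Fin n → X.presheaf.stalk z) : RatForm X n :=
  exteriorPower.ιMulti X.functionField n fun i =>
    KaehlerDifferential.D ℤ X.functionField
      (algebraMap (X.presheaf.stalk z) X.functionField (h i))

/-- `dh₁ ∧ ⋯ ∧ dhₙ` generates the module of regular `n`-forms at `z` (which is spanned over the local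
ring by the forms `dh'₁ ∧ ⋯ ∧ dh'ₙ`). -/
def IsLocalFrame (z : X) {n : ℕ} (h : Fin n → X.presheaf.stalk z) : Prop :=
  wedgeD z h ≠ 0 ∧ ∀ h' : Fin n → X.presheaf.stalk z, ∃ u : X.presheaf.stalk z,
    wedgeD z h' = algebraMap (X.presheaf.stalk z) X.functionField u • wedgeD z h

/-- `W` is a canonical divisor: the divisor of a nonzero rational `n`-form `ω`, where `n = dim X`. The
order of `ω` along `E` is the order of `g` if `ω = g • η` for a local generator `η` of the sheaf of
`n`-forms at the generic point of `E`. -/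
def IsCanonicalDivisor (n : ℕ) (W : WeilDiv X) : Prop :=
  ∃ ω : RatForm X n, ω ≠ 0 ∧ ∀ E : PrimeDivisor X,
    ∃ (h : Fin n → X.presheaf.stalk E.1) (g : X.functionField),
      IsLocalFrame E.1 h ∧ ω = g • wedgeD E.1 h ∧ W E = Scheme.ord g E.1

end Canonical

/-! ## Pairs `(X, D)` over `ℚ`: Clemens complex and constants -/

section Pair

variable {X : Scheme.{0}}

/-- The constants `ℚ → 𝒪(U)`. -/
noncomputable def constants (s : X ⟶ Spec (.of ℚ)) (U : X.Opens) : ℚ →+* Γ(X, U) :=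
  ((Scheme.ΓSpecIso (.of ℚ)).inv ≫ s.appTop ≫ X.presheaf.map (homOfLE le_top).op).hom

/-- The group `E(U) = 𝒪(U)ˣ / ℚˣ`, written additively. -/
def UnitsModConstants (s : X ⟶ Spec (.of ℚ)) (U : X.Opens) : Type :=
  Additive (Γ(X, U)ˣ ⧸ (Units.map (constants s U : ℚ →* Γ(X, U))).range)

noncomputable instance (s : X ⟶ Spec (.of ℚ)) (U : X.Opens) :
    AddCommGroup (UnitsModConstants s U) :=
  inferInstanceAs (AddCommGroup
    (Additive (Γ(X, U)ˣ ⧸ (Units.map (constants s U : ℚ →* Γ(X, U))).range)))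

/-- The base change `X_ℂ`. -/
noncomputable abbrev complexification (s : X ⟶ Spec (.of ℚ)) : Scheme.{0} :=
  pullback s (Spec.map (CommRingCat.ofHom (algebraMap ℚ ℂ)))

/-- Complex conjugation on `X_ℂ`. -/
noncomputable def complexConj (s : X ⟶ Spec (.of ℚ)) : complexification s ⟶ complexification s :=
  pullback.map _ _ _ _ (𝟙 X) (Spec.map (CommRingCat.ofHom (starRingEnd ℂ))) (𝟙 _) (by simp) (by
    rw [Category.comp_id, ← Spec.map_comp, ← CommRingCat.ofHom_comp]
    congr 2
    exact Subsingleton.elim _ _)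

/-- The subset `Z` of `X_ℂ` contains an `ℝ`-rational point of `X`: `q` is the complex point of `X_ℂ`
induced by the real point `p` of `X`. -/
def HasRealPoint (s : X ⟶ Spec (.of ℚ)) (Z : Set (complexification s)) : Prop :=
  ∃ (p : Spec (.of ℝ) ⟶ X) (q : Spec (.of ℂ) ⟶ complexification s),
    q ≫ pullback.snd _ _ = 𝟙 _ ∧
    q ≫ pullback.fst _ _ = Spec.map (CommRingCat.ofHom (algebraMap ℝ ℂ)) ≫ p ∧
    Set.range q ⊆ Z

/-- The intersection `Z_A` of the divisors in `A` (all of `X` if `A = ∅`). -/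
def stratum (A : Finset (PrimeDivisor X)) : Set X := ⋂ E ∈ A, E.support

/-- A face `(A, Z)` of the `ℝ`-analytic Clemens complex of the divisor with set of components `D`: a
set `A ⊆ D` of components and an irreducible component `Z` of `(Z_A)_ℂ` which is defined over `ℝ` (that
is, stable under complex conjugation) and has a real point. The empty face is included. -/
structure AnalyticFace (s : X ⟶ Spec (.of ℚ)) (D : Finset (PrimeDivisor X)) where
  vertices : Finset (PrimeDivisor X)
  carrier : Set (complexification s)
  subset : vertices ⊆ D
  isComponent : Maximal
    (fun T => IsIrreducible T ∧
      T ⊆ (pullback.fst s _ : complexification s ⟶ X) ⁻¹' stratum vertices)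
    carrier
  conj_invariant : complexConj s ⁻¹' carrier = carrier
  hasRealPoint : HasRealPoint s carrier

/-- `(A, Z) ≼ (A', Z')` if `A ⊆ A'` and `Z ⊇ Z'`. -/
instance (s : X ⟶ Spec (.of ℚ)) (D : Finset (PrimeDivisor X)) : LE (AnalyticFace s D) where
  le F G := F.vertices ⊆ G.vertices ∧ G.carrier ⊆ F.carrier

/-- The dimension `#A - 1` of a face. -/
def AnalyticFace.dim {s : X ⟶ Spec (.of ℚ)} {D : Finset (PrimeDivisor X)}
    (F : AnalyticFace s D) : ℤ := F.vertices.card - 1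

variable [IsIntegral X] [IsLocallyNoetherian X]

/-- `b_A = rk Pic(U) - rk E(U) + #A`, where `U = X ∖ D`. -/
noncomputable def bExp (s : X ⟶ Spec (.of ℚ)) (D A : Finset (PrimeDivisor X)) : ℤ :=
  Module.finrank ℤ (APic (complement D) ∅) -
    Module.finrank ℤ (UnitsModConstants s (complement D)) + A.card

/-- `b'_A = rk Pic(U; A)`, where `U = X ∖ D`. -/
noncomputable def bExp' (D A : Finset (PrimeDivisor X)) : ℕ :=
  Module.finrank ℤ (APic (complement D) A)

/-- The reduced divisor with set of components `D`. -/
noncomputable def reducedDivisor (D : Finset (PrimeDivisor X)) : WeilDiv X :=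
  ∑ E ∈ D, Finsupp.single E 1

/-- The constant `α_A = 𝒳(π_A[-(W + D)]) / (b'_A - 1)!`, where `𝒳` is the characteristic function of the
effective cone in `Pic(U; A)_ℝ`, `U = X ∖ D`. If `W` is a canonical divisor, then `-(W + D)` represents
the log anticanonical class. The `ℤ`-basis `b` of `Pic(U; A)` serves to normalize the measure. -/
noncomputable def alpha {ι : Type} [Fintype ι] (D A : Finset (PrimeDivisor X))
    (b : Module.Basis ι ℤ (APic (complement D) A)) (W : WeilDiv X) : ℝ≥0∞ :=
  charFun b (Eff (complement D) A)
    (1 ⊗ₜ toAPic (complement D) A (QuotientAddGroup.mk (-(W + reducedDivisor D)))) /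
      ((bExp' D A - 1).factorial : ℝ≥0∞)

end Pair
end LogPair

/-! ## The toric threefold -/

namespace ToricThreefold

/-- Labels for the rays of the fan, named after the corresponding coordinates: the coordinates
`(a₀ : a₁)`, `(b₀ : b₁)`, `(c₀ : c₁)` of `ℙ¹ × ℙ¹ × ℙ¹`, and `x`, `y` for the two exceptional divisors. -/
inductive Ray | a0 | a1 | b0 | b1 | c0 | c1 | x | y
  deriving DecidableEq

open Ray

instance : Fintype Ray :=
  ⟨{a0, a1, b0, b1, c0, c1, x, y}, fun r => by cases r <;> decide⟩

/-- The primitive generators of the rays. -/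
def vec : Ray → Fin 3 → ℤ
  | a0 => ![1, 0, 0] | a1 => ![-1, 0, 0] | b0 => ![0, 1, 0] | b1 => ![0, -1, 0]
  | c0 => ![0, 0, 1] | c1 => ![0, 0, -1] | x => ![-1, -1, 0] | y => ![-1, 0, -1]

/-- The star subdivision at the cone `τ`, with `r` the new ray through the sum of the generators of
`τ`. It describes the blow-up of the toric variety along the orbit closure of `τ`. -/
def starSubdivision (S : Finset (Finset Ray)) (τ : Finset Ray) (r : Ray) : Finset (Finset Ray) :=
  S.filter (fun σ => ¬ τ ⊆ σ) ∪
    (S.filter (fun σ => ¬ τ ⊆ σ ∧ σ ∪ τ ∈ S)).image (insert r)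

/-- The cones of the fan of `ℙ¹ × ℙ¹ × ℙ¹`. -/
def cones₀ : Finset (Finset Ray) :=
  (({a0, a1, b0, b1, c0, c1} : Finset Ray).powerset).filter
    fun σ => ¬ {a0, a1} ⊆ σ ∧ ¬ {b0, b1} ⊆ σ ∧ ¬ {c0, c1} ⊆ σ

/-- The cones of the fan of `X`: blow up `l₁ = V(a₁, b₁)`, with exceptional ray `x`, and then the strict
transform of `l₂ = V(a₁, c₁)`, with exceptional ray `y`. -/
def cones : Finset (Finset Ray) := starSubdivision (starSubdivision cones₀ {a1, b1} x) {a1, c1} y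

theorem cones_erase : ∀ σ ∈ cones, ∀ ρ ∈ σ, σ.erase ρ ∈ cones := by decide +kernel

theorem singleton_mem_cones : ∀ ρ, {ρ} ∈ cones := by decide +kernel

/-- The pairing of a character with the generator of a ray, in coordinates. -/
def pairing (m : ℤ × ℤ × ℤ) : Ray → ℤ
  | a0 => m.1 | a1 => -m.1 | b0 => m.2.1 | b1 => -m.2.1
  | c0 => m.2.2 | c1 => -m.2.2 | x => -m.1 - m.2.1 | y => -m.1 - m.2.2

theorem dotProduct_vec (m : ℤ × ℤ × ℤ) (ρ : Ray) :
    ![m.1, m.2.1, m.2.2] ⬝ᵥ vec ρ = pairing m ρ := by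
  cases ρ <;> simp [pairing, vec, dotProduct, Fin.sum_univ_three] <;> ring

theorem cones_unimodular : ∀ σ ∈ cones, ∀ ρ ∈ σ,
    ∃ m ∈ ([0, 1, -1] ×ˢ [0, 1, -1] ×ˢ [0, 1, -1] : List (ℤ × ℤ × ℤ)),
      pairing m ρ = 1 ∧ ∀ ρ' ∈ σ, ρ' ≠ ρ → pairing m ρ' = 0 := by decide +kernel

/-- Values on the rays of a strictly convex support function (an ample divisor). -/
def height : Ray → ℤ
  | x => 2 | y => 4 | _ => 3

theorem cones_convex : ∀ σ ∈ cones,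
    ∃ m ∈ ([0, 1, -1, 2, -2, 3, -3] ×ˢ [0, 1, -1, 2, -2, 3, -3] ×ˢ [0, 1, -1, 2, -2, 3, -3] :
      List (ℤ × ℤ × ℤ)),
      ∀ ρ, (ρ ∈ σ → pairing m ρ = height ρ) ∧ (ρ ∉ σ → pairing m ρ < height ρ) := by
  decide +kernel

theorem cones_subset : ∀ σ ∈ cones, ∀ τ ⊆ σ, τ ∈ cones := by
  intro σ
  induction σ using Finset.strongInduction with
  | H σ ih =>
    intro hσ τ hτ
    rcases eq_or_ne τ σ with rfl | hne
    · exact hσ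
    · obtain ⟨ρ, hρ, hρτ⟩ := Finset.exists_of_ssubset (hτ.ssubset_of_ne hne)
      exact ih _ (Finset.erase_ssubset hρ) (cones_erase σ hσ ρ hρ) τ
        (Finset.subset_erase.2 ⟨hτ, hρτ⟩)

/-- The fan of the toric threefold `X`. -/
def fan : LogPair.SmoothFan 3 Ray where
  ray := vec
  cones := cones
  empty_mem := by decide +kernel
  mem_of_subset := cones_subset
  unimodular := fun σ hσ ρ hρ => by
    obtain ⟨m, -, h1, h0⟩ := cones_unimodular σ hσ ρ hρ
    exact ⟨![m.1, m.2.1, m.2.2], by rw [dotProduct_vec, h1],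
      fun ρ' hρ' hne => by rw [dotProduct_vec, h0 ρ' hρ' hne]⟩
  separated := fun σ hσ τ hτ => by
    obtain ⟨m, -, hm⟩ := cones_convex σ hσ
    obtain ⟨k, -, hk⟩ := cones_convex τ hτ
    refine ⟨![m.1, m.2.1, m.2.2] - ![k.1, k.2.1, k.2.2], fun ρ hρ => ?_, fun ρ hρ => ?_,
      fun ρ hρ => ?_⟩ <;> rw [sub_dotProduct, dotProduct_vec, dotProduct_vec]
    · rw [(hm ρ).1 (Finset.mem_inter.1 hρ).1, (hk ρ).1 (Finset.mem_inter.1 hρ).2, sub_self]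
    · have h1 := (hm ρ).1 (Finset.mem_sdiff.1 hρ).1
      have h2 := (hk ρ).2 (Finset.mem_sdiff.1 hρ).2
      omega
    · have h1 := (hk ρ).1 (Finset.mem_sdiff.1 hρ).1
      have h2 := (hm ρ).2 (Finset.mem_sdiff.1 hρ).2
      omega

/-- The toric threefold `X` over `ℚ`. -/
noncomputable abbrev X : Scheme.{0} := fan.toricScheme

/-- The structure morphism `X → Spec ℚ`. -/
noncomputable abbrev toSpec : X ⟶ Spec (.of ℚ) := fan.structureMap

/-- The torus-invariant prime divisor of a ray. -/
noncomputable def rayDivisor (ρ : Ray) : LogPair.PrimeDivisor X :=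
  ⟨fan.rayPoint (singleton_mem_cones ρ), fan.coheight_rayPoint (singleton_mem_cones ρ)⟩

/-- The exceptional divisor above `l₁`. -/
noncomputable def E₁ : LogPair.PrimeDivisor X := rayDivisor x

/-- The exceptional divisor above `l₂`. -/
noncomputable def E₂ : LogPair.PrimeDivisor X := rayDivisor y

/-- The preimage of the plane `V(a₀)`. -/
noncomputable def M : LogPair.PrimeDivisor X := rayDivisor a0

/-- The boundary `D = E₁ + E₂ + M`, as a set of prime divisors. -/
noncomputable def D : Finset (LogPair.PrimeDivisor X) := {E₁, E₂, M}

end ToricThreefold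

/-! On a toric variety every question about divisor classes can be moved to the torus-invariant
divisors. The coordinate ring of the torus is a Laurent polynomial ring, hence factorial, so a prime
divisor meeting the torus has an equation `f` there. The order of `f` along an invariant divisor is
at most that of each of its monomials (`ord_fn_rayPoint_le`). Dividing `f` by one of its monomials
therefore shows that the prime divisor is linearly equivalent to an effective invariant divisor
(`exists_ord_eq`). This defines the homomorphism `invariantPart`, which preserves effectivity. A
rational function without zeros or poles on the torus is a monomial (`exists_eq_fn_single`), so the
only relations between invariant divisors come from characters (`exists_ord_eq_iff`). Consequently
`Pic(V; A)` is determined by integral weights of the rays (`ClassData.equiv`), and its effective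
cone is generated by these weights (`ClassData.Eff_eq`).

For the threefold, `Pic(U; E₁, E₂)` and `Pic(X ∖ M)` see the same rays, namely all except `a0`, so
one weight table `wtE` serves for both; this gives the isomorphism. The weights of `x`, `y` and `a1`
sum to zero and positively span a plane, so the cone contains lines; it is cut out by two closed
half-spaces, so taking the closure changes nothing. For `{M}` the nonzero weights are the standard
basis vectors of `ℤ³`, and the cone is an orthant. A unit on `U` is a monomial whose exponent
vanishes on `a1`, `b0`, `c0`, hence is constant, so `E(U)` is trivial.

For `α_M`, the form `dlog ∧ dlog ∧ dlog` has no zeros or poles on the torus and a simple pole along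
each invariant divisor (`isCanonicalDivisor_neg_boundary`). The log anticanonical class is thus the
sum of the weights of `a1`, `b0`, `b1`, `c0`, `c1`, which is `(1, 2, 2)`. The integral over the dual
orthant is a product of one-dimensional integrals with value `1/4`, and `(3 - 1)! = 2` gives `1/8`.

For the Clemens complex, an intersection of invariant divisors is empty unless their rays span a
cone. Otherwise it is the closure of one orbit, which is geometrically irreducible and has a real
point, the image of the identity of a torus. The faces therefore correspond to the cones with rays
among `x`, `y`, `a0`, and these can be enumerated. -/

namespace LogPair

/-! ### Local rings and rational functions in affine charts -/

section LocalRings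

variable {X : Scheme.{0}} {R : CommRingCat.{0}} (j : Spec R ⟶ X) [IsOpenImmersion j]

/-- The localization map from the coordinate ring of an affine chart `j` to the local ring at a point
`x` of the chart. -/
noncomputable def toStalk (x : X) (hx : x ∈ Set.range j) : R ⟶ X.presheaf.stalk x :=
  Spec.preimage (IsOpenImmersion.lift j (X.fromSpecStalk x) (by
    rw [Scheme.range_fromSpecStalk]
    exact fun y hy => hy.mem_open j.isOpenEmbedding.isOpen_range hx))

theorem SpecMap_toStalk (x : X) (hx : x ∈ Set.range j) :
    Spec.map (toStalk j x hx) ≫ j = X.fromSpecStalk x := by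
  rw [toStalk, Spec.map_preimage, IsOpenImmersion.lift_fac]

/-- An open immersion is a monomorphism and `Spec` is faithful. The compatibilities of `toStalk`
with specialization and change of chart follow from this uniqueness. -/
theorem toStalk_eq_of_comp_eq {x : X} (hx : x ∈ Set.range j) (φ : R ⟶ X.presheaf.stalk x)
    (h : Spec.map φ ≫ j = X.fromSpecStalk x) : φ = toStalk j x hx :=
  Spec.map_injective ((cancel_mono j).1 (h.trans (SpecMap_toStalk j x hx).symm))

theorem toStalk_stalkSpecializes {x y : X} (h : x ⤳ y) (hx : x ∈ Set.range j)
    (hy : y ∈ Set.range j) :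
    toStalk j y hy ≫ X.presheaf.stalkSpecializes h = toStalk j x hx :=
  toStalk_eq_of_comp_eq _ _ _ (by
    rw [Spec.map_comp, Category.assoc, SpecMap_toStalk, Scheme.SpecMap_stalkSpecializes_fromSpecStalk])

theorem toStalk_comp {S : CommRingCat.{0}} (θ : R ⟶ S) (i : Spec S ⟶ X) [IsOpenImmersion i]
    (h : Spec.map θ ≫ j = i) (x : X) (hx : x ∈ Set.range i) (hx' : x ∈ Set.range j) :
    θ ≫ toStalk i x hx = toStalk j x hx' :=
  toStalk_eq_of_comp_eq _ _ _ (by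
    rw [Spec.map_comp, Category.assoc, h, SpecMap_toStalk])

theorem toStalk_stalkMap (p : Spec R) :
    toStalk j (j p) (Set.mem_range_self p) ≫ j.stalkMap p = StructureSheaf.toStalk R p := by
  apply Spec.map_injective
  rw [← cancel_mono j, Spec.map_comp, Category.assoc, SpecMap_toStalk,
    Scheme.SpecMap_stalkMap_fromSpecStalk, Spec.fromSpecStalk_eq']
  rfl

/-- The stalk map of an open immersion is an isomorphism, and it carries `toStalk` to the canonical
map into the stalk of `Spec R`, which is known to be a localization. -/
theorem isLocalization_toStalk (p : Spec R) :
    letI := (toStalk j (j p) (Set.mem_range_self p)).hom.toAlgebra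
    haveI : p.asIdeal.IsPrime := p.isPrime
    IsLocalization.AtPrime (X.presheaf.stalk (j p)) p.asIdeal := by
  have := p.isPrime
  let := (toStalk j (j p) (Set.mem_range_self p)).hom.toAlgebra
  have h := StructureSheaf.IsLocalization.to_stalk R p
  let : Algebra R ((Spec R).presheaf.stalk p) := (StructureSheaf.toStalk R p).hom.toAlgebra
  refine (IsLocalization.isLocalization_iff_of_algEquiv p.asIdeal.primeCompl
    (S := X.presheaf.stalk (j p)) (P := (Spec R).presheaf.stalk p)
    { (asIso (j.stalkMap p)).commRingCatIsoToRingEquiv with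
      commutes' := fun r => ?_ }).2 h
  exact congr($(toStalk_stalkMap j p).hom r)

theorem isUnit_toStalk {p : Spec R} {f : R} (hf : f ∉ p.asIdeal) :
    IsUnit ((toStalk j (j p) (Set.mem_range_self p)).hom f) := by
  let := (toStalk j (j p) (Set.mem_range_self p)).hom.toAlgebra
  have : p.asIdeal.IsPrime := p.isPrime
  have := isLocalization_toStalk j p
  exact IsLocalization.map_units (M := p.asIdeal.primeCompl) _ ⟨f, hf⟩

theorem exists_toStalk_mul_eq {p : Spec R} (z : X.presheaf.stalk (j p)) :
    ∃ f s : R, s ∉ p.asIdeal ∧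
      z * (toStalk j (j p) (Set.mem_range_self p)).hom s = (toStalk j (j p) (Set.mem_range_self p)).hom f := by
  let := (toStalk j (j p) (Set.mem_range_self p)).hom.toAlgebra
  have : p.asIdeal.IsPrime := p.isPrime
  have := isLocalization_toStalk j p
  obtain ⟨⟨f, s⟩, h⟩ := IsLocalization.surj p.asIdeal.primeCompl z
  exact ⟨f, s, s.2, h⟩

/-- The extension of a prime to its localization is the maximal ideal. This supplies the
uniformizers used to compute orders. -/
theorem span_toStalk_isMaximal {p : Spec R} {f : R} (hf : p.asIdeal = Ideal.span {f}) :
    (Ideal.span {(toStalk j (j p) (Set.mem_range_self p)).hom f}).IsMaximal := by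
  let := (toStalk j (j p) (Set.mem_range_self p)).hom.toAlgebra
  have : p.asIdeal.IsPrime := p.isPrime
  have := isLocalization_toStalk j p
  have h := IsLocalization.AtPrime.map_eq_maximalIdeal p.asIdeal (X.presheaf.stalk (j p))
  have h2 : p.asIdeal.map (algebraMap R (X.presheaf.stalk (j p))) =
      Ideal.span {(toStalk j (j p) (Set.mem_range_self p)).hom f} := by
    rw [hf, Ideal.map_span, Set.image_singleton]; rfl
  rw [← h2, h]
  infer_instance

variable [IsIntegral X]

theorem genericPoint_mem_range (p : Spec R) : genericPoint X ∈ Set.range j :=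
  (genericPoint_specializes (j p)).mem_open j.isOpenEmbedding.isOpen_range (Set.mem_range_self p)

variable [Nonempty (Spec R)]

theorem genericPoint_mem_chart : genericPoint X ∈ Set.range j :=
  genericPoint_mem_range j (Classical.arbitrary _)

/-- The function on an affine chart, as a rational function. -/
noncomputable def toFunctionField : R →+* X.functionField :=
  (toStalk j (genericPoint X) (genericPoint_mem_chart j)).hom

theorem algebraMap_toStalk (x : X) (hx : x ∈ Set.range j) (f : R) :
    algebraMap (X.presheaf.stalk x) X.functionField ((toStalk j x hx).hom f) =
      toFunctionField j f :=
  congr($(toStalk_stalkSpecializes j ((genericPoint_spec X).specializes trivial)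
    (genericPoint_mem_chart j) hx).hom f)

theorem toFunctionField_comp {S : CommRingCat.{0}} [Nonempty (Spec S)] (θ : R ⟶ S)
    (i : Spec S ⟶ X) [IsOpenImmersion i] (h : Spec.map θ ≫ j = i) (f : R) :
    toFunctionField i (θ.hom f) = toFunctionField j f :=
  congr($(toStalk_comp j θ i h (genericPoint X) (genericPoint_mem_chart i)
    (genericPoint_mem_chart j)).hom f)

theorem toFunctionField_injective [IsDomain R] : Function.Injective (toFunctionField j) := by
  -- The point is generalized so that it can be replaced by `j p`, although the type of the stalk
  -- depends on it. The corresponding prime is then the zero ideal.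
  have h : ∀ {x : X} (hx : x ∈ Set.range j), x = genericPoint X →
      Function.Injective (toStalk j x hx).hom := by
    rintro _ ⟨p, rfl⟩ hp
    have hp0 : p.asIdeal = ⊥ := by
      let o : Spec R := (⟨⊥, Ideal.isPrime_bot⟩ : PrimeSpectrum R)
      have h1 : p ⤳ o := j.isOpenEmbedding.isInducing.specializes_iff.1
        (hp ▸ genericPoint_specializes _)
      exact le_bot_iff.1 ((PrimeSpectrum.le_iff_specializes p o).2 h1)
    let := (toStalk j (j p) (Set.mem_range_self p)).hom.toAlgebra
    have : p.asIdeal.IsPrime := p.isPrime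
    have := isLocalization_toStalk j p
    refine IsLocalization.injective (M := p.asIdeal.primeCompl) _ fun s hs => ?_
    refine mem_nonZeroDivisors_of_ne_zero ?_
    rintro rfl
    exact hs (zero_mem _)
  exact h _ rfl

theorem exists_toFunctionField_mul_eq [IsDomain R] (z : X.functionField) :
    ∃ f s : R, s ≠ 0 ∧ z * toFunctionField j s = toFunctionField j f := by
  have h : ∀ {x : X} (hx : x ∈ Set.range j) (z : X.presheaf.stalk x),
      ∃ f s : R, s ≠ 0 ∧ z * (toStalk j x hx).hom s = (toStalk j x hx).hom f := by
    rintro _ ⟨p, rfl⟩ z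
    obtain ⟨f, s, hs, h⟩ := exists_toStalk_mul_eq j z
    exact ⟨f, s, fun h => hs (h ▸ zero_mem _), h⟩
  exact h _ z

theorem toStalk_injective [IsDomain R] (x : X) (hx : x ∈ Set.range j) :
    Function.Injective (toStalk j x hx).hom := fun a b h =>
  toFunctionField_injective j (by
    rw [← algebraMap_toStalk j x hx, h, algebraMap_toStalk j x hx])

/-! ### Orders of vanishing in affine charts -/

section Order

variable [IsLocallyNoetherian X]

theorem ord_eq_zero_of_isUnit {x : X} {u : X.presheaf.stalk x} (hu : IsUnit u) :
    Scheme.ord (algebraMap (X.presheaf.stalk x) X.functionField u) x = 0 := by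
  by_cases hx : Order.coheight x = 1
  · rw [Scheme.ord_eq_iff hx]
    · have := krullDimLE_of_coheight_le hx.le
      exact Ring.ordFrac_of_isUnit hu
    · rw [map_ne_zero_iff _ (IsFractionRing.injective _ _)]
      exact hu.ne_zero
  -- Outside codimension one, `Scheme.ord` has the default value `0`.
  · exact Scheme.ord_eq_zero_of_coheight_neq_one hx _

theorem ord_algebraMap_nonneg {x : X} {u : X.presheaf.stalk x} (hu : u ≠ 0) :
    0 ≤ Scheme.ord (algebraMap (X.presheaf.stalk x) X.functionField u) x := by
  by_cases hx : Order.coheight x = 1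
  · rw [Scheme.le_ord_iff hx]
    · have := krullDimLE_of_coheight_le hx.le
      exact Ring.ordFrac_ge_one_of_ne_zero hu
    · rwa [map_ne_zero_iff _ (IsFractionRing.injective _ _)]
  · rw [Scheme.ord_eq_zero_of_coheight_neq_one hx]

/-- The order of `u` is the length of the local ring modulo `u`. Here this quotient is a field, a
simple module of length one. -/
theorem ord_eq_one_of_isMaximal {x : X} (hx : Order.coheight x = 1) {u : X.presheaf.stalk x}
    (hu0 : u ≠ 0) (hu : (Ideal.span {u}).IsMaximal) :
    Scheme.ord (algebraMap (X.presheaf.stalk x) X.functionField u) x = 1 := by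
  rw [Scheme.ord_eq_iff hx]
  · have := krullDimLE_of_coheight_le hx.le
    refine (Ring.ordFrac_eq_ord _ hu0).trans ?_
    refine Ring.ordMonoidWithZeroHom_eq_coe _ (mem_nonZeroDivisors_of_ne_zero hu0) (n := 1) ?_
    rw [Ring.ord, Nat.cast_one, Module.length_eq_one_iff,
      isSimpleModule_iff_isSimpleModule_of_algebraMap_surjective
        (S := X.presheaf.stalk x ⧸ Ideal.span {u}) Ideal.Quotient.mk_surjective]
    let := Ideal.Quotient.field (Ideal.span {u})
    exact instIsSimpleModule _
  · rwa [map_ne_zero_iff _ (IsFractionRing.injective _ _)]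

theorem ord_toFunctionField_of_notMem {p : Spec R} {f : R} (hf : f ∉ p.asIdeal) :
    Scheme.ord (toFunctionField j f) (j p) = 0 := by
  rw [← algebraMap_toStalk j (j p) (Set.mem_range_self p)]
  exact ord_eq_zero_of_isUnit (isUnit_toStalk j hf)

variable [IsDomain R]

theorem ord_toFunctionField_nonneg {f : R} (hf : f ≠ 0) (p : Spec R) :
    0 ≤ Scheme.ord (toFunctionField j f) (j p) := by
  rw [← algebraMap_toStalk j (j p) (Set.mem_range_self p)]
  refine ord_algebraMap_nonneg ?_
  rwa [map_ne_zero_iff _ (toStalk_injective j _ _)]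

theorem ord_toFunctionField_of_span {p : Spec R} (hp : Order.coheight (j p) = 1) {f : R}
    (hf : f ≠ 0) (h : p.asIdeal = Ideal.span {f}) :
    Scheme.ord (toFunctionField j f) (j p) = 1 := by
  rw [← algebraMap_toStalk j (j p) (Set.mem_range_self p)]
  refine ord_eq_one_of_isMaximal hp ?_ (span_toStalk_isMaximal j h)
  rwa [map_ne_zero_iff _ (toStalk_injective j _ _)]

end Order

end LocalRings

end LogPair

/-! ### Laurent polynomials -/

namespace LogPair.SmoothFan

/-- The fan of affine space, consisting of the faces of the positive orthant. -/
def affineSpace (n : ℕ) : SmoothFan n (Fin n) where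
  ray i := Pi.single i 1
  cones := Finset.univ
  empty_mem := Finset.mem_univ _
  mem_of_subset _ _ _ _ := Finset.mem_univ _
  unimodular _ _ i _ := ⟨Pi.single i 1, by simp, fun j _ hj => by simp [hj.symm]⟩
  separated σ _ τ _ := by
    refine ⟨fun i => if i ∈ σ then (if i ∈ τ then 0 else 1) else -1, ?_, ?_, ?_⟩ <;>
      simp +contextual

/-- The cone of affine space is the monoid of exponents of monomials. -/
noncomputable def dualAffineSpace (n : ℕ) :
    (Fin n →₀ ℕ) ≃+ (affineSpace n).dual Finset.univ where
  toFun u := ⟨fun i => u i, fun i _ => by simp [affineSpace]⟩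
  invFun m := Finsupp.equivFunOnFinite.symm fun i => (m.1 i).toNat
  left_inv u := by ext; simp
  right_inv m := by
    ext i
    have := m.2 i (Finset.mem_univ i)
    simpa [affineSpace] using this
  map_add' u v := by ext; simp

/-- The Laurent polynomial ring is the chart of the zero cone in the fan of affine space, hence the
localization of a polynomial ring at a monomial, and factoriality passes to localizations. -/
theorem uniqueFactorizationMonoid_affineSpace (n : ℕ) :
    UniqueFactorizationMonoid ((affineSpace n).CoordRing ∅) := by
  have : UniqueFactorizationMonoid ((affineSpace n).CoordRing Finset.univ) :=
    MulEquiv.uniqueFactorizationMonoid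
      (AddMonoidAlgebra.domCongr ℚ ℚ (dualAffineSpace n)).toMulEquiv
      (inferInstanceAs (UniqueFactorizationMonoid (MvPolynomial (Fin n) ℚ)))
  obtain ⟨m, h0, h1⟩ := (affineSpace n).exists_face (Finset.mem_univ Finset.univ)
    (Finset.empty_subset _)
  let := ((affineSpace n).restrict (Finset.empty_subset Finset.univ)).toAlgebra
  have := (affineSpace n).isLocalization (Finset.empty_subset _) m h0 h1
  exact UniqueFactorizationMonoid.of_isLocalization
    (Submonoid.powers (AddMonoidAlgebra.single m 1 : (affineSpace n).CoordRing Finset.univ)) _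

variable {n : ℕ} {ι : Type} [DecidableEq ι] (Δ : SmoothFan n ι)

/-- The characters are the exponents of the functions on the torus. -/
def dualEmpty : (Fin n → ℤ) ≃+ Δ.dual ∅ where
  toFun m := ⟨m, fun _ h => absurd h (Finset.notMem_empty _)⟩
  invFun m := m.1
  left_inv _ := rfl
  right_inv _ := rfl
  map_add' _ _ := rfl

/-- The coordinate ring of the torus depends only on `n`, not on the fan. -/
instance : UniqueFactorizationMonoid (Δ.CoordRing ∅) :=
  have := uniqueFactorizationMonoid_affineSpace n
  MulEquiv.uniqueFactorizationMonoid
    (AddMonoidAlgebra.domCongr ℚ ℚ ((affineSpace n).dualEmpty.symm.trans Δ.dualEmpty)).toMulEquiv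
    inferInstance

end LogPair.SmoothFan

/-- Let `f * g = 1`. If the supports are not both singletons, two distinct pairs of exponents have
unique sums. Each such sum carries a nonzero coefficient of `1`, so both sums are `0`, contradicting
uniqueness. -/
theorem AddMonoidAlgebra.exists_eq_single_of_isUnit {k A : Type*} [Field k] [AddCommGroup A]
    [TwoUniqueSums A] {f : AddMonoidAlgebra k A} (hf : IsUnit f) :
    ∃ (a : A) (c : k), c ≠ 0 ∧ f = AddMonoidAlgebra.single a c := by
  classical
  obtain ⟨g, hg⟩ := hf.exists_right_inv
  have hf0 : f.coeff.support.Nonempty := by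
    rw [Finsupp.support_nonempty_iff]
    exact fun h => hf.ne_zero (AddMonoidAlgebra.coeff_eq_zero.1 h)
  have hg0 : g.coeff.support.Nonempty := by
    rw [Finsupp.support_nonempty_iff]
    intro h
    rw [AddMonoidAlgebra.coeff_eq_zero.1 h, mul_zero] at hg
    exact zero_ne_one hg
  have hcard : f.coeff.support.card * g.coeff.support.card ≤ 1 := by
    by_contra! hlt
    obtain ⟨p, hp, q, hq, hpq, hpu, hqu⟩ :=
      TwoUniqueSums.uniqueAdd_of_one_lt_card hlt
    rw [Finset.mem_product] at hp hq
    have key : ∀ p : A × A, p.1 ∈ f.coeff.support → p.2 ∈ g.coeff.support →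
        UniqueAdd f.coeff.support g.coeff.support p.1 p.2 → p.1 + p.2 = 0 := by
      intro p h1 h2 hu
      by_contra hne
      have h3 : (f * g).coeff (p.1 + p.2) = f.coeff p.1 * g.coeff p.2 :=
        AddMonoidAlgebra.coeff_mul_add_of_uniqueAdd hu
      rw [hg, AddMonoidAlgebra.one_def, AddMonoidAlgebra.coeff_single,
        Finsupp.single_eq_of_ne hne] at h3
      exact mul_ne_zero (Finsupp.mem_support_iff.1 h1) (Finsupp.mem_support_iff.1 h2) h3.symm
    have h := hqu hp.1 hp.2 ((key p hp.1 hp.2 hpu).trans (key q hq.1 hq.2 hqu).symm)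
    exact hpq (Prod.ext h.1 h.2)
  have h1 : f.coeff.support.card = 1 := by
    have := hf0.card_pos
    have := hg0.card_pos
    nlinarith
  obtain ⟨a, c, hc, h⟩ := Finsupp.card_support_eq_one'.1 h1
  exact ⟨a, c, hc, AddMonoidAlgebra.coeff_injective h⟩

namespace LogPair.SmoothFan

variable {n : ℕ} {ι : Type} [DecidableEq ι] (Δ : SmoothFan n ι)

/-! ### Orbit closures in charts -/

/-- Restriction of functions from the chart of `σ` to the closure of the orbit of `A`. -/
noncomputable def orbitRes (A σ : Finset ι) (h : A ⊆ σ) :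
    Δ.CoordRing σ →ₐ[ℚ] AddMonoidAlgebra ℚ (Fin n → ℤ) :=
  AddMonoidAlgebra.lift ℚ _ _
    { toFun := fun m => if ∀ ρ ∈ A, m.toAdd.1 ⬝ᵥ Δ.ray ρ = 0 then
          AddMonoidAlgebra.single m.toAdd.1 1 else 0
      map_one' := by simp [AddMonoidAlgebra.one_def]
      map_mul' := fun a b => by
        have hab : (∀ ρ ∈ A, (a * b).toAdd.1 ⬝ᵥ Δ.ray ρ = 0) ↔
            (∀ ρ ∈ A, a.toAdd.1 ⬝ᵥ Δ.ray ρ = 0) ∧ ∀ ρ ∈ A, b.toAdd.1 ⬝ᵥ Δ.ray ρ = 0 := by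
          rw [← forall₂_and]
          refine forall₂_congr fun ρ hρ => ?_
          have ha := a.toAdd.2 ρ (h hρ)
          have hb := b.toAdd.2 ρ (h hρ)
          have : (a * b).toAdd.1 ⬝ᵥ Δ.ray ρ = a.toAdd.1 ⬝ᵥ Δ.ray ρ + b.toAdd.1 ⬝ᵥ Δ.ray ρ := by
            rw [← add_dotProduct]; rfl
          omega
        simp only [hab, ite_zero_mul_ite_zero, AddMonoidAlgebra.single_mul_single]
        simp }

theorem orbitRes_single {A σ : Finset ι} (h : A ⊆ σ) (m : Δ.dual σ) (r : ℚ) :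
    Δ.orbitRes A σ h (AddMonoidAlgebra.single m r) =
      if ∀ ρ ∈ A, m.1 ⬝ᵥ Δ.ray ρ = 0 then AddMonoidAlgebra.single m.1 r else 0 := by
  rw [orbitRes, AddMonoidAlgebra.lift_single]
  simp only [MonoidHom.coe_mk, OneHom.coe_mk, toAdd_ofAdd]
  split_ifs <;> simp

theorem coeff_orbitRes {A σ : Finset ι} (h : A ⊆ σ) (f : Δ.CoordRing σ) (m : Δ.dual σ)
    (hm : ∀ ρ ∈ A, m.1 ⬝ᵥ Δ.ray ρ = 0) : (Δ.orbitRes A σ h f).coeff m.1 = f.coeff m := by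
  induction f using AddMonoidAlgebra.induction_linear with
  | zero => simp
  | add f g hf hg => simp [hf, hg]
  | single u r =>
    rw [orbitRes_single]
    by_cases hu : u = m
    · subst hu; simp [if_pos hm]
    · have hu' : u.1 ≠ m.1 := fun h => hu (Subtype.ext h)
      split_ifs <;> simp [hu, hu']

/-- The map `orbitRes` keeps or kills each monomial and keeps distinct exponents apart, so its
kernel is a monomial ideal. -/
theorem orbitRes_eq_zero_iff {A σ : Finset ι} (h : A ⊆ σ) (f : Δ.CoordRing σ) :
    Δ.orbitRes A σ h f = 0 ↔ ∀ m ∈ f.coeff.support, ∃ ρ ∈ A, 0 < m.1 ⬝ᵥ Δ.ray ρ := by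
  constructor
  · intro hf m hm
    by_contra! hA
    have h0 : ∀ ρ ∈ A, m.1 ⬝ᵥ Δ.ray ρ = 0 := fun ρ hρ => le_antisymm (hA ρ hρ) (m.2 ρ (h hρ))
    have := Δ.coeff_orbitRes h f m h0
    rw [hf] at this
    exact Finsupp.mem_support_iff.1 hm this.symm
  · intro hf
    rw [← AddMonoidAlgebra.sum_coeff_single f, Finsupp.sum, map_sum]
    refine Finset.sum_eq_zero fun m hm => ?_
    obtain ⟨ρ, hρ, hpos⟩ := hf m hm
    rw [orbitRes_single, if_neg fun h0 => hpos.ne' (h0 ρ hρ)]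

theorem orbitRes_restrict {A τ σ : Finset ι} (h : A ⊆ τ) (h' : τ ⊆ σ) (f : Δ.CoordRing σ) :
    Δ.orbitRes A τ h (Δ.restrict h' f) = Δ.orbitRes A σ (h.trans h') f := by
  induction f using AddMonoidAlgebra.induction_linear with
  | zero => simp
  | add f g hf hg => simp [hf, hg]
  | single u r => rw [restrict_single, orbitRes_single, orbitRes_single]

theorem rayIdeal_eq_ker_orbitRes (ρ : ι) :
    Δ.rayIdeal ρ = RingHom.ker (Δ.orbitRes {ρ} {ρ} subset_rfl) := by
  have h : ∀ f, Δ.rayRes ρ f = Δ.orbitRes {ρ} {ρ} subset_rfl f := fun f => by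
    induction f using AddMonoidAlgebra.induction_linear with
    | zero => rw [map_zero, map_zero]
    | add f g hf hg => rw [map_add, map_add, hf, hg]
    | single m r => rw [rayRes_single, orbitRes_single]; simp
  rw [rayIdeal_eq_ker]
  ext f
  change Δ.rayRes ρ f = 0 ↔ Δ.orbitRes {ρ} {ρ} subset_rfl f = 0
  rw [h]

/-- The generic point of the orbit of `A` in the chart of `σ`. -/
noncomputable def orbitPoint (A σ : Finset ι) (h : A ⊆ σ) : Spec (.of (Δ.CoordRing σ)) :=
  ⟨RingHom.ker (Δ.orbitRes A σ h), RingHom.ker_isPrime _⟩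

theorem charts_map_orbitPoint {A : Finset ι} {τ σ : Δ.Cone} (f : τ ⟶ σ) (h : A ⊆ τ.1) :
    Δ.charts.map f (Δ.orbitPoint A τ.1 h) = Δ.orbitPoint A σ.1 (h.trans (leOfHom f)) :=
  PrimeSpectrum.ext (Ideal.ext fun g => by
    change Δ.orbitRes A τ.1 h (Δ.restrict (leOfHom f) g) = 0 ↔ Δ.orbitRes A σ.1 _ g = 0
    rw [orbitRes_restrict])

theorem chartMap_orbitPoint {A : Finset ι} {τ σ : Δ.Cone} (hτ : τ.1 ⊆ σ.1) (h : A ⊆ τ.1) :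
    Δ.chartMap σ (Δ.orbitPoint A σ.1 (h.trans hτ)) = Δ.chartMap τ (Δ.orbitPoint A τ.1 h) := by
  rw [← Δ.chartMap_charts_map (homOfLE hτ : τ ⟶ σ), charts_map_orbitPoint]

/-- This makes the generic point of an invariant divisor computable in every chart that meets the
divisor, not only in the chart of the ray itself. -/
theorem rayPoint_eq {ρ : ι} (hρ : {ρ} ∈ Δ.cones) {σ : Δ.Cone} (h : ρ ∈ σ.1) :
    Δ.rayPoint hρ = Δ.chartMap σ (Δ.orbitPoint {ρ} σ.1 (Finset.singleton_subset_iff.2 h)) := by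
  rw [Δ.chartMap_orbitPoint (τ := ⟨{ρ}, hρ⟩) (Finset.singleton_subset_iff.2 h) subset_rfl]
  unfold rayPoint orbitPoint
  simp only [rayIdeal_eq_ker_orbitRes]

theorem exists_chartMap_eq (x : Δ.toricScheme) : ∃ σ p, Δ.chartMap σ p = x :=
  Scheme.IsLocallyDirected.ι_jointly_surjective Δ.charts x

theorem chartMap_eq_iff {σ τ : Δ.Cone} {p : Spec (.of (Δ.CoordRing σ.1))}
    {q : Spec (.of (Δ.CoordRing τ.1))} : Δ.chartMap σ p = Δ.chartMap τ q ↔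
      ∃ (υ : Δ.Cone) (f : υ ⟶ σ) (g : υ ⟶ τ) (x : Spec (.of (Δ.CoordRing υ.1))),
        Δ.charts.map f x = p ∧ Δ.charts.map g x = q :=
  Scheme.IsLocallyDirected.ι_eq_ι_iff Δ.charts

/-- The character `m` as a function on the chart of `σ`. -/
noncomputable abbrev monomial {σ : Finset ι} (m : Fin n → ℤ) (hm : m ∈ Δ.dual σ) : Δ.CoordRing σ :=
  AddMonoidAlgebra.single ⟨m, hm⟩ 1

/-- On the chart of `σ` the character `-m` is regular as well, so `m` is invertible there and lies
in no prime ideal. -/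
theorem range_charts_map_of_face {σ τ : Δ.Cone} (f : σ ⟶ τ) {m : Fin n → ℤ} (hm : m ∈ Δ.dual τ.1)
    (h0 : ∀ ρ ∈ σ.1, m ⬝ᵥ Δ.ray ρ = 0) {x : Spec (.of (Δ.CoordRing σ.1))} :
    Δ.monomial m hm ∉ (Δ.charts.map f x).asIdeal := fun h => by
  have hneg : -m ∈ Δ.dual σ.1 := fun ρ hρ => by rw [neg_dotProduct, h0 ρ hρ, neg_zero]
  have h1 : Δ.monomial m (Δ.dual_anti (leOfHom f) hm) ∈ x.asIdeal := by
    have h2 : Δ.restrict (leOfHom f) (Δ.monomial m hm) ∈ x.asIdeal := h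
    rwa [restrict_single] at h2
  have h2 := Ideal.mul_mem_left _ (Δ.monomial (-m) hneg) h1
  rw [AddMonoidAlgebra.single_mul_single] at h2
  refine x.isPrime.ne_top ((Ideal.eq_top_iff_one _).2 ?_)
  convert h2 using 1
  rw [AddMonoidAlgebra.one_def]
  congr 1
  · ext; simp
  · simp

/-- Charts are glued only along charts of common faces. If `ρ` is not in `σ`, the only common face
with `{ρ}` is the zero cone; all characters are invertible on its chart, whereas a character with
value `1` on `ρ` vanishes at the generic point of the divisor. -/
theorem rayPoint_mem_range_chartMap {ρ : ι} (hρ : {ρ} ∈ Δ.cones) (σ : Δ.Cone) :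
    Δ.rayPoint hρ ∈ Set.range (Δ.chartMap σ) ↔ ρ ∈ σ.1 := by
  refine ⟨?_, fun h => ⟨_, (Δ.rayPoint_eq hρ h).symm⟩⟩
  rintro ⟨p, hp⟩
  rw [Δ.rayPoint_eq hρ (σ := ⟨{ρ}, hρ⟩) (Finset.mem_singleton_self ρ), chartMap_eq_iff] at hp
  obtain ⟨υ, f, g, x, -, hx⟩ := hp
  by_contra hn
  have hυ : ∀ r ∈ υ.1, False := fun r hr => by
    have h1 := Finset.mem_singleton.1 (leOfHom g hr)
    exact hn (h1 ▸ leOfHom f hr)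
  obtain ⟨e, he, -⟩ := Δ.unimodular _ hρ ρ (Finset.mem_singleton_self ρ)
  have hed : e ∈ Δ.dual {ρ} := fun r hr => by
    rw [Finset.mem_singleton.1 hr, he]; exact zero_le_one
  refine Δ.range_charts_map_of_face g hed (fun r hr => (hυ r hr).elim) (x := x) ?_
  rw [hx]
  refine (Δ.orbitRes_eq_zero_iff _ _).2 fun m hm => ⟨ρ, Finset.mem_singleton_self ρ, ?_⟩
  have := AddMonoidAlgebra.coeff_single (⟨e, hed⟩ : Δ.dual {ρ}) (1 : ℚ)
  rw [monomial, AddMonoidAlgebra.coeff_single] at hm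
  rw [Finset.mem_singleton.1 (Finsupp.support_single_subset hm), he]
  exact one_pos

theorem rayPoint_injective {ρ ρ' : ι} (hρ : {ρ} ∈ Δ.cones) (hρ' : {ρ'} ∈ Δ.cones)
    (h : Δ.rayPoint hρ = Δ.rayPoint hρ') : ρ = ρ' := by
  have := (Δ.rayPoint_mem_range_chartMap hρ ⟨{ρ'}, hρ'⟩).1
    (h ▸ (Δ.rayPoint_mem_range_chartMap hρ' ⟨{ρ'}, hρ'⟩).2 (Finset.mem_singleton_self _))
  exact Finset.mem_singleton.1 this

/-- The closure of an orbit, in a chart. -/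
theorem chartMap_mem_closure_rayPoint {ρ : ι} (hρ : {ρ} ∈ Δ.cones) (σ : Δ.Cone)
    (p : Spec (.of (Δ.CoordRing σ.1))) :
    Δ.chartMap σ p ∈ closure {Δ.rayPoint hρ} ↔
      ∃ h : ρ ∈ σ.1, (Δ.orbitPoint {ρ} σ.1 (Finset.singleton_subset_iff.2 h)).asIdeal ≤ p.asIdeal := by
  rw [← specializes_iff_mem_closure]
  constructor
  · intro h
    have hσ := (Δ.rayPoint_mem_range_chartMap hρ σ).1
      (h.mem_open (Δ.chartMap σ).isOpenEmbedding.isOpen_range ⟨p, rfl⟩)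
    refine ⟨hσ, ?_⟩
    rw [Δ.rayPoint_eq hρ hσ] at h
    exact (PrimeSpectrum.le_iff_specializes _ p).2
      ((Δ.chartMap σ).isOpenEmbedding.isInducing.specializes_iff.1 h)
  · rintro ⟨hσ, h⟩
    rw [Δ.rayPoint_eq hρ hσ]
    exact Specializes.map ((PrimeSpectrum.le_iff_specializes _ p).1 h) (Δ.chartMap σ).continuous

end LogPair.SmoothFan

namespace LogPair

/-! ### Rational functions on toric schemes and their divisors -/

theorem ord_one {X : Scheme.{0}} [IsIntegral X] [IsLocallyNoetherian X] (z : X) :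
    Scheme.ord (1 : X.functionField) z = 0 := by
  have h1 := Scheme.ord_mul (x := z) (one_ne_zero (α := X.functionField)) one_ne_zero
  rw [one_mul] at h1
  omega

namespace SmoothFan

variable {n : ℕ} {ι : Type} [DecidableEq ι] (Δ : SmoothFan n ι)

instance (σ : Finset ι) : Nonempty (Spec (.of (Δ.CoordRing σ))) := ⟨Δ.zeroPoint σ⟩

/-- The open torus. -/
def torus : Δ.Cone := ⟨∅, Δ.empty_mem⟩

theorem torus_subset (σ : Finset ι) : Δ.torus.1 ⊆ σ := Finset.empty_subset σ

theorem mem_dual_torus (m : Fin n → ℤ) : m ∈ Δ.dual Δ.torus.1 :=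
  fun _ h => absurd h (Finset.notMem_empty _)

/-- A function on the chart of `σ`, as a rational function. -/
noncomputable def fn (σ : Δ.Cone) : Δ.CoordRing σ.1 →+* Δ.toricScheme.functionField :=
  toFunctionField (Δ.chartMap σ)

theorem fn_injective (σ : Δ.Cone) : Function.Injective (Δ.fn σ) :=
  toFunctionField_injective (Δ.chartMap σ)

theorem fn_restrict {τ σ : Δ.Cone} (h : τ.1 ⊆ σ.1) (f : Δ.CoordRing σ.1) :
    Δ.fn τ (Δ.restrict h f) = Δ.fn σ f :=
  toFunctionField_comp (Δ.chartMap σ) (CommRingCat.ofHom (Δ.restrict h)) (Δ.chartMap τ)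
    (colimit.w Δ.charts (homOfLE h : τ ⟶ σ)) f

/-- The character `m` as a rational function. -/
noncomputable def char (m : Fin n → ℤ) : Δ.toricScheme.functionField :=
  Δ.fn Δ.torus (Δ.monomial m (Δ.mem_dual_torus m))

theorem fn_monomial (σ : Δ.Cone) {m : Fin n → ℤ} (hm : m ∈ Δ.dual σ.1) :
    Δ.fn σ (Δ.monomial m hm) = Δ.char m := by
  rw [← Δ.fn_restrict (τ := Δ.torus) (Δ.torus_subset _), restrict_single]
  rfl

theorem char_zero : Δ.char 0 = 1 :=
  map_one (Δ.fn Δ.torus)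

theorem char_add (a b : Fin n → ℤ) : Δ.char (a + b) = Δ.char a * Δ.char b := by
  rw [char, char, char, ← map_mul, AddMonoidAlgebra.single_mul_single, one_mul]
  rfl

theorem char_ne_zero (m : Fin n → ℤ) : Δ.char m ≠ 0 := by
  rw [char, Ne, map_eq_zero_iff _ (Δ.fn_injective _)]
  simp

/-- The order of characters at a point. -/
noncomputable def ordChar (z : Δ.toricScheme) : (Fin n → ℤ) →+ ℤ where
  toFun m := Scheme.ord (Δ.char m) z
  map_zero' := by rw [char_zero, ord_one]
  map_add' a b := by rw [char_add, Scheme.ord_mul (Δ.char_ne_zero a) (Δ.char_ne_zero b)]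

theorem ord_char_eq_zero (σ : Δ.Cone) (p : Spec (.of (Δ.CoordRing σ.1))) {m : Fin n → ℤ}
    (hm : m ∈ Δ.dual σ.1) (h : Δ.monomial m hm ∉ p.asIdeal) :
    Scheme.ord (Δ.char m) (Δ.chartMap σ p) = 0 := by
  rw [← Δ.fn_monomial σ hm]
  exact ord_toFunctionField_of_notMem (Δ.chartMap σ) h

theorem monomial_notMem_torus (m : Fin n → ℤ) (p : Spec (.of (Δ.CoordRing Δ.torus.1))) :
    Δ.monomial m (Δ.mem_dual_torus m) ∉ p.asIdeal := by
  have := Δ.range_charts_map_of_face (𝟙 Δ.torus) (Δ.mem_dual_torus m)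
    (fun ρ h => absurd h (Finset.notMem_empty _)) (x := p)
  rwa [Δ.charts.map_id] at this

theorem ord_char_torus (m : Fin n → ℤ) (p : Spec (.of (Δ.CoordRing Δ.torus.1))) :
    Scheme.ord (Δ.char m) (Δ.chartMap Δ.torus p) = 0 :=
  Δ.ord_char_eq_zero _ _ _ (Δ.monomial_notMem_torus m p)

theorem monomial_mem_orbitPoint {A σ : Finset ι} (h : A ⊆ σ) {m : Fin n → ℤ} (hm : m ∈ Δ.dual σ) :
    Δ.monomial m hm ∈ (Δ.orbitPoint A σ h).asIdeal ↔ ∃ ρ ∈ A, 0 < m ⬝ᵥ Δ.ray ρ := by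
  refine (Δ.orbitRes_eq_zero_iff h _).trans ?_
  rw [AddMonoidAlgebra.coeff_single, Finsupp.support_single _ (one_ne_zero (α := ℚ))]
  simp

/-- A character that is a local equation of the divisor of `ρ` in the chart of `σ` generates its
ideal. -/
theorem orbitPoint_singleton_eq_span {ρ : ι} {σ : Finset ι} (h : {ρ} ⊆ σ) {e : Fin n → ℤ}
    (he : e ⬝ᵥ Δ.ray ρ = 1) (h0 : ∀ ρ' ∈ σ, ρ' ≠ ρ → e ⬝ᵥ Δ.ray ρ' = 0) (hed : e ∈ Δ.dual σ) :
    (Δ.orbitPoint {ρ} σ h).asIdeal = Ideal.span {Δ.monomial e hed} := by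
  apply le_antisymm
  · intro f hf
    have hf := (Δ.orbitRes_eq_zero_iff h f).1 hf
    rw [← AddMonoidAlgebra.sum_coeff_single f, Finsupp.sum]
    refine Ideal.sum_mem _ fun m hm => ?_
    obtain ⟨ρ', hρ', hpos⟩ := hf m hm
    obtain rfl := Finset.mem_singleton.1 hρ'
    have hd : m.1 - e ∈ Δ.dual σ := fun r hr => by
      rw [sub_dotProduct]
      by_cases hne : r = ρ'
      · rw [hne, he]; omega
      · rw [h0 r hr hne, sub_zero]; exact m.2 r hr
    refine Ideal.mem_span_singleton.2 ⟨AddMonoidAlgebra.single ⟨_, hd⟩ (f.coeff m), ?_⟩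
    rw [AddMonoidAlgebra.single_mul_single]
    congr 1
    · ext; simp
    · simp
  · rw [Ideal.span_le, Set.singleton_subset_iff]
    exact (Δ.monomial_mem_orbitPoint h hed).2 ⟨ρ, Finset.mem_singleton_self ρ, he ▸ one_pos⟩

theorem exists_dual_ray (σ : Δ.Cone) {ρ : ι} (hρ : ρ ∈ σ.1) : ∃ e ∈ Δ.dual σ.1,
    e ⬝ᵥ Δ.ray ρ = 1 ∧ ∀ ρ' ∈ σ.1, ρ' ≠ ρ → e ⬝ᵥ Δ.ray ρ' = 0 := by
  obtain ⟨e, he, h0⟩ := Δ.unimodular _ σ.2 ρ hρ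
  refine ⟨e, fun r hr => ?_, he, h0⟩
  by_cases hne : r = ρ
  · rw [hne, he]; exact zero_le_one
  · rw [h0 r hr hne]

/-- A character `e` with value `1` on `ρ` is a uniformizer. Subtracting the appropriate multiple of
`e` from `m` leaves a character that is trivial on `ρ`, hence a unit at the point. -/
theorem ord_char_rayPoint {ρ : ι} (hρ : {ρ} ∈ Δ.cones) (m : Fin n → ℤ) :
    Scheme.ord (Δ.char m) (Δ.rayPoint hρ) = m ⬝ᵥ Δ.ray ρ := by
  let σ : Δ.Cone := ⟨{ρ}, hρ⟩
  have hσ := Δ.rayPoint_eq hρ (σ := σ) (Finset.mem_singleton_self ρ)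
  obtain ⟨e, hed, he, h0⟩ := Δ.exists_dual_ray σ (Finset.mem_singleton_self ρ)
  have h1 : Δ.ordChar (Δ.rayPoint hρ) e = 1 := by
    change Scheme.ord (Δ.char e) (Δ.rayPoint hρ) = 1
    rw [← Δ.fn_monomial σ hed, hσ]
    refine ord_toFunctionField_of_span (Δ.chartMap σ) ?_ ?_
      (Δ.orbitPoint_singleton_eq_span _ he h0 hed)
    · rw [← hσ, coheight_rayPoint]
    · exact AddMonoidAlgebra.single_ne_zero.2 one_ne_zero
  set k := m ⬝ᵥ Δ.ray ρ with hk
  have hm0 : (m - k • e) ⬝ᵥ Δ.ray ρ = 0 := by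
    rw [sub_dotProduct, smul_dotProduct, he, ← hk]; simp
  have hmd : m - k • e ∈ Δ.dual σ.1 := fun r hr => by
    rw [Finset.mem_singleton.1 hr, hm0]
  have h2 : Δ.ordChar (Δ.rayPoint hρ) (m - k • e) = 0 := by
    change Scheme.ord (Δ.char _) (Δ.rayPoint hρ) = 0
    rw [hσ]
    refine Δ.ord_char_eq_zero σ _ hmd fun h => ?_
    obtain ⟨r, hr, hpos⟩ := (Δ.monomial_mem_orbitPoint _ hmd).1 h
    rw [Finset.mem_singleton.1 hr, hm0] at hpos
    exact lt_irrefl _ hpos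
  rw [map_sub, map_zsmul, h1] at h2
  change Δ.ordChar (Δ.rayPoint hρ) m = k
  simpa [sub_eq_zero] using h2

theorem exists_restrict_eq {τ σ : Finset ι} (h : τ ⊆ σ) (f : Δ.CoordRing τ)
    (hf : ∀ m ∈ f.coeff.support, m.1 ∈ Δ.dual σ) : ∃ g, Δ.restrict h g = f := by
  rw [← RingHom.mem_range, ← AddMonoidAlgebra.sum_coeff_single f, Finsupp.sum]
  refine sum_mem fun m hm => ?_
  exact ⟨AddMonoidAlgebra.single ⟨m.1, hf m hm⟩ (f.coeff m), by rw [restrict_single]⟩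

theorem coeff_restrict {τ σ : Finset ι} (h : τ ⊆ σ) (f : Δ.CoordRing σ) (m : Δ.dual σ) :
    (Δ.restrict h f).coeff ⟨m.1, Δ.dual_anti h m.2⟩ = f.coeff m := by
  induction f using AddMonoidAlgebra.induction_linear with
  | zero => simp
  | add f g hf hg => simp [hf, hg]
  | single u r =>
    rw [restrict_single]
    by_cases hu : u = m
    · subst hu; simp
    · have hu' : u.1 ≠ m.1 := fun h => hu (Subtype.ext h)
      simp [hu, hu']

/-- The order of a Laurent polynomial along an invariant divisor is at most the order of each of its
monomials. -/
theorem ord_fn_rayPoint_le {ρ : ι} (hρ : {ρ} ∈ Δ.cones) {f : Δ.CoordRing Δ.torus.1}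
    {m : Δ.dual Δ.torus.1} (hm : m ∈ f.coeff.support) :
    Scheme.ord (Δ.fn Δ.torus f) (Δ.rayPoint hρ) ≤ m.1 ⬝ᵥ Δ.ray ρ := by
  let σ : Δ.Cone := ⟨{ρ}, hρ⟩
  obtain ⟨u, hu, hmin⟩ := Finset.exists_min_image f.coeff.support (fun m => m.1 ⬝ᵥ Δ.ray ρ) ⟨m, hm⟩
  refine le_trans (le_of_eq ?_) (hmin m hm)
  have hf0 : f ≠ 0 := by rintro rfl; simp at hm
  -- After division by a monomial `u` of minimal value on `ρ`, the function is regular on the chart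
  -- of `ρ`. Its constant coefficient is the nonzero coefficient of `f` at `u`, so it does not
  -- vanish along the divisor. The order of `f` is thus exactly this minimum.
  set g := f * Δ.monomial (-u.1) (Δ.mem_dual_torus _) with hg
  have hgc : ∀ v, g.coeff v = f.coeff ⟨v.1 + u.1, Δ.mem_dual_torus _⟩ := fun v => by
    refine (AddMonoidAlgebra.coeff_mul_single_eq_coeff_mul _ fun w _ => ?_).trans (mul_one _)
    rw [Subtype.ext_iff, Subtype.ext_iff]
    exact add_neg_eq_iff_eq_add
  obtain ⟨g', hg'⟩ := Δ.exists_restrict_eq (Δ.torus_subset {ρ}) g fun v hv r hr => by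
    have := hmin _ (Finsupp.mem_support_iff.2 (hgc v ▸ Finsupp.mem_support_iff.1 hv))
    rw [add_dotProduct] at this
    rw [Finset.mem_singleton.1 hr]
    omega
  have h1 : Scheme.ord (Δ.fn Δ.torus g) (Δ.rayPoint hρ) = 0 := by
    rw [← hg']
    refine (congrArg₂ _ (Δ.fn_restrict (τ := Δ.torus) (σ := σ) (Δ.torus_subset _) g') rfl).trans ?_
    rw [Δ.rayPoint_eq hρ (σ := σ) (Finset.mem_singleton_self ρ)]
    refine ord_toFunctionField_of_notMem (Δ.chartMap σ) fun h => ?_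
    have h2 := Δ.coeff_orbitRes (A := {ρ}) (σ := {ρ}) subset_rfl g' 0 (by simp)
    rw [show Δ.orbitRes {ρ} {ρ} subset_rfl g' = 0 from h, ← Δ.coeff_restrict (Δ.torus_subset {ρ}),
      hg', hgc] at h2
    refine Finsupp.mem_support_iff.1 hu ?_
    rw [show u = ⟨(0 : Fin n → ℤ) + u.1, Δ.mem_dual_torus _⟩ from Subtype.ext (zero_add _).symm]
    exact h2.symm
  rw [hg, map_mul, Scheme.ord_mul ((map_ne_zero_iff _ (Δ.fn_injective _)).2 hf0)
    ((map_ne_zero_iff _ (Δ.fn_injective _)).2 (AddMonoidAlgebra.single_ne_zero.2 one_ne_zero))] at h1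
  have h2 : Scheme.ord (Δ.fn Δ.torus (Δ.monomial (-u.1) (Δ.mem_dual_torus _))) (Δ.rayPoint hρ) =
    -u.1 ⬝ᵥ Δ.ray ρ := Δ.ord_char_rayPoint hρ (-u.1)
  rw [neg_dotProduct] at h2
  linarith

end SmoothFan
end LogPair

namespace LogPair.SmoothFan

variable {n : ℕ} {ι : Type} [DecidableEq ι] (Δ : SmoothFan n ι)

/-! ### Prime divisors of toric schemes -/

theorem height_eq_coheight (σ : Δ.Cone) (p : Spec (.of (Δ.CoordRing σ.1))) :
    p.asIdeal.height = Order.coheight (Δ.chartMap σ p) :=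
  (idealHeight_eq_coheight (.of (Δ.CoordRing σ.1)) p).trans
    (coheight_eq_of_isOpenImmersion (Δ.chartMap σ)).symm

/-- Inside a chart the torus is the locus where the product of the local equations of all rays is
invertible. Off the torus, some local equation therefore lies in the prime of `x`. It is a prime
element, and a prime ideal of height one containing it is generated by it. -/
theorem exists_rayPoint_eq {x : Δ.toricScheme} (hx : Order.coheight x = 1)
    (hx' : x ∉ Set.range (Δ.chartMap Δ.torus)) : ∃ ρ, ∃ hρ : {ρ} ∈ Δ.cones, x = Δ.rayPoint hρ := by
  obtain ⟨σ, p, rfl⟩ := Δ.exists_chartMap_eq x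
  have hp := p.isPrime
  have hmem : ∃ ρ ∈ σ.1, ∃ e, ∃ he : e ∈ Δ.dual σ.1, e ⬝ᵥ Δ.ray ρ = 1 ∧
      (∀ ρ' ∈ σ.1, ρ' ≠ ρ → e ⬝ᵥ Δ.ray ρ' = 0) ∧ Δ.monomial e he ∈ p.asIdeal := by
    by_contra! hn
    choose! e hed he h0 using fun ρ (hρ : ρ ∈ σ.1) => Δ.exists_dual_ray σ hρ
    have h1 : ∏ ρ ∈ σ.1.attach, Δ.monomial (e ρ) (hed ρ ρ.2) ∉ p.asIdeal := fun h => by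
      obtain ⟨ρ, -, hρ⟩ := hp.prod_mem_iff.1 h
      exact hn ρ ρ.2 (e ρ) (hed ρ ρ.2) (he ρ ρ.2) (h0 ρ ρ.2) hρ
    rw [AddMonoidAlgebra.prod_single, Finset.prod_const_one] at h1
    let f : Δ.torus ⟶ σ := homOfLE (Δ.torus_subset σ.1)
    refine hx' ?_
    have h2 : ∀ ρ ∈ σ.1, ρ ∉ Δ.torus.1 →
        (∑ r ∈ σ.1.attach, (⟨e r, hed r r.2⟩ : Δ.dual σ.1)).1 ⬝ᵥ Δ.ray ρ = 1 := fun ρ hρ _ => by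
      rw [AddSubmonoid.coe_finsetSum, sum_dotProduct, Finset.sum_eq_single ⟨ρ, hρ⟩]
      · exact he ρ hρ
      · intro r _ hr
        exact h0 r r.2 ρ hρ fun h => hr (Subtype.ext h.symm)
      · exact fun h => absurd (Finset.mem_attach _ _) h
    obtain ⟨q, hq⟩ := (Δ.range_charts_map f _
      (fun ρ h => absurd h (Finset.notMem_empty _)) h2 p).2 h1
    exact ⟨q, (Δ.chartMap_charts_map f q).symm.trans (congrArg _ hq)⟩
  obtain ⟨ρ, hρ, e, hed, he, h0, hep⟩ := hmem
  have hρ' : {ρ} ∈ Δ.cones := Δ.mem_of_subset _ σ.2 _ (Finset.singleton_subset_iff.2 hρ)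
  refine ⟨ρ, hρ', ?_⟩
  rw [Δ.rayPoint_eq hρ' hρ]
  have hspan := Δ.orbitPoint_singleton_eq_span (Finset.singleton_subset_iff.2 hρ) he h0 hed
  have hne : Δ.monomial e hed ≠ 0 := AddMonoidAlgebra.single_ne_zero.2 one_ne_zero
  have hprime : Prime (Δ.monomial e hed) := by
    rw [← Ideal.span_singleton_prime hne, ← hspan]
    exact (Δ.orbitPoint {ρ} σ.1 _).isPrime
  have hp1 : p.asIdeal.height = 1 := by rw [Δ.height_eq_coheight, hx]
  congr 1
  refine PrimeSpectrum.ext ?_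
  rw [hspan]
  exact p.asIdeal.eq_span_singleton_of_height_eq_one hp1 hep hprime

theorem exists_span_eq {p : Spec (.of (Δ.CoordRing Δ.torus.1))}
    (hp : Order.coheight (Δ.chartMap Δ.torus p) = 1) :
    ∃ f : Δ.CoordRing Δ.torus.1, f ≠ 0 ∧ p.asIdeal = Ideal.span {f} := by
  have := p.isPrime
  have hp1 : p.asIdeal.height = 1 := by rw [Δ.height_eq_coheight, hp]
  have : UniqueFactorizationMonoid (Δ.CoordRing Δ.torus.1) :=
    inferInstanceAs (UniqueFactorizationMonoid (Δ.CoordRing ∅))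
  obtain ⟨f, hf, hfp⟩ := p.isPrime.exists_mem_prime_of_ne_bot (p.asIdeal.ne_bot_of_height_eq_one hp1)
  exact ⟨f, hfp.ne_zero, p.asIdeal.eq_span_singleton_of_height_eq_one hp1 hf hfp⟩

theorem eq_of_coheight_eq_one {p q : Spec (.of (Δ.CoordRing Δ.torus.1))}
    (hp : Order.coheight (Δ.chartMap Δ.torus p) = 1)
    (hq : Order.coheight (Δ.chartMap Δ.torus q) = 1)
    (h : p.asIdeal ≤ q.asIdeal) : p = q := by
  have hp1 : p.asIdeal.height = 1 := by rw [Δ.height_eq_coheight, hp]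
  have hq1 : q.asIdeal.height = 1 := by rw [Δ.height_eq_coheight, hq]
  by_contra hne
  have := p.isPrime
  have : p.asIdeal.FiniteHeight := by simp [p.asIdeal.finiteHeight_iff, hp1]
  have := Ideal.height_strict_mono_of_isPrime (lt_of_le_of_ne h fun h => hne (PrimeSpectrum.ext h))
  rw [hp1, hq1] at this
  exact lt_irrefl _ this

theorem coheight_span_prime {π : Δ.CoordRing Δ.torus.1} (hπ : Prime π)
    (p : Spec (.of (Δ.CoordRing Δ.torus.1))) (hp : p.asIdeal = Ideal.span {π}) :
    Order.coheight (Δ.chartMap Δ.torus p) = 1 := by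
  have := p.isPrime
  have : IsNoetherianRing (Δ.CoordRing Δ.torus.1) := Δ.isNoetherianRing Δ.torus.2
  rw [← height_eq_coheight]
  apply le_antisymm
  · refine Ideal.height_le_one_of_isPrincipal_of_mem_minimalPrimes (Ideal.span {π}) _ ?_
    rw [← hp, Ideal.minimalPrimes_eq_subsingleton_self]; rfl
  · rw [Order.one_le_iff_ne_zero, Ne, Ideal.height_eq_zero_iff_eq_bot, hp,
      Ideal.span_singleton_eq_bot]
    exact hπ.ne_zero

/-- A rational function without zeros and poles on the torus is a monomial. -/
theorem exists_eq_fn_single {f : Δ.toricScheme.functionField} (hf : f ≠ 0)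
    (h : ∀ p, Order.coheight (Δ.chartMap Δ.torus p) = 1 →
      Scheme.ord f (Δ.chartMap Δ.torus p) = 0) :
    ∃ (m : Fin n → ℤ) (c : ℚ), c ≠ 0 ∧
      f = Δ.fn Δ.torus (AddMonoidAlgebra.single ⟨m, Δ.mem_dual_torus m⟩ c) := by
  have : UniqueFactorizationMonoid (Δ.CoordRing Δ.torus.1) :=
    inferInstanceAs (UniqueFactorizationMonoid (Δ.CoordRing ∅))
  have hfn0 : ∀ {a}, a ≠ 0 → Δ.fn Δ.torus a ≠ 0 := fun ha =>
    (map_ne_zero_iff _ (Δ.fn_injective _)).2 ha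
  obtain ⟨a, s, hs, has⟩ : ∃ a s : Δ.CoordRing Δ.torus.1, s ≠ 0 ∧
      f * Δ.fn Δ.torus s = Δ.fn Δ.torus a :=
    exists_toFunctionField_mul_eq (Δ.chartMap Δ.torus) f
  have ha : a ≠ 0 := by
    rintro rfl
    rw [map_zero] at has
    exact mul_ne_zero hf (hfn0 hs) has
  -- Numerator and denominator are made coprime, so that zeros and poles cannot cancel.
  obtain ⟨a', b', c', hrel, rfl, rfl⟩ := UniqueFactorizationMonoid.exists_reduced_factors a ha s
  have hc := left_ne_zero_of_mul ha
  have ha' := right_ne_zero_of_mul ha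
  have hb' := right_ne_zero_of_mul hs
  have hab : f * Δ.fn Δ.torus b' = Δ.fn Δ.torus a' := by
    rw [map_mul, map_mul] at has
    exact mul_left_cancel₀ (hfn0 hc) (by rw [← has]; ring)
  -- A prime element defines a point of codimension one of the torus, where the order detects
  -- divisibility by that element. A prime factor of the numerator or of the denominator would then
  -- give `f` a nonzero order.
  have key : ∀ π, Prime π → ∃ p, (∀ w, w ≠ 0 → π ∣ w →
      0 < Scheme.ord (Δ.fn Δ.torus w) (Δ.chartMap Δ.torus p)) ∧
      (∀ w, ¬ π ∣ w → Scheme.ord (Δ.fn Δ.torus w) (Δ.chartMap Δ.torus p) = 0) ∧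
      Scheme.ord f (Δ.chartMap Δ.torus p) = 0 := by
    intro π hπ
    let p : Spec (.of (Δ.CoordRing Δ.torus.1)) :=
      (⟨Ideal.span {π}, (Ideal.span_singleton_prime hπ.ne_zero).2 hπ⟩ :
        PrimeSpectrum (Δ.CoordRing Δ.torus.1))
    have hp1 := Δ.coheight_span_prime hπ p rfl
    refine ⟨p, ?_, ?_, h p hp1⟩
    · rintro _ hw ⟨w, rfl⟩
      rw [map_mul, Scheme.ord_mul (hfn0 (left_ne_zero_of_mul hw)) (hfn0 (right_ne_zero_of_mul hw))]
      have h1 : Scheme.ord (Δ.fn Δ.torus π) (Δ.chartMap Δ.torus p) = 1 :=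
        ord_toFunctionField_of_span _ hp1 hπ.ne_zero rfl
      have h2 : 0 ≤ Scheme.ord (Δ.fn Δ.torus w) (Δ.chartMap Δ.torus p) :=
        ord_toFunctionField_nonneg _ (right_ne_zero_of_mul hw) p
      omega
    · intro w hw
      refine ord_toFunctionField_of_notMem _ fun hw' => hw ?_
      exact Ideal.mem_span_singleton.1 hw'
  have hord : ∀ p, Scheme.ord f (Δ.chartMap Δ.torus p) +
      Scheme.ord (Δ.fn Δ.torus b') (Δ.chartMap Δ.torus p) =
      Scheme.ord (Δ.fn Δ.torus a') (Δ.chartMap Δ.torus p) := fun p => by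
    rw [← Scheme.ord_mul hf (hfn0 hb'), hab]
  have hua : IsUnit a' := by
    by_contra hu
    obtain ⟨π, hπ, hd⟩ := WfDvdMonoid.exists_irreducible_factor hu ha'
    obtain ⟨p, h1, h2, h3⟩ := key π hπ.prime
    have h4 := h1 a' ha' hd
    have h5 := h2 b' fun hd' => hπ.not_isUnit (hrel hd hd')
    have h6 := hord p
    omega
  have hub : IsUnit b' := by
    by_contra hu
    obtain ⟨π, hπ, hd⟩ := WfDvdMonoid.exists_irreducible_factor hu hb'
    obtain ⟨p, h1, h2, h3⟩ := key π hπ.prime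
    have h4 := h1 b' hb' hd
    have h5 := h2 a' fun hd' => hπ.not_isUnit (hrel hd' hd)
    have h6 := hord p
    omega
  obtain ⟨b'', hb''⟩ := hub.exists_right_inv
  have hfa : f = Δ.fn Δ.torus (a' * b'') := by
    rw [map_mul, ← hab, mul_assoc, ← map_mul, hb'', map_one, mul_one]
  let e : Δ.CoordRing Δ.torus.1 ≃ₐ[ℚ] AddMonoidAlgebra ℚ (Fin n → ℤ) :=
    AddMonoidAlgebra.domCongr ℚ ℚ Δ.dualEmpty.symm
  obtain ⟨m, c, hc, hm⟩ := AddMonoidAlgebra.exists_eq_single_of_isUnit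
    ((hua.mul (IsUnit.of_mul_eq_one_right _ hb'')).map e)
  refine ⟨m, c, hc, hfa.trans (congrArg _ (e.injective (hm.trans ?_)))⟩
  exact (AddMonoidAlgebra.domCongr_single (R := ℚ) (A := ℚ) Δ.dualEmpty.symm ⟨m, Δ.mem_dual_torus m⟩ c).symm

end LogPair.SmoothFan

namespace LogPair

/-- The order of vanishing, as a homomorphism. -/
noncomputable def ordUnits {X : Scheme.{0}} [IsIntegral X] [IsLocallyNoetherian X] (z : X) :
    Additive X.functionFieldˣ →+ ℤ where
  toFun f := Scheme.ord f.toMul.1 z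
  map_zero' := ord_one z
  map_add' f g := Scheme.ord_mul f.toMul.ne_zero g.toMul.ne_zero

namespace SmoothFan

variable {n : ℕ} {ι : Type} [DecidableEq ι] (Δ : SmoothFan n ι)

/-! ### Reduction of divisors to invariant divisors -/

/-- The invariant prime divisor of a ray. -/
noncomputable def divisor {ρ : ι} (hρ : {ρ} ∈ Δ.cones) : PrimeDivisor Δ.toricScheme :=
  ⟨Δ.rayPoint hρ, Δ.coheight_rayPoint hρ⟩

theorem ord_char_divisor {ρ : ι} (hρ : {ρ} ∈ Δ.cones) (m : Fin n → ℤ) :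
    Scheme.ord (Δ.char m) (Δ.divisor hρ).1 = m ⬝ᵥ Δ.ray ρ :=
  Δ.ord_char_rayPoint hρ m

/-- Nonzero constants are units in every chart. -/
theorem ord_fn_single {m : Fin n → ℤ} {c : ℚ} (hc : c ≠ 0) (z : Δ.toricScheme) :
    Scheme.ord (Δ.fn Δ.torus (AddMonoidAlgebra.single ⟨m, Δ.mem_dual_torus m⟩ c)) z =
      Scheme.ord (Δ.char m) z := by
  obtain ⟨σ, p, rfl⟩ := Δ.exists_chartMap_eq z
  have h1 : (AddMonoidAlgebra.single ⟨m, Δ.mem_dual_torus m⟩ c : Δ.CoordRing Δ.torus.1) =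
      Δ.restrict (Δ.torus_subset σ.1) (AddMonoidAlgebra.single 0 c) *
        Δ.monomial m (Δ.mem_dual_torus m) := by
    rw [restrict_single, AddMonoidAlgebra.single_mul_single, mul_one]
    congr 1
    ext; simp
  have hu : IsUnit (AddMonoidAlgebra.single 0 c : Δ.CoordRing σ.1) := by
    refine IsUnit.of_mul_eq_one (AddMonoidAlgebra.single 0 c⁻¹) ?_
    rw [AddMonoidAlgebra.single_mul_single, mul_inv_cancel₀ hc, add_zero]; rfl
  rw [h1, map_mul, Δ.fn_restrict]
  change Scheme.ord (Δ.fn σ _ * Δ.char m) _ = _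
  rw [Scheme.ord_mul ((hu.map (Δ.fn σ)).ne_zero) (Δ.char_ne_zero m)]
  have h2 : Scheme.ord (Δ.fn σ (AddMonoidAlgebra.single 0 c)) (Δ.chartMap σ p) = 0 :=
    ord_toFunctionField_of_notMem _ fun h => p.isPrime.ne_top (Ideal.eq_top_of_isUnit_mem _ h hu)
  rw [h2, zero_add]

theorem divisor_injective {ρ ρ' : ι} (hρ : {ρ} ∈ Δ.cones) (hρ' : {ρ'} ∈ Δ.cones)
    (h : Δ.divisor hρ = Δ.divisor hρ') : ρ = ρ' :=
  Δ.rayPoint_injective hρ hρ' (congrArg Subtype.val h)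

theorem divisor_notMem_torus {ρ : ι} (hρ : {ρ} ∈ Δ.cones) :
    (Δ.divisor hρ).1 ∉ Set.range (Δ.chartMap Δ.torus) := fun h =>
  absurd ((Δ.rayPoint_mem_range_chartMap hρ Δ.torus).1 h) (Finset.notMem_empty ρ)

theorem exists_eq_divisor {E : PrimeDivisor Δ.toricScheme}
    (hE : E.1 ∉ Set.range (Δ.chartMap Δ.torus)) : ∃ ρ, ∃ hρ : {ρ} ∈ Δ.cones, E = Δ.divisor hρ := by
  obtain ⟨ρ, hρ, h⟩ := Δ.exists_rayPoint_eq E.2 hE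
  exact ⟨ρ, hρ, Subtype.ext h⟩

/-- A prime divisor is linearly equivalent to an effective invariant divisor. -/
theorem exists_ord_eq (E : PrimeDivisor Δ.toricScheme) : ∃ g : Δ.toricScheme.functionFieldˣ,
    (∀ E' : PrimeDivisor Δ.toricScheme, E'.1 ∈ Set.range (Δ.chartMap Δ.torus) →
      Scheme.ord g.1 E'.1 = if E = E' then 1 else 0) ∧
    (∀ ρ (hρ : {ρ} ∈ Δ.cones), Scheme.ord g.1 (Δ.divisor hρ).1 ≤ 0) ∧
    ∀ ρ (hρ : {ρ} ∈ Δ.cones), E = Δ.divisor hρ → g = 1 := by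
  by_cases hE : E.1 ∈ Set.range (Δ.chartMap Δ.torus)
  · obtain ⟨p, hp⟩ := hE
    have hp1 : Order.coheight (Δ.chartMap Δ.torus p) = 1 := by rw [hp]; exact E.2
    obtain ⟨f, hf, hfp⟩ := Δ.exists_span_eq hp1
    -- Any monomial of the equation will do: it is a unit on the torus, and along each invariant
    -- divisor its order is at least that of `f`.
    obtain ⟨m, hm⟩ : f.coeff.support.Nonempty :=
      Finsupp.support_nonempty_iff.2 fun h => hf (AddMonoidAlgebra.coeff_eq_zero.1 h)
    have hf0 : Δ.fn Δ.torus f ≠ 0 := (map_ne_zero_iff _ (Δ.fn_injective _)).2 hf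
    have hc := Δ.char_ne_zero (-m.1)
    refine ⟨Units.mk0 (Δ.fn Δ.torus f * Δ.char (-m.1)) (mul_ne_zero hf0 hc), ?_, ?_, ?_⟩
    · rintro E' ⟨q, hq⟩
      have hq1 : Order.coheight (Δ.chartMap Δ.torus q) = 1 := by rw [hq]; exact E'.2
      rw [Units.val_mk0, Scheme.ord_mul hf0 hc, ← hq, ord_char_torus, add_zero]
      split_ifs with h
      · rw [hq, ← h, ← hp]
        exact ord_toFunctionField_of_span _ hp1 hf hfp
      · refine ord_toFunctionField_of_notMem _ fun hfq => h (Subtype.ext ?_)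
        rw [← hp, ← hq, Δ.eq_of_coheight_eq_one hp1 hq1]
        rw [hfp, Ideal.span_le, Set.singleton_subset_iff]
        exact hfq
    · intro ρ hρ
      rw [Units.val_mk0, Scheme.ord_mul hf0 hc]
      have h1 : Scheme.ord (Δ.char (-m.1)) (Δ.divisor hρ).1 = (-m.1) ⬝ᵥ Δ.ray ρ :=
        Δ.ord_char_rayPoint hρ (-m.1)
      have h2 : Scheme.ord (Δ.fn Δ.torus f) (Δ.divisor hρ).1 ≤ m.1 ⬝ᵥ Δ.ray ρ :=
        Δ.ord_fn_rayPoint_le hρ hm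
      rw [neg_dotProduct] at h1
      omega
    · rintro ρ hρ rfl
      exact absurd ⟨p, hp⟩ (Δ.divisor_notMem_torus hρ)
  -- Invariant divisors are left untouched; this normalization makes `invariantPart` the identity on
  -- them.
  · refine ⟨1, fun E' hE' => ?_, fun ρ hρ => ?_, fun _ _ _ => rfl⟩
    · rw [Units.val_one, ord_one, if_neg]
      rintro rfl
      exact hE hE'
    · rw [Units.val_one, ord_one]

/-- A rational function by which a prime divisor differs from an effective invariant divisor. -/
noncomputable def reductionFn (E : PrimeDivisor Δ.toricScheme) : Δ.toricScheme.functionFieldˣ :=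
  (Δ.exists_ord_eq E).choose

/-- A rational function by which a divisor differs from an invariant divisor. -/
noncomputable def reduction : WeilDiv Δ.toricScheme →+ Additive Δ.toricScheme.functionFieldˣ :=
  Finsupp.liftAddHom fun E => zmultiplesHom _ (Additive.ofMul (Δ.reductionFn E))

theorem ordUnits_reduction_torus (L : WeilDiv Δ.toricScheme) {E : PrimeDivisor Δ.toricScheme}
    (hE : E.1 ∈ Set.range (Δ.chartMap Δ.torus)) : ordUnits E.1 (Δ.reduction L) = L E := by
  have h : (ordUnits E.1).comp Δ.reduction = Finsupp.applyAddHom E := by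
    ext E'
    have := (Δ.exists_ord_eq E').choose_spec.1 E hE
    simp only [reduction, AddMonoidHom.coe_comp, Function.comp_apply, Finsupp.singleAddHom_apply,
      Finsupp.liftAddHom_apply_single, zmultiplesHom_apply, one_smul, Finsupp.applyAddHom_apply,
      Finsupp.single_apply]
    exact this
  exact DFunLike.congr_fun h L

variable (hΔ : ∀ ρ, {ρ} ∈ Δ.cones)

/-- The coefficients of an invariant divisor linearly equivalent to a given divisor. -/
noncomputable def invariantPart : WeilDiv Δ.toricScheme →+ (ι → ℤ) :=
  AddMonoidHom.mk' (fun L ρ => L (Δ.divisor (hΔ ρ)) - ordUnits (Δ.divisor (hΔ ρ)).1 (Δ.reduction L))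
    fun L L' => by ext; simp; ring

theorem invariantPart_apply (L : WeilDiv Δ.toricScheme) (ρ : ι) : Δ.invariantPart hΔ L ρ =
    L (Δ.divisor (hΔ ρ)) - ordUnits (Δ.divisor (hΔ ρ)).1 (Δ.reduction L) := rfl

theorem reduction_single (E : PrimeDivisor Δ.toricScheme) (k : ℤ) :
    Δ.reduction (Finsupp.single E k) = k • Additive.ofMul (Δ.reductionFn E) := by
  simp [reduction]

theorem invariantPart_divisor (ρ : ι) :
    Δ.invariantPart hΔ (Finsupp.single (Δ.divisor (hΔ ρ)) 1) = Pi.single ρ 1 := by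
  ext ρ'
  have h : Δ.reductionFn (Δ.divisor (hΔ ρ)) = 1 :=
    (Δ.exists_ord_eq _).choose_spec.2.2 ρ (hΔ ρ) rfl
  rw [invariantPart_apply, reduction_single, h, ofMul_one, smul_zero, map_zero, sub_zero,
    Finsupp.single_apply, Pi.single_apply]
  refine if_congr ⟨fun h => (Δ.divisor_injective _ _ h).symm, ?_⟩ rfl rfl
  rintro rfl
  rfl

/-- The reduction function has nonpositive order along every invariant divisor, and it is
subtracted. This sign is what makes the invariant divisors generate the effective cone. -/
theorem invariantPart_single_nonneg (E : PrimeDivisor Δ.toricScheme) :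
    0 ≤ Δ.invariantPart hΔ (Finsupp.single E 1) := fun ρ => by
  have h : Scheme.ord (Δ.reductionFn E).1 (Δ.divisor (hΔ ρ)).1 ≤ 0 :=
    (Δ.exists_ord_eq E).choose_spec.2.1 ρ (hΔ ρ)
  have h1 : ordUnits (Δ.divisor (hΔ ρ)).1 (Additive.ofMul (Δ.reductionFn E)) ≤ 0 := h
  rw [invariantPart_apply, reduction_single, one_smul, Pi.zero_apply, Finsupp.single_apply]
  split_ifs
  · exact sub_nonneg.2 (h1.trans zero_le_one)
  · exact sub_nonneg.2 h1

theorem invariantPart_nonneg {L : WeilDiv Δ.toricScheme} (hL : 0 ≤ L) :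
    0 ≤ Δ.invariantPart hΔ L := by
  rw [← Finsupp.sum_single L, Finsupp.sum, map_sum]
  refine Finset.sum_nonneg fun E _ => ?_
  rw [← mul_one (L E), ← smul_eq_mul, ← Finsupp.smul_single, map_zsmul]
  exact smul_nonneg (hL E) (Δ.invariantPart_single_nonneg hΔ E)

/-- A divisor is principal on the complement of some invariant divisors if and only if its invariant
part is given by a character there. -/
theorem exists_ord_eq_iff (S : Set (PrimeDivisor Δ.toricScheme))
    (hS : ∀ E : PrimeDivisor Δ.toricScheme, E.1 ∈ Set.range (Δ.chartMap Δ.torus) → E ∈ S)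
    (L : WeilDiv Δ.toricScheme) :
    (∃ f : Δ.toricScheme.functionField, f ≠ 0 ∧ ∀ E ∈ S, L E = Scheme.ord f E.1) ↔
      ∃ m : Fin n → ℤ, ∀ ρ, Δ.divisor (hΔ ρ) ∈ S → Δ.invariantPart hΔ L ρ = m ⬝ᵥ Δ.ray ρ := by
  set g := Δ.reduction L with hg
  have hord : ∀ (f : Δ.toricScheme.functionField), f ≠ 0 → ∀ z,
      Scheme.ord (f * g.toMul.1) z = Scheme.ord f z + ordUnits z g := fun f hf z =>
    Scheme.ord_mul hf g.toMul.ne_zero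
  constructor
  · rintro ⟨f, hf, h⟩
    -- On the torus `f` and the reduction function `g` have the same divisor, so their quotient is a
    -- monomial.
    obtain ⟨m, c, hc, hm⟩ := Δ.exists_eq_fn_single (f := f * (-g).toMul.1)
      (mul_ne_zero hf (-g).toMul.ne_zero) fun p hp => by
        let E : PrimeDivisor Δ.toricScheme := ⟨_, hp⟩
        have h1 : Scheme.ord (f * (-g).toMul.1) E.1 = Scheme.ord f E.1 + ordUnits E.1 (-g) :=
          Scheme.ord_mul hf (-g).toMul.ne_zero
        refine h1.trans ?_
        rw [map_neg, hg, Δ.ordUnits_reduction_torus L (E := E) ⟨p, rfl⟩, h E (hS E ⟨p, rfl⟩)]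
        ring
    refine ⟨m, fun ρ hρ => ?_⟩
    have h1 : Scheme.ord (f * (-g).toMul.1) (Δ.divisor (hΔ ρ)).1 =
      Scheme.ord f (Δ.divisor (hΔ ρ)).1 + ordUnits (Δ.divisor (hΔ ρ)).1 (-g) :=
        Scheme.ord_mul hf (-g).toMul.ne_zero
    rw [hm, Δ.ord_fn_single hc, Δ.ord_char_divisor, map_neg (ordUnits _), ← h _ hρ] at h1
    rw [invariantPart_apply, sub_eq_add_neg, ← hg, ← h1]
  · rintro ⟨m, h⟩
    refine ⟨Δ.char m * g.toMul.1, mul_ne_zero (Δ.char_ne_zero m) g.toMul.ne_zero, fun E hE => ?_⟩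
    rw [hord _ (Δ.char_ne_zero m)]
    by_cases hE' : E.1 ∈ Set.range (Δ.chartMap Δ.torus)
    · rw [hg, Δ.ordUnits_reduction_torus L hE']
      obtain ⟨p, hp⟩ := hE'
      rw [← hp, ord_char_torus, zero_add]
    · obtain ⟨ρ, hρ, rfl⟩ := Δ.exists_eq_divisor hE'
      have h1 := h ρ hE
      rw [invariantPart_apply] at h1
      have h2 : Scheme.ord (Δ.char m) (Δ.divisor hρ).1 = m ⬝ᵥ Δ.ray ρ := Δ.ord_char_rayPoint hρ m
      linarith

end SmoothFan
end LogPair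

namespace LogPair

/-! ### Class groups of pairs -/

/-- The homomorphism sending a divisor to the class of its `A`-divisor. -/
noncomputable def classOf {X : Scheme.{0}} [IsIntegral X] [IsLocallyNoetherian X] (V : X.Opens)
    (A : Finset (PrimeDivisor X)) : WeilDiv X →+ APic V A :=
  (QuotientAddGroup.mk' (principalA V A)).comp (toADiv V A)

/-- Both components are extended by zero and added. As no member of `A` meets `V` in its generic
point, the two extensions have disjoint supports. -/
theorem exists_toADiv_eq {X : Scheme.{0}} (V : X.Opens) (A : Finset (PrimeDivisor X))
    (hAV : ∀ E ∈ A, E.1 ∉ V) (L : ADiv V A) :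
    ∃ L' : WeilDiv X, toADiv V A L' = L ∧ (0 ≤ L → 0 ≤ L') := by
  classical
  refine ⟨L.1.embDomain (Function.Embedding.subtype _) + L.2.embDomain (Function.Embedding.subtype _),
    ?_, ?_⟩
  · have h1 : ∀ E : {E : PrimeDivisor X // E.1 ∈ V},
        L.2.embDomain (Function.Embedding.subtype _) E.1 = 0 := fun E =>
      Finsupp.embDomain_of_notMem_range _ _ _ (by rintro ⟨F, hF⟩; exact hAV _ (hF ▸ F.2) E.2)
    have h2 : ∀ E : {E : PrimeDivisor X // E ∈ A},
        L.1.embDomain (Function.Embedding.subtype _) E.1 = 0 := fun E =>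
      Finsupp.embDomain_of_notMem_range _ _ _ (by rintro ⟨F, hF⟩; exact hAV _ E.2 (hF ▸ F.2))
    refine Prod.ext (Finsupp.ext fun E => ?_) (Finsupp.ext fun E => ?_)
    · change L.1.embDomain (Function.Embedding.subtype _) (Function.Embedding.subtype _ E) +
        L.2.embDomain (Function.Embedding.subtype _) E.1 = L.1 E
      rw [h1, Finsupp.embDomain_apply_self, add_zero]
    · change L.1.embDomain (Function.Embedding.subtype _) E.1 +
        L.2.embDomain (Function.Embedding.subtype _) (Function.Embedding.subtype _ E) = L.2 E
      rw [h2, Finsupp.embDomain_apply_self, zero_add]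
  · intro hL
    refine add_nonneg (fun E => ?_) fun E => ?_
    · by_cases hE : E ∈ Set.range (Function.Embedding.subtype fun E : PrimeDivisor X => E.1 ∈ V)
      · obtain ⟨F, rfl⟩ := hE
        rw [Finsupp.embDomain_apply_self]
        exact hL.1 F
      · rw [Finsupp.embDomain_of_notMem_range _ _ _ hE]; rfl
    · by_cases hE : E ∈ Set.range (Function.Embedding.subtype fun E : PrimeDivisor X => E ∈ A)
      · obtain ⟨F, rfl⟩ := hE
        rw [Finsupp.embDomain_apply_self]
        exact hL.2 F
      · rw [Finsupp.embDomain_of_notMem_range _ _ _ hE]; rfl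

theorem toADiv_nonneg {X : Scheme.{0}} (V : X.Opens) (A : Finset (PrimeDivisor X))
    {L : WeilDiv X} (hL : 0 ≤ L) : 0 ≤ toADiv V A L :=
  ⟨fun E => hL E.1, fun E => hL E.1⟩

theorem classOf_surjective {X : Scheme.{0}} [IsIntegral X] [IsLocallyNoetherian X] (V : X.Opens)
    (A : Finset (PrimeDivisor X)) (hAV : ∀ E ∈ A, E.1 ∉ V) : Function.Surjective (classOf V A) := by
  intro κ
  obtain ⟨L, rfl⟩ := QuotientAddGroup.mk_surjective κ
  obtain ⟨L', rfl, -⟩ := exists_toADiv_eq V A hAV L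
  exact ⟨L', rfl⟩

theorem classOf_eq_zero_iff {X : Scheme.{0}} [IsIntegral X] [IsLocallyNoetherian X] (V : X.Opens)
    (A : Finset (PrimeDivisor X)) (L : WeilDiv X) : classOf V A L = 0 ↔
      ∃ f : X.functionField, f ≠ 0 ∧ ∀ E ∈ {E : PrimeDivisor X | E.1 ∈ V ∨ E ∈ A},
        L E = Scheme.ord f E.1 := by
  refine (QuotientAddGroup.eq_zero_iff _).trans ?_
  constructor
  · rintro ⟨f, hf, h1, h2⟩
    exact ⟨f, hf, fun E hE => hE.elim (fun h => h1 ⟨E, h⟩) fun h => h2 ⟨E, h⟩⟩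
  · rintro ⟨f, hf, h⟩
    exact ⟨f, hf, fun E => h E.1 (Or.inl E.2), fun E => h E.1 (Or.inr E.2)⟩

/-- The effective cone is generated by the classes of effective divisors on `X`. -/
theorem Eff_eq_hull {X : Scheme.{0}} [IsIntegral X] [IsLocallyNoetherian X] (V : X.Opens)
    (A : Finset (PrimeDivisor X)) (hAV : ∀ E ∈ A, E.1 ∉ V) : Eff V A =
      PointedCone.hull ℝ {v | ∃ L : WeilDiv X, 0 ≤ L ∧ v = 1 ⊗ₜ classOf V A L} := by
  rw [Eff]
  congr 1
  ext v
  constructor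
  · rintro ⟨L, hL, rfl⟩
    obtain ⟨L', rfl, h⟩ := exists_toADiv_eq V A hAV L
    exact ⟨L', h hL, rfl⟩
  · rintro ⟨L, hL, rfl⟩
    exact ⟨toADiv V A L, toADiv_nonneg V A hL, rfl⟩

namespace SmoothFan

variable {n : ℕ} {ι : Type} [DecidableEq ι] [Fintype ι] (Δ : SmoothFan n ι)
  (hΔ : ∀ ρ, {ρ} ∈ Δ.cones)

/-- A presentation of the class group `Pic(V; A)` by the invariant divisors: `wt ρ ∈ G` is the class of the
divisor of `ρ`. -/
structure ClassData (V : Δ.toricScheme.Opens) (A : Finset (PrimeDivisor Δ.toricScheme))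
    (G : Type) [AddCommGroup G] where
  wt : ι → G
  disjoint : ∀ E ∈ A, E.1 ∉ V
  torus_subset : Set.range (Δ.chartMap Δ.torus) ⊆ V
  span : AddSubgroup.closure (Set.range wt) = ⊤
  rel : ∀ c : ι → ℤ, ∑ ρ, c ρ • wt ρ = 0 ↔ ∃ m : Fin n → ℤ, ∀ ρ,
    ((Δ.divisor (hΔ ρ)).1 ∈ V ∨ Δ.divisor (hΔ ρ) ∈ A) → c ρ = m ⬝ᵥ Δ.ray ρ

namespace ClassData

variable {Δ hΔ} {V : Δ.toricScheme.Opens} {A : Finset (PrimeDivisor Δ.toricScheme)}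
  {G : Type} [AddCommGroup G] (d : ClassData Δ hΔ V A G)

/-- The class of a divisor. -/
noncomputable def degree : WeilDiv Δ.toricScheme →+ G :=
  AddMonoidHom.comp
    { toFun := fun c : ι → ℤ => ∑ ρ, c ρ • d.wt ρ
      map_zero' := by simp
      map_add' := by simp [add_smul, Finset.sum_add_distrib] }
    (Δ.invariantPart hΔ)

theorem degree_apply (L : WeilDiv Δ.toricScheme) :
    d.degree L = ∑ ρ, Δ.invariantPart hΔ L ρ • d.wt ρ := rfl

theorem degree_divisor (ρ : ι) : d.degree (Finsupp.single (Δ.divisor (hΔ ρ)) 1) = d.wt ρ := by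
  rw [degree_apply, invariantPart_divisor]
  simp [Pi.single_apply]

theorem degree_surjective : Function.Surjective d.degree := by
  rw [← AddMonoidHom.range_eq_top, eq_top_iff, ← d.span, AddSubgroup.closure_le]
  rintro _ ⟨ρ, rfl⟩
  exact ⟨_, d.degree_divisor ρ⟩

/-- Both kernels consist of the divisors whose invariant part agrees with a character on the rays
visible in `V` or `A`: one by the relations of the presentation, the other by `exists_ord_eq_iff`.
-/
theorem ker_degree : d.degree.ker = (classOf V A).ker := by
  ext L
  rw [AddMonoidHom.mem_ker, AddMonoidHom.mem_ker, classOf_eq_zero_iff]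
  exact (d.rel _).trans
    (Δ.exists_ord_eq_iff hΔ _ (fun E hE => Or.inl (d.torus_subset hE)) L).symm

/-- The class group is presented by the invariant divisors. -/
noncomputable def equiv : APic V A ≃+ G :=
  (QuotientAddGroup.quotientKerEquivOfSurjective _
    (classOf_surjective V A d.disjoint)).symm.trans
  ((QuotientAddGroup.quotientAddEquivOfEq d.ker_degree.symm).trans
    (QuotientAddGroup.quotientKerEquivOfSurjective _ d.degree_surjective))

theorem equiv_classOf (L : WeilDiv Δ.toricScheme) : d.equiv (classOf V A L) = d.degree L := by
  have h : (QuotientAddGroup.quotientKerEquivOfSurjective _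
    (classOf_surjective V A d.disjoint)).symm (classOf V A L) = QuotientAddGroup.mk L := by
    rw [AddEquiv.symm_apply_eq]; rfl
  rw [equiv, AddEquiv.trans_apply, h]
  rfl

theorem equiv_toAPic (L : WeilDiv Δ.toricScheme) :
    d.equiv (toAPic V A (QuotientAddGroup.mk L)) = d.degree L :=
  d.equiv_classOf L

theorem symm_wt_mem_Eff (ρ : ι) : (1 : ℝ) ⊗ₜ d.equiv.symm (d.wt ρ) ∈ Eff V A := by
  rw [Eff_eq_hull V A d.disjoint]
  refine Submodule.subset_span ⟨Finsupp.single (Δ.divisor (hΔ ρ)) 1, Finsupp.single_nonneg.2 zero_le_one, ?_⟩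
  rw [← d.degree_divisor, ← equiv_classOf, AddEquiv.symm_apply_apply]

/-- The effective cone is generated by the classes of the invariant divisors. -/
theorem Eff_eq : Eff V A =
    PointedCone.hull ℝ (Set.range fun ρ => (1 : ℝ) ⊗ₜ d.equiv.symm (d.wt ρ)) := by
  apply le_antisymm
  · rw [Eff_eq_hull V A d.disjoint]
    refine Submodule.span_le.2 ?_
    rintro _ ⟨L, hL, rfl⟩
    -- An effective divisor is replaced by its invariant part, whose coefficients are nonnegative
    -- integers.
    have h1 : classOf V A L = ∑ ρ, Δ.invariantPart hΔ L ρ • d.equiv.symm (d.wt ρ) := by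
      apply d.equiv.injective
      rw [equiv_classOf, degree_apply, map_sum]
      simp
    rw [h1, TensorProduct.tmul_sum]
    refine Submodule.sum_mem _ fun ρ _ => ?_
    have h2 := Δ.invariantPart_nonneg hΔ hL ρ
    have h3 : (1 : ℝ) ⊗ₜ[ℤ] (Δ.invariantPart hΔ L ρ • d.equiv.symm (d.wt ρ)) =
        (⟨(Δ.invariantPart hΔ L ρ : ℝ), by exact_mod_cast h2⟩ : {c : ℝ // 0 ≤ c}) •
          ((1 : ℝ) ⊗ₜ[ℤ] d.equiv.symm (d.wt ρ)) := by
      rw [TensorProduct.tmul_smul]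
      exact (Int.cast_smul_eq_zsmul ℝ _ _).symm
    rw [h3]
    exact Submodule.smul_mem _ _ (Submodule.subset_span ⟨ρ, rfl⟩)
  · refine Submodule.span_le.2 ?_
    rintro _ ⟨ρ, rfl⟩
    exact d.symm_wt_mem_Eff ρ

end ClassData
end SmoothFan
end LogPair

namespace LogPair

theorem mem_complement {X : Scheme.{0}} {S : Finset (PrimeDivisor X)} {x : X} :
    x ∈ complement S ↔ ∀ E ∈ S, x ∉ E.support := by
  change x ∈ (⋃ E ∈ S, E.support)ᶜ ↔ _
  simp

end LogPair

namespace ToricThreefold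

open LogPair Ray

/-! ### Class groups of the toric threefold -/

theorem rayDivisor_injective : Function.Injective rayDivisor := fun ρ ρ' h =>
  fan.divisor_injective (singleton_mem_cones ρ) (singleton_mem_cones ρ') h

theorem rayDivisor_mem_support {ρ ρ' : Ray} :
    (rayDivisor ρ).1 ∈ (rayDivisor ρ').support ↔ ρ = ρ' := by
  constructor
  · intro h
    have h1 : fan.chartMap ⟨{ρ}, singleton_mem_cones ρ⟩ (fan.orbitPoint {ρ} {ρ} subset_rfl) ∈
        closure {fan.rayPoint (singleton_mem_cones ρ')} := by
      rw [← fan.rayPoint_eq (singleton_mem_cones ρ) (σ := ⟨{ρ}, singleton_mem_cones ρ⟩)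
        (Finset.mem_singleton_self ρ)]
      exact h
    obtain ⟨h2, -⟩ := (fan.chartMap_mem_closure_rayPoint _ _ _).1 h1
    exact (Finset.mem_singleton.1 h2).symm
  · rintro rfl
    exact subset_closure rfl

theorem torus_notMem_support (ρ : Ray) (p) :
    fan.chartMap fan.torus p ∉ (rayDivisor ρ).support := fun h => by
  obtain ⟨h2, -⟩ := (fan.chartMap_mem_closure_rayPoint (singleton_mem_cones ρ) _ _).1 h
  exact absurd h2 (Finset.notMem_empty _)

theorem rayDivisor_mem_complement {T : Finset Ray} {ρ : Ray} :
    (rayDivisor ρ).1 ∈ complement (T.image rayDivisor) ↔ ρ ∉ T := by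
  rw [mem_complement, Finset.forall_mem_image]
  refine ⟨fun h hρ => h hρ (rayDivisor_mem_support.2 rfl), fun h ρ' hρ' hmem => h ?_⟩
  rwa [rayDivisor_mem_support.1 hmem]

theorem sum_ray {G : Type*} [AddCommMonoid G] (f : Ray → G) :
    ∑ ρ, f ρ = f a0 + f a1 + f b0 + f b1 + f c0 + f c1 + f x + f y := by
  have : (Finset.univ : Finset Ray) = {a0, a1, b0, b1, c0, c1, x, y} := rfl
  rw [this]
  simp [add_assoc]

/-- Explicit coordinates turn the relations among weights into integer linear arithmetic. -/
theorem exists_dotProduct_iff (c : Ray → ℤ) (P : Ray → Prop) :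
    (∃ m : Fin 3 → ℤ, ∀ ρ, P ρ → c ρ = m ⬝ᵥ vec ρ) ↔
      ∃ i j k : ℤ, ∀ ρ, P ρ → c ρ = pairing (i, j, k) ρ := by
  constructor
  · rintro ⟨m, h⟩
    refine ⟨m 0, m 1, m 2, fun ρ hρ => ?_⟩
    rw [h ρ hρ, ← dotProduct_vec]
    congr 1
    ext i
    fin_cases i <;> rfl
  · rintro ⟨i, j, k, h⟩
    exact ⟨![i, j, k], fun ρ hρ => by rw [h ρ hρ, ← dotProduct_vec]⟩

theorem forall_ray (P : Ray → Prop) :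
    (∀ ρ, P ρ) ↔ P a0 ∧ P a1 ∧ P b0 ∧ P b1 ∧ P c0 ∧ P c1 ∧ P x ∧ P y :=
  ⟨fun h => ⟨h _, h _, h _, h _, h _, h _, h _, h _⟩, fun h ρ => by cases ρ <;> simp [h]⟩

theorem closure_range_eq_top {r : ℕ} (wt : Ray → Fin r → ℤ)
    (h : ∀ i, ∃ ρ, wt ρ = Pi.single i 1) : AddSubgroup.closure (Set.range wt) = ⊤ := by
  refine eq_top_iff.2 fun v _ => ?_
  rw [show v = ∑ i, v i • Pi.single i (1 : ℤ) from by
    conv_lhs => rw [← Finset.univ_sum_single v]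
    simp [← Pi.single_smul]]
  refine sum_mem fun i _ => zsmul_mem ?_ _
  obtain ⟨ρ, hρ⟩ := h i
  exact hρ ▸ AddSubgroup.subset_closure ⟨ρ, rfl⟩

/-- A presentation of the class group `Pic(X ∖ B; A)` for invariant divisors `A ⊆ B` with sets of rays
`S ⊆ T`. -/
def classData {r : ℕ} {B A : Finset (PrimeDivisor X)} (T S : Finset Ray) (hST : S ⊆ T)
    (hB : B = T.image rayDivisor) (hA : A = S.image rayDivisor) (wt : Ray → Fin r → ℤ)
    (hwt : ∀ i, ∃ ρ, wt ρ = Pi.single i 1)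
    (hrel : ∀ c : Ray → ℤ, ∑ ρ, c ρ • wt ρ = 0 ↔
      ∃ i j k : ℤ, ∀ ρ, (ρ ∉ T ∨ ρ ∈ S) → c ρ = pairing (i, j, k) ρ) :
    fan.ClassData singleton_mem_cones (complement B) A (Fin r → ℤ) where
  wt := wt
  disjoint E hE := by
    subst hA hB
    obtain ⟨ρ, hρ, rfl⟩ := Finset.mem_image.1 hE
    exact fun h => rayDivisor_mem_complement.1 h (hST hρ)
  torus_subset := by
    subst hB
    rintro _ ⟨p, rfl⟩
    refine mem_complement.2 fun E hE => ?_
    obtain ⟨ρ, -, rfl⟩ := Finset.mem_image.1 hE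
    exact torus_notMem_support ρ p
  span := closure_range_eq_top wt hwt
  rel c := by
    subst hA hB
    refine (hrel c).trans ((exists_dotProduct_iff c _).symm.trans ?_)
    refine exists_congr fun m => forall_congr' fun ρ => imp_congr (or_congr ?_ ?_) Iff.rfl
    · exact rayDivisor_mem_complement.symm
    · exact (Finset.mem_image.trans ⟨fun ⟨ρ', h, h'⟩ => rayDivisor_injective h' ▸ h,
        fun h => ⟨ρ, h, rfl⟩⟩).symm

theorem D_eq : D = ({x, y, a0} : Finset Ray).image rayDivisor := by
  simp [D, E₁, E₂, M, Finset.image_insert]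

theorem M_eq : {M} = ({a0} : Finset Ray).image rayDivisor := by simp [M]

theorem E_eq : {E₁, E₂} = ({x, y} : Finset Ray).image rayDivisor := by
  simp [E₁, E₂, Finset.image_insert]

/-- The classes of the invariant divisors in `Pic(U)`. -/
def wtU : Ray → Fin 2 → ℤ
  | a0 => 0 | a1 => 0 | b0 => ![1, 0] | b1 => ![1, 0] | c0 => ![0, 1] | c1 => ![0, 1] | x => 0 | y => 0

/-- The classes of the invariant divisors in `Pic(U; M)`. -/
def wtM : Ray → Fin 3 → ℤ
  | a0 => ![1, 0, 0] | a1 => ![1, 0, 0] | b0 => ![0, 1, 0] | b1 => ![0, 1, 0]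
  | c0 => ![0, 0, 1] | c1 => ![0, 0, 1] | x => 0 | y => 0

/-- The classes of the invariant divisors in `Pic(X ∖ M)`. -/
def wtE : Ray → Fin 4 → ℤ
  | a0 => 0 | a1 => ![-1, -1, 0, 0] | b0 => ![1, 0, 1, 0] | b1 => ![0, 0, 1, 0]
  | c0 => ![0, 1, 0, 1] | c1 => ![0, 0, 0, 1] | x => ![1, 0, 0, 0] | y => ![0, 1, 0, 0]

/-- The presentation of `Pic(U)`. -/
noncomputable def dataU : fan.ClassData singleton_mem_cones (complement D) ∅ (Fin 2 → ℤ) :=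
  classData {x, y, a0} ∅ (by simp) D_eq (by simp) wtU
    (fun i => by fin_cases i <;> [use b0; use c0] <;> ext i <;> fin_cases i <;> simp [wtU])
    (fun c => by
      simp only [sum_ray, forall_ray, funext_iff, Fin.forall_fin_succ]
      constructor
      · intro h
        -- The character is forced by its values on `a1`, `b0` and `c0`, whose generators form a
        -- basis of `ℤ³`; `a0` is not visible here.
        refine ⟨-c a1, c b0, c c0, ?_⟩
        simp [wtU, pairing] at h ⊢
        omega
      · rintro ⟨i, j, k, h⟩
        simp [wtU, pairing] at h ⊢
        omega)

/-- The presentation of `Pic(U; M)`. -/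
noncomputable def dataM : fan.ClassData singleton_mem_cones (complement D) {M} (Fin 3 → ℤ) :=
  classData {x, y, a0} {a0} (by simp) D_eq M_eq wtM
    (fun i => by fin_cases i <;> [use a0; use b0; use c0] <;> ext i <;> fin_cases i <;> simp [wtM])
    (fun c => by
      simp only [sum_ray, forall_ray, funext_iff, Fin.forall_fin_succ]
      constructor
      · intro h
        -- Since `M` belongs to `A`, the value on `a0` is visible and determines the first
        -- coordinate.
        refine ⟨c a0, c b0, c c0, ?_⟩
        simp [wtM, pairing] at h ⊢
        omega
      · rintro ⟨i, j, k, h⟩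
        simp [wtM, pairing] at h ⊢
        omega)

theorem wtE_single (i : Fin 4) : ∃ ρ, wtE ρ = Pi.single i 1 := by
  fin_cases i <;> [use x; use y; use b1; use c1] <;> ext i <;> fin_cases i <;> simp [wtE]

/-- The rays other than `a0` are those visible in `U` together with `{E₁, E₂}`, and also those
visible in `X ∖ M`. This coincidence is the source of the isomorphism between the two class groups.
-/
theorem wtE_rel (c : Ray → ℤ) : ∑ ρ, c ρ • wtE ρ = 0 ↔
    ∃ i j k : ℤ, ∀ ρ, ρ ≠ a0 → c ρ = pairing (i, j, k) ρ := by
  simp only [sum_ray, forall_ray, funext_iff, Fin.forall_fin_succ]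
  constructor
  · intro h
    refine ⟨-c a1, c b0, c c0, ?_⟩
    simp [wtE, pairing] at h ⊢
    omega
  · rintro ⟨i, j, k, h⟩
    simp [wtE, pairing] at h ⊢
    omega

/-- The presentation of `Pic(U; E₁, E₂)`. -/
noncomputable def dataE : fan.ClassData singleton_mem_cones (complement D) {E₁, E₂} (Fin 4 → ℤ) :=
  classData {x, y, a0} {x, y} (by simp) D_eq E_eq wtE wtE_single fun c => (wtE_rel c).trans <| by
    simp only [forall_ray]
    simp

/-- The presentation of `Pic(X ∖ M)`. -/
noncomputable def dataMc : fan.ClassData singleton_mem_cones (complement {M}) ∅ (Fin 4 → ℤ) :=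
  classData {a0} ∅ (by simp) M_eq (by simp) wtE wtE_single fun c => (wtE_rel c).trans <| by
    simp only [forall_ray]
    simp

end ToricThreefold

namespace LogPair.SmoothFan.ClassData

/-! ### Coordinates on class groups -/

variable {n : ℕ} {ι : Type} [DecidableEq ι] [Fintype ι] {Δ : SmoothFan n ι}
  {hΔ : ∀ ρ, {ρ} ∈ Δ.cones} {V : Δ.toricScheme.Opens} {A : Finset (PrimeDivisor Δ.toricScheme)}
  {r : ℕ} (d : ClassData Δ hΔ V A (Fin r → ℤ))

/-- The basis of the class group given by a presentation. -/
noncomputable def basis : Module.Basis (Fin r) ℤ (APic V A) :=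
  (Pi.basisFun ℤ (Fin r)).map d.equiv.symm.toIntLinearEquiv

theorem basis_apply (i : Fin r) : d.basis i = d.equiv.symm (Pi.single i 1) := by
  simp [basis]

theorem basis_repr (κ : APic V A) (i : Fin r) : d.basis.repr κ i = d.equiv κ i := by
  simp [basis]

theorem finrank_eq (d : ClassData Δ hΔ V A (Fin r → ℤ)) : Module.finrank ℤ (APic V A) = r := by
  rw [Module.finrank_eq_card_basis d.basis, Fintype.card_fin]

theorem moduleFinite (d : ClassData Δ hΔ V A (Fin r → ℤ)) : Module.Finite ℤ (APic V A) := Module.Finite.of_basis d.basis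

/-- Coordinates on the real class group. -/
noncomputable def coord : ℝ ⊗[ℤ] APic V A ≃ₗ[ℝ] (Fin r → ℝ) := (d.basis.baseChange ℝ).equivFun

theorem coord_tmul (c : ℝ) (κ : APic V A) (i : Fin r) : d.coord (c ⊗ₜ κ) i = c * d.equiv κ i := by
  rw [coord, Module.Basis.equivFun_apply, Module.Basis.baseChange_repr_tmul, basis_repr, zsmul_eq_mul,
    mul_comm]

/-- Questions about effective cones become questions about the cone over a finite table of weight
vectors. -/
theorem mem_Eff_iff (v : ℝ ⊗[ℤ] APic V A) : v ∈ Eff V A ↔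
    d.coord v ∈ PointedCone.hull ℝ (Set.range fun ρ i => (d.wt ρ i : ℝ)) := by
  have h : PointedCone.hull ℝ (Set.range fun ρ i => (d.wt ρ i : ℝ)) =
      PointedCone.map d.coord.toLinearMap (Eff V A) := by
    rw [d.Eff_eq]
    refine Eq.trans ?_ (Submodule.map_span _ _).symm
    rw [← Set.range_comp]
    congr 2
    ext ρ i
    simp [coord_tmul]
  rw [h, PointedCone.mem_map]
  exact ⟨fun hv => ⟨v, hv, rfl⟩, fun ⟨w, hw, h⟩ => d.coord.injective h ▸ hw⟩

end LogPair.SmoothFan.ClassData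

namespace ToricThreefold

open LogPair Ray

/-! ### The effective cones -/

/-- A linear form is nonnegative on a cone if it is so on its generators. -/
theorem hull_le_of_forall {E : Type*} [AddCommGroup E] [Module ℝ E] {S : Set E} (f : E →ₗ[ℝ] ℝ)
    (h : ∀ w ∈ S, 0 ≤ f w) {w : E} (hw : w ∈ PointedCone.hull ℝ S) : 0 ≤ f w := by
  have : PointedCone.hull ℝ S ≤ PointedCone.comap f (PointedCone.positive ℝ ℝ) :=
    Submodule.span_le.2 fun w hw => h w hw
  exact this hw

theorem smul_mem_hull {E : Type*} [AddCommGroup E] [Module ℝ E] {S : Set E} {w : E} (hw : w ∈ S)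
    {c : ℝ} (hc : 0 ≤ c) : c • w ∈ PointedCone.hull ℝ S :=
  Submodule.smul_mem _ (⟨c, hc⟩ : {c : ℝ // 0 ≤ c}) (Submodule.subset_span hw)

/-- The weights `(1,0,0,0)`, `(0,1,0,0)`, `(-1,-1,0,0)` of `x`, `y`, `a1` positively span the first
two coordinates. Only the last two coordinates, which are nonnegative on all weights, remain
constrained. -/
theorem mem_hull_wtE (w : Fin 4 → ℝ) :
    w ∈ PointedCone.hull ℝ (Set.range fun ρ i => (wtE ρ i : ℝ)) ↔ 0 ≤ w 2 ∧ 0 ≤ w 3 := by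
  constructor
  · intro h
    constructor
    · refine hull_le_of_forall (LinearMap.proj 2) ?_ h
      rintro _ ⟨ρ, rfl⟩
      cases ρ <;> simp [wtE]
    · refine hull_le_of_forall (LinearMap.proj 3) ?_ h
      rintro _ ⟨ρ, rfl⟩
      cases ρ <;> simp [wtE]
  · rintro ⟨h2, h3⟩
    -- Adding a multiple of the relation `x + y + a1 = 0` between the weights makes all coefficients
    -- nonnegative; `|w 0| + |w 1|` is large enough for both.
    have key : w = (w 0 + (|w 0| + |w 1|)) • (fun i => (wtE x i : ℝ)) +
        (w 1 + (|w 0| + |w 1|)) • (fun i => (wtE y i : ℝ)) +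
        (|w 0| + |w 1|) • (fun i => (wtE a1 i : ℝ)) +
        w 2 • (fun i => (wtE b1 i : ℝ)) + w 3 • (fun i => (wtE c1 i : ℝ)) := by
      ext i
      fin_cases i <;> simp [wtE] <;> ring
    rw [key]
    have h0 := neg_abs_le (w 0)
    have h1 := neg_abs_le (w 1)
    have h0' := abs_nonneg (w 0)
    have h1' := abs_nonneg (w 1)
    refine add_mem (add_mem (add_mem (add_mem ?_ ?_) ?_) ?_) ?_ <;>
      exact smul_mem_hull (Set.mem_range_self (f := fun ρ i => (wtE ρ i : ℝ)) _) (by linarith)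

/-- The isomorphism `Pic(U; E₁, E₂) ≅ Pic(X ∖ M)`. -/
noncomputable def picEquiv : APic (complement D) {E₁, E₂} ≃+ APic (complement {M}) ∅ :=
  dataE.equiv.trans dataMc.equiv.symm

theorem picEquiv_toAPic (κ : Pic X) :
    picEquiv (toAPic (complement D) {E₁, E₂} κ) = toAPic (complement {M}) ∅ κ := by
  obtain ⟨L, rfl⟩ := QuotientAddGroup.mk_surjective κ
  rw [picEquiv, AddEquiv.trans_apply, AddEquiv.symm_apply_eq, dataMc.equiv_toAPic,
    dataE.equiv_toAPic]
  rfl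

/-- Both presentations have values in the same `ℤ⁴`, so the isomorphism is the identity in
coordinates. -/
theorem coord_picEquiv (v : ℝ ⊗[ℤ] APic (complement D) {E₁, E₂}) :
    dataMc.coord (picEquiv.toAddMonoidHom.toIntLinearMap.baseChange ℝ v) = dataE.coord v := by
  induction v using TensorProduct.induction_on with
  | zero => simp
  | add v w hv hw => rw [map_add, map_add, map_add, hv, hw]
  | tmul c κ =>
    ext i
    rw [LinearMap.baseChange_tmul, dataMc.coord_tmul, dataE.coord_tmul]
    exact congr(c * (($(dataMc.equiv.apply_symm_apply (dataE.equiv κ)) i : ℤ) : ℝ))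

/-- The cone is an intersection of two half-spaces given by linear forms, which are continuous for
the module topology. -/
theorem isClosed_Eff : @IsClosed _ (moduleTopology ℝ _) (Eff (complement {M}) ∅ : Set (ℝ ⊗[ℤ] APic (complement {M}) ∅)) := by
  let : TopologicalSpace (ℝ ⊗[ℤ] APic (complement {M}) ∅) := moduleTopology ℝ _
  have : IsModuleTopology ℝ (ℝ ⊗[ℤ] APic (complement {M}) ∅) := ⟨rfl⟩
  have h : (Eff (complement {M}) ∅ : Set (ℝ ⊗[ℤ] APic (complement {M}) ∅)) =
      {v | 0 ≤ (LinearMap.proj 2 ∘ₗ dataMc.coord.toLinearMap : _ →ₗ[ℝ] ℝ) v} ∩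
      {v | 0 ≤ (LinearMap.proj 3 ∘ₗ dataMc.coord.toLinearMap : _ →ₗ[ℝ] ℝ) v} := by
    ext v
    exact (dataMc.mem_Eff_iff v).trans (mem_hull_wtE _)
  rw [h]
  exact (isClosed_le continuous_const (IsModuleTopology.continuous_of_linearMap _)).inter
    (isClosed_le continuous_const (IsModuleTopology.continuous_of_linearMap _))

theorem image_Eff : (picEquiv.toAddMonoidHom.toIntLinearMap.baseChange ℝ) ''
    (Eff (complement D) {E₁, E₂}) = closedEff (complement {M}) := by
  rw [closedEff, @IsClosed.closure_eq _ (moduleTopology ℝ _) _ isClosed_Eff]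
  ext v
  constructor
  · rintro ⟨w, hw, rfl⟩
    refine (dataMc.mem_Eff_iff _).2 ?_
    rw [coord_picEquiv]
    exact (dataE.mem_Eff_iff w).1 hw
  · intro hv
    have h : picEquiv.toAddMonoidHom.toIntLinearMap.baseChange ℝ
        (dataE.coord.symm (dataMc.coord v)) = v := by
      apply dataMc.coord.injective
      rw [coord_picEquiv, LinearEquiv.apply_symm_apply]
    refine ⟨_, (dataE.mem_Eff_iff _).2 ?_, h⟩
    rw [LinearEquiv.apply_symm_apply]
    exact (dataMc.mem_Eff_iff v).1 hv

theorem not_strictlyConvex_Eff : ¬ StrictlyConvex (Eff (complement D) {E₁, E₂}) := by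
  intro h
  -- This is the class of `E₁`, the weight of `x`; its last two coordinates vanish, so its negative
  -- lies in the cone too.
  refine h (dataE.coord.symm (Pi.single 0 1)) ?_ ?_ ?_
  · refine (dataE.mem_Eff_iff _).2 ((mem_hull_wtE _).2 ?_)
    rw [LinearEquiv.apply_symm_apply]
    simp
  · rw [Ne, LinearEquiv.map_eq_zero_iff, Pi.single_eq_zero_iff]
    exact one_ne_zero
  · refine (dataE.mem_Eff_iff _).2 ((mem_hull_wtE _).2 ?_)
    rw [map_neg, LinearEquiv.apply_symm_apply]
    simp

/-- The weights of `a`, `b` and `c` are the three standard basis vectors, each occurring twice,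
while `x` and `y` have weight zero. -/
theorem mem_hull_wtM (w : Fin 3 → ℝ) :
    w ∈ PointedCone.hull ℝ (Set.range fun ρ i => (wtM ρ i : ℝ)) ↔ ∀ i, 0 ≤ w i := by
  constructor
  · intro h i
    refine hull_le_of_forall (LinearMap.proj i) ?_ h
    rintro _ ⟨ρ, rfl⟩
    fin_cases i <;> cases ρ <;> simp [wtM]
  · intro h
    have key : w = w 0 • (fun i => (wtM a0 i : ℝ)) + w 1 • (fun i => (wtM b0 i : ℝ)) +
        w 2 • (fun i => (wtM c0 i : ℝ)) := by
      ext i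
      fin_cases i <;> simp [wtM]
    have hm := Set.mem_range_self (f := fun ρ i => (wtM ρ i : ℝ))
    rw [key]
    exact add_mem (add_mem (smul_mem_hull (hm _) (h 0)) (smul_mem_hull (hm _) (h 1)))
      (smul_mem_hull (hm _) (h 2))

theorem mem_Eff_M (v : ℝ ⊗[ℤ] APic (complement D) {M}) :
    v ∈ Eff (complement D) {M} ↔ ∀ i, 0 ≤ dataM.coord v i :=
  (dataM.mem_Eff_iff v).trans (mem_hull_wtM _)

theorem Eff_M_eq_hull : Eff (complement D) {M} =
    PointedCone.hull ℝ (Set.range fun i => (1 : ℝ) ⊗ₜ dataM.basis i) := by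
  apply le_antisymm
  · intro v hv
    rw [mem_Eff_M] at hv
    rw [← (dataM.basis.baseChange ℝ).sum_repr v]
    refine sum_mem fun i _ => ?_
    exact smul_mem_hull (S := Set.range fun i => (1 : ℝ) ⊗ₜ dataM.basis i) ⟨i, (Module.Basis.baseChange_apply ℝ dataM.basis i).symm⟩ (hv i)
  · refine Submodule.span_le.2 ?_
    rintro _ ⟨i, rfl⟩
    refine (mem_Eff_M _).2 fun j => ?_
    rw [dataM.coord_tmul, one_mul, dataM.basis_apply, AddEquiv.apply_symm_apply]
    rw [Pi.single_apply]
    split_ifs <;> simp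

theorem isSmoothCone_Eff_M : IsSmoothCone (Eff (complement D) {M}) :=
  ⟨3, dataM.basis, Eff_M_eq_hull⟩

theorem strictlyConvex_Eff_M : StrictlyConvex (Eff (complement D) {M}) := by
  intro v hv hv0 hv'
  have h1 := (mem_Eff_M v).1 hv
  have h2 := (mem_Eff_M (-v)).1 hv'
  refine hv0 (dataM.coord.map_eq_zero_iff.1 (funext fun i => le_antisymm ?_ (h1 i)))
  have := h2 i
  rw [map_neg, Pi.neg_apply] at this
  exact neg_nonneg.1 this

end ToricThreefold

namespace LogPair

/-! ### Characteristic functions of cones -/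

section

variable {Λ : Type} [AddCommGroup Λ] {ι ι' : Type}

theorem functional_tmul_basis (b : Module.Basis ι ℤ Λ) (t : ι → ℝ) (i : ι) :
    functional b t (1 ⊗ₜ b i) = t i := by
  rw [functional, ← Module.Basis.baseChange_apply, Module.Basis.constr_basis]

theorem functional_eq_of_basis (b : Module.Basis ι ℤ Λ) {t : ι → ℝ} {f : (ℝ ⊗[ℤ] Λ) →ₗ[ℝ] ℝ}
    (h : ∀ i, f (1 ⊗ₜ b i) = t i) : functional b t = f :=
  (b.baseChange ℝ).ext fun i => by
    rw [Module.Basis.baseChange_apply, functional_tmul_basis, h]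

variable [Fintype ι] [Fintype ι']

theorem functional_apply (b : Module.Basis ι ℤ Λ) (t : ι → ℝ) (v : ℝ ⊗[ℤ] Λ) :
    functional b t v = ∑ i, (b.baseChange ℝ).repr v i * t i := by
  rw [functional, Module.Basis.constr_apply_fintype]
  simp

theorem charFun_reindex (b : Module.Basis ι ℤ Λ) (e : ι ≃ ι') (C : PointedCone ℝ (ℝ ⊗[ℤ] Λ))
    (v : ℝ ⊗[ℤ] Λ) : charFun (b.reindex e) C v = charFun b C v := by
  let g := MeasurableEquiv.piCongrLeft (fun _ : ι => ℝ) e.symm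
  have hg : ∀ t : ι' → ℝ, functional (b.reindex e) t = functional b (g t) := fun t =>
    functional_eq_of_basis _ fun i => by
      rw [Module.Basis.reindex_apply, functional_tmul_basis]
      exact Equiv.piCongrLeft_apply_apply (fun _ : ι => ℝ) e.symm t i
  have := (MeasureTheory.volume_measurePreserving_piCongrLeft (fun _ : ι => ℝ)
    e.symm).setLIntegral_comp_preimage_emb g.measurableEmbedding
    (fun t => ENNReal.ofReal (Real.exp (-functional b t v)))
    {t : ι → ℝ | ∀ y ∈ C, 0 ≤ functional b t y}
  rw [charFun, charFun, ← this]
  simp only [hg]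
  rfl

/-- The normalization of the measure does not depend on the basis. -/
theorem charFun_eq_of_basis [DecidableEq ι] (b b' : Module.Basis ι ℤ Λ)
    (C : PointedCone ℝ (ℝ ⊗[ℤ] Λ)) (v : ℝ ⊗[ℤ] Λ) : charFun b C v = charFun b' C v := by
  let M : Matrix ι ι ℝ := ((b.toMatrix b').map (Int.castRingHom ℝ)).transpose
  -- A change of basis of a lattice has determinant `±1`, so it preserves Lebesgue measure.
  have hdet : |M.det| = 1 := by
    have h1 : IsUnit (b.toMatrix b').det := by
      rw [← Matrix.isUnit_iff_isUnit_det]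
      let := b.invertibleToMatrix b'
      exact isUnit_of_invertible _
    rw [Matrix.det_transpose, ← RingHom.mapMatrix_apply, ← RingHom.map_det]
    rcases Int.isUnit_iff.1 h1 with h | h <;> simp [h]
  have hdet0 : M.det ≠ 0 := fun h => by simp [h] at hdet
  have hM : ∀ t : ι → ℝ, functional b t = functional b' (Matrix.toLin' M t) := fun t =>
    (functional_eq_of_basis _ fun i => by
      conv_lhs => rw [← b.sum_repr (b' i), TensorProduct.tmul_sum, map_sum]
      rw [Matrix.toLin'_apply, Matrix.mulVec, dotProduct]
      refine Finset.sum_congr rfl fun k _ => ?_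
      rw [TensorProduct.tmul_smul, ← Int.cast_smul_eq_zsmul ℝ, map_smul, functional_tmul_basis]
      rfl).symm
  have hmp : MeasureTheory.MeasurePreserving (Matrix.toLin' M) := by
    refine ⟨(LinearMap.continuous_of_finiteDimensional _).measurable, ?_⟩
    rw [Real.map_matrix_volume_pi_eq_smul_volume_pi hdet0, abs_inv, hdet]
    simp
  have hemb : MeasurableEmbedding (Matrix.toLin' M) :=
    (LinearEquiv.ofBijective (Matrix.toLin' M) (by
      rw [Function.Bijective, ← LinearMap.ker_eq_bot, ← LinearMap.range_eq_top,
        ← LinearMap.isUnit_iff_range_eq_top, ← LinearMap.isUnit_iff_ker_eq_bot, and_self,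
        LinearMap.isUnit_iff_isUnit_det, LinearMap.det_toLin', isUnit_iff_ne_zero]
      exact hdet0)).toContinuousLinearEquiv.toHomeomorph.measurableEmbedding
  have := hmp.setLIntegral_comp_preimage_emb hemb
    (fun t => ENNReal.ofReal (Real.exp (-functional b' t v)))
    {t : ι → ℝ | ∀ y ∈ C, 0 ≤ functional b' t y}
  rw [charFun, charFun, ← this]
  simp only [hM]
  rfl

/-- The characteristic function of a smooth cone. -/
theorem charFun_hull_basis (b : Module.Basis ι ℤ Λ) (v : ℝ ⊗[ℤ] Λ)
    (hv : ∀ i, 0 < (b.baseChange ℝ).repr v i) :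
    charFun b (PointedCone.hull ℝ (Set.range fun i => 1 ⊗ₜ b i)) v =
      ENNReal.ofReal (∏ i, ((b.baseChange ℝ).repr v i)⁻¹) := by
  set c := fun i => (b.baseChange ℝ).repr v i
  -- In dual coordinates the dual cone is the positive orthant.
  have hset : {t : ι → ℝ | ∀ y ∈ PointedCone.hull ℝ (Set.range fun i => (1 : ℝ) ⊗ₜ[ℤ] b i),
      0 ≤ functional b t y} = Set.univ.pi fun _ => Set.Ici 0 := by
    ext t
    constructor
    · intro h i _
      have := h _ (Submodule.subset_span ⟨i, rfl⟩)
      rwa [functional_tmul_basis] at this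
    · intro h y hy
      refine ToricThreefold.hull_le_of_forall (functional b t) ?_ hy
      rintro _ ⟨i, rfl⟩
      change 0 ≤ functional b t (1 ⊗ₜ b i)
      rw [functional_tmul_basis]
      exact h i trivial
  -- The integrand factors, so the integral is a product of the integrals of `exp (-c s)` over `s ≥
  -- 0`, each equal to `1 / c`.
  have hexp : ∀ t : ι → ℝ, Real.exp (-functional b t v) = ∏ i, Real.exp (-c i * t i) := fun t => by
    rw [functional_apply, ← Real.exp_sum, ← Finset.sum_neg_distrib]
    congr 1
    exact Finset.sum_congr rfl fun i _ => (neg_mul _ _).symm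
  have hint : ∀ i, MeasureTheory.Integrable (fun s => Real.exp (-c i * s))
      (MeasureTheory.volume.restrict (Set.Ici 0)) := fun i =>
    (integrableOn_Ici_iff_integrableOn_Ioi).2 (integrableOn_exp_mul_Ioi (neg_lt_zero.2 (hv i)) 0)
  rw [charFun, hset, MeasureTheory.volume_pi, MeasureTheory.Measure.restrict_pi_pi]
  simp only [hexp]
  rw [← MeasureTheory.ofReal_integral_eq_lintegral_ofReal
    (MeasureTheory.Integrable.fintype_prod hint)
    (Filter.Eventually.of_forall fun t => Finset.prod_nonneg fun i _ => (Real.exp_pos _).le),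
    MeasureTheory.integral_fintype_prod_eq_prod (f := fun i (s : ℝ) => Real.exp (-c i * s))]
  congr 1
  refine Finset.prod_congr rfl fun i _ => ?_
  rw [MeasureTheory.integral_Ici_eq_integral_Ioi, integral_exp_mul_Ioi (neg_lt_zero.2 (hv i))]
  simp

end

end LogPair

namespace ToricThreefold

open LogPair Ray

theorem bExp'_M : bExp' D {M} = 3 := dataM.finrank_eq

/-- An arbitrary basis is first reindexed by `Fin 3` and then exchanged for `dataM.basis`, in which
the cone is an orthant. The value is `1 · 1/2 · 1/2` divided by `(3 - 1)! = 2`. -/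
theorem alpha_eq_of_degree {ι : Type} [Fintype ι]
    (b : Module.Basis ι ℤ (APic (complement D) {M})) (W : WeilDiv X)
    (hW : dataM.degree (-(W + reducedDivisor D)) = ![1, 2, 2]) : alpha D {M} b W = 1 / 8 := by
  classical
  have hcard : Fintype.card ι = Fintype.card (Fin 3) := by
    rw [← Module.finrank_eq_card_basis b, ← Module.finrank_eq_card_basis dataM.basis]
  have hrepr : ∀ i, (dataM.basis.baseChange ℝ).repr
      (1 ⊗ₜ toAPic (complement D) {M} (QuotientAddGroup.mk (-(W + reducedDivisor D)))) i =
        ((![1, 2, 2] : Fin 3 → ℤ) i : ℝ) := fun i => by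
    refine (dataM.coord_tmul 1 _ i).trans ?_
    rw [dataM.equiv_toAPic, hW, one_mul]
  rw [alpha, bExp'_M, ← charFun_reindex b (Fintype.equivOfCardEq hcard),
    charFun_eq_of_basis _ dataM.basis, Eff_M_eq_hull, charFun_hull_basis]
  · simp only [hrepr, Fin.prod_univ_three]
    rw [show Nat.factorial (3 - 1) = 2 from rfl]
    have h4 : ENNReal.ofReal ((((![1, 2, 2] : Fin 3 → ℤ) 0 : ℤ) : ℝ)⁻¹ *
        (((![1, 2, 2] : Fin 3 → ℤ) 1 : ℤ) : ℝ)⁻¹ * (((![1, 2, 2] : Fin 3 → ℤ) 2 : ℤ) : ℝ)⁻¹) =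
        (4 : ℝ≥0∞)⁻¹ := by
      rw [← ENNReal.ofReal_ofNat 4, ← ENNReal.ofReal_inv_of_pos (by norm_num)]
      congr 1
      simp
      norm_num
    rw [h4, ENNReal.div_eq_inv_mul, one_div, Nat.cast_ofNat, ← ENNReal.mul_inv (by simp) (by simp)]
    norm_num
  · intro i
    rw [hrepr]
    fin_cases i <;> simp

/-! ### Units -/

/-- Two ring homomorphisms from `ℚ` to the same ring coincide, so nothing about the structure
morphism has to be unfolded. -/
theorem germToFunctionField_constants (U : X.Opens) [Nonempty U] (q : ℚ) :
    X.germToFunctionField U (constants toSpec U q) =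
      fan.fn fan.torus (AddMonoidAlgebra.single ⟨0, fan.mem_dual_torus 0⟩ q) := by
  have h := Subsingleton.elim ((X.germToFunctionField U).hom.comp (constants toSpec U))
    ((fan.fn fan.torus).comp (algebraMap ℚ (fan.CoordRing fan.torus.1)))
  exact congr($h q)

/-- A unit on `U` has no zeros or poles on the torus, so it is a constant times a character. That
character is trivial on `a1`, `b0` and `c0`, whose generators span `ℤ³`, hence is trivial. -/
theorem exists_constants_eq (u : Γ(X, complement D)) (hu : IsUnit u) :
    ∃ q : ℚ, q ≠ 0 ∧ constants toSpec (complement D) q = u := by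
  have hsub : Set.range (fan.chartMap fan.torus) ⊆ complement D := dataU.torus_subset
  have : Nonempty (complement D) := ⟨⟨_, hsub (Set.mem_range_self (fan.zeroPoint _))⟩⟩
  have hne : X.germToFunctionField (complement D) u ≠ 0 :=
    (hu.map (X.germToFunctionField (complement D)).hom).ne_zero
  obtain ⟨m, c, hc, h⟩ := fan.exists_eq_fn_single hne fun p _ =>
    Scheme.ord_of_isUnit hu (hsub (Set.mem_range_self p))
  have hm : ∀ ρ ∉ ({x, y, a0} : Finset Ray), m ⬝ᵥ vec ρ = 0 := fun ρ hρ => by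
    have h1 : (rayDivisor ρ).1 ∈ complement D := by
      rw [D_eq]
      exact rayDivisor_mem_complement.2 hρ
    have h2 := Scheme.ord_of_isUnit hu h1
    rw [h, fan.ord_fn_single hc] at h2
    exact (fan.ord_char_rayPoint (singleton_mem_cones ρ) m).symm.trans h2
  have hm0 : m = 0 := by
    have h1 := hm a1 (by decide)
    have h2 := hm b0 (by decide)
    have h3 := hm c0 (by decide)
    simp [vec, dotProduct, Fin.sum_univ_three] at h1 h2 h3
    ext i
    fin_cases i <;> assumption
  subst hm0
  refine ⟨c, hc, X.germToFunctionField_injective (complement D) ?_⟩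
  rw [h, germToFunctionField_constants]

instance : Subsingleton (UnitsModConstants toSpec (complement D)) := by
  refine show Subsingleton (Γ(X, complement D)ˣ ⧸
    (Units.map (constants toSpec (complement D) : ℚ →* Γ(X, complement D))).range) from ?_
  refine QuotientGroup.subsingleton_iff.2 (eq_top_iff.2 fun u _ => ?_)
  obtain ⟨q, hq, h⟩ := exists_constants_eq u.1 u.isUnit
  exact ⟨Units.mk0 q hq, Units.ext h⟩

/-- The three terms are `2 - 0 + 1`. -/
theorem bExp_M : bExp toSpec D {M} = 3 := by
  rw [bExp, dataU.finrank_eq, Module.finrank_zero_of_subsingleton]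
  simp

end ToricThreefold

namespace exteriorPower

/-! ### Top exterior powers -/

variable {K V : Type*} [Field K] [AddCommGroup V] [Module K V] {n : ℕ} (B : Module.Basis (Fin n) K V)

/-- Alternating maps are determined on injective families of basis vectors. Here these are the
permutations of `B`, on which both sides change by the sign. -/
theorem ιMulti_eq_det_smul (v : Fin n → V) : ιMulti K n v = B.det v • ιMulti K n B := by
  have h : ιMulti K n =
      (LinearMap.toSpanSingleton K (⋀[K]^n V) (ιMulti K n B)).compAlternatingMap B.det := by
    refine B.ext_alternating fun w hw => ?_
    let σ := Equiv.ofBijective w (Finite.injective_iff_bijective.1 hw)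
    change ιMulti K n (B ∘ σ) = B.det (B ∘ σ) • ιMulti K n B
    rw [AlternatingMap.map_perm, AlternatingMap.map_perm, B.det_self, smul_assoc, one_smul]
  exact congr($h v)

theorem ιMulti_basis_ne_zero : ιMulti K n B ≠ 0 := fun h => by
  have := alternatingMapLinearEquiv_apply_ιMulti B.det B
  rw [h, map_zero, B.det_self] at this
  exact zero_ne_one this

theorem exists_eq_smul_ιMulti (ω : ⋀[K]^n V) : ∃ c : K, ω = c • ιMulti K n B := by
  have h : ω ∈ Submodule.span K (Set.range (ιMulti K n (M := V))) := by
    rw [ιMulti_span]; trivial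
  have hle : Submodule.span K (Set.range (ιMulti K n (M := V))) ≤
      Submodule.span K {ιMulti K n B} := by
    refine Submodule.span_le.2 ?_
    rintro _ ⟨v, rfl⟩
    rw [ιMulti_eq_det_smul B v]
    exact Submodule.smul_mem _ _ (Submodule.subset_span rfl)
  obtain ⟨c, hc⟩ := Submodule.mem_span_singleton.1 (hle h)
  exact ⟨c, hc.symm⟩

end exteriorPower

namespace LogPair.SmoothFan

variable {n : ℕ} {ι : Type} [DecidableEq ι] (Δ : SmoothFan n ι)

/-! ### Derivations of the function field -/

theorem isFractionRing_fn : letI := (Δ.fn Δ.torus).toAlgebra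
    IsFractionRing (Δ.CoordRing Δ.torus.1) Δ.toricScheme.functionField := by
  let := (Δ.fn Δ.torus).toAlgebra
  refine (isLocalization_iff _ _).2 ⟨?_, fun z => ?_, fun {a b} h => ?_⟩
  · rintro ⟨f, hf⟩
    refine isUnit_iff_ne_zero.2 ?_
    exact (map_ne_zero_iff _ (Δ.fn_injective Δ.torus)).2 (nonZeroDivisors.ne_zero hf)
  · obtain ⟨f, s, hs, h⟩ := exists_toFunctionField_mul_eq (Δ.chartMap Δ.torus) z
    exact ⟨⟨f, s, mem_nonZeroDivisors_of_ne_zero hs⟩, h⟩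
  · exact ⟨1, by rw [Δ.fn_injective Δ.torus h]⟩

/-- The constant rational functions. -/
noncomputable def const : ℚ →+* Δ.toricScheme.functionField :=
  (Δ.fn Δ.torus).comp (algebraMap ℚ _)

instance : CharZero Δ.toricScheme.functionField := charZero_of_injective_ringHom Δ.const.injective

theorem fn_single (σ : Δ.Cone) (m : Δ.dual σ.1) (c : ℚ) :
    Δ.fn σ (AddMonoidAlgebra.single m c) = Δ.const c * Δ.char m.1 := by
  rw [← Δ.fn_restrict (τ := Δ.torus) (Δ.torus_subset _), restrict_single, const, RingHom.comp_apply,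
    char, ← map_mul]
  congr 1
  change _ = AddMonoidAlgebra.single 0 c * _
  rw [AddMonoidAlgebra.single_mul_single, mul_one, zero_add]

/-- The deformation `χ^m (1 + φ(m)ε)` of the character `m`. -/
noncomputable def jet (φ : (Fin n → ℤ) →+ ℤ) (m : Fin n → ℤ) :
    TrivSqZeroExt Δ.toricScheme.functionField Δ.toricScheme.functionField :=
  TrivSqZeroExt.inl (Δ.char m) + TrivSqZeroExt.inr (φ m * Δ.char m)

theorem fst_jet (φ : (Fin n → ℤ) →+ ℤ) (m : Fin n → ℤ) : (Δ.jet φ m).fst = Δ.char m := by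
  simp [jet]

theorem snd_jet (φ : (Fin n → ℤ) →+ ℤ) (m : Fin n → ℤ) : (Δ.jet φ m).snd = φ m * Δ.char m := by
  simp [jet]

/-- The first order deformation of the identity of the function field that multiplies the character `m`
with `1 + φ(m)ε`, restricted to the torus chart. -/
noncomputable def deform (φ : (Fin n → ℤ) →+ ℤ) : Δ.CoordRing Δ.torus.1 →+*
    TrivSqZeroExt Δ.toricScheme.functionField Δ.toricScheme.functionField :=
  AddMonoidAlgebra.liftNCRingHom ((TrivSqZeroExt.inlHom _ _).comp Δ.const)
    { toFun := fun m => Δ.jet φ m.toAdd.1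
      map_one' := by
        change Δ.jet φ 0 = 1
        ext <;> simp [fst_jet, snd_jet, char_zero]
      map_mul' := fun a b => by
        change Δ.jet φ (a.toAdd.1 + b.toAdd.1) = _
        ext
        · rw [TrivSqZeroExt.fst_mul, fst_jet, fst_jet, fst_jet, char_add]
        · rw [TrivSqZeroExt.snd_mul, fst_jet, fst_jet, snd_jet, snd_jet, snd_jet, char_add, map_add,
            op_smul_eq_smul, smul_eq_mul, smul_eq_mul]
          push_cast
          ring }
    (fun _ _ => Commute.all _ _)

theorem deform_single (φ : (Fin n → ℤ) →+ ℤ) (m : Δ.dual Δ.torus.1) (c : ℚ) :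
    Δ.deform φ (AddMonoidAlgebra.single m c) = TrivSqZeroExt.inl (Δ.const c) * Δ.jet φ m.1 :=
  AddMonoidAlgebra.liftNCRingHom_single _ _ _ _ _

theorem deform_monomial (φ : (Fin n → ℤ) →+ ℤ) (m : Fin n → ℤ) :
    Δ.deform φ (Δ.monomial m (Δ.mem_dual_torus m)) = Δ.jet φ m := by
  rw [deform_single, map_one, TrivSqZeroExt.inl_one, one_mul]

theorem fst_deform (φ : (Fin n → ℤ) →+ ℤ) (f : Δ.CoordRing Δ.torus.1) :
    (Δ.deform φ f).fst = Δ.fn Δ.torus f := by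
  induction f using AddMonoidAlgebra.induction_linear with
  | zero => rw [map_zero, map_zero, TrivSqZeroExt.fst_zero]
  | add f g hf hg => rw [map_add, map_add, TrivSqZeroExt.fst_add, hf, hg]
  | single m c =>
    rw [deform_single, fn_single, TrivSqZeroExt.fst_mul, TrivSqZeroExt.fst_inl, fst_jet]

/-- The ring homomorphism `deform` into the dual numbers extends to the function field, since a dual
number is a unit as soon as its first component is. The extension has the form `z ↦ z + δ(z)ε`, and
its second component is the derivation. -/
theorem exists_derivation (φ : (Fin n → ℤ) →+ ℤ) :
    ∃ δ : Derivation ℤ Δ.toricScheme.functionField Δ.toricScheme.functionField,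
      ∀ m, δ (Δ.char m) = φ m * Δ.char m := by
  let := (Δ.fn Δ.torus).toAlgebra
  have := Δ.isFractionRing_fn
  have hu : ∀ s : nonZeroDivisors (Δ.CoordRing Δ.torus.1), IsUnit (Δ.deform φ s) := fun s => by
    rw [TrivSqZeroExt.isUnit_iff_isUnit_fst, fst_deform, isUnit_iff_ne_zero]
    exact (map_ne_zero_iff _ (Δ.fn_injective Δ.torus)).2 (nonZeroDivisors.ne_zero s.2)
  let Θ := IsLocalization.lift (S := Δ.toricScheme.functionField) hu
  have hΘ : ∀ f, Θ (Δ.fn Δ.torus f) = Δ.deform φ f := fun f => IsLocalization.lift_eq hu f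
  have hfst : ∀ z, (Θ z).fst = z := fun z => by
    have : ((TrivSqZeroExt.fstHom ℤ _ _).toRingHom.comp Θ) = RingHom.id _ :=
      IsLocalization.ringHom_ext (nonZeroDivisors (Δ.CoordRing Δ.torus.1)) (RingHom.ext fun f =>
        (congrArg TrivSqZeroExt.fst (hΘ f)).trans (Δ.fst_deform φ f))
    exact congr($this z)
  refine ⟨Derivation.mk' (AddMonoidHom.toIntLinearMap
    { toFun := fun z => (Θ z).snd
      map_zero' := by rw [map_zero, TrivSqZeroExt.snd_zero]
      map_add' := fun a b => by rw [map_add, TrivSqZeroExt.snd_add] }) fun a b => ?_, fun m => ?_⟩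
  · change (Θ (a * b)).snd = a * (Θ b).snd + b * (Θ a).snd
    rw [map_mul, TrivSqZeroExt.snd_mul, hfst, hfst, op_smul_eq_smul,
      smul_eq_mul, smul_eq_mul]
  · change (Θ (Δ.char m)).snd = _
    rw [char, hΘ, deform_monomial, snd_jet]
    rfl

/-! ### Logarithmic differentials -/

/-- The logarithmic differential of a character. -/
noncomputable def dlog : (Fin n → ℤ) →+ Ω[Δ.toricScheme.functionField⁄ℤ] where
  toFun m := (Δ.char m)⁻¹ • KaehlerDifferential.D ℤ _ (Δ.char m)
  map_zero' := by rw [char_zero, Derivation.map_one_eq_zero, smul_zero]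
  map_add' a b := by
    have ha := Δ.char_ne_zero a
    have hb := Δ.char_ne_zero b
    rw [char_add, Derivation.leibniz, smul_add, smul_smul, smul_smul, add_comm]
    congr 2 <;> field_simp

theorem D_char (m : Fin n → ℤ) :
    KaehlerDifferential.D ℤ Δ.toricScheme.functionField (Δ.char m) = Δ.char m • Δ.dlog m :=
  (smul_inv_smul₀ (Δ.char_ne_zero m) _).symm

/-- A derivation kills integers and therefore their quotients, so differentials over `ℤ` already
treat rational numbers as constants. -/
theorem D_const (q : ℚ) : KaehlerDifferential.D ℤ Δ.toricScheme.functionField (Δ.const q) = 0 := by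
  have h : Δ.const q = (q.num : Δ.toricScheme.functionField) / (q.den : Δ.toricScheme.functionField) := by
    conv_lhs => rw [← Rat.num_div_den q]
    rw [map_div₀, map_intCast, map_natCast]
  rw [h, Derivation.leibniz_div_const _ _ _ (Derivation.map_natCast _ _), Derivation.map_intCast,
    smul_zero]

theorem D_fn_single (σ : Δ.Cone) (m : Δ.dual σ.1) (c : ℚ) :
    KaehlerDifferential.D ℤ _ (Δ.fn σ (AddMonoidAlgebra.single m c)) =
      Δ.fn σ (AddMonoidAlgebra.single m c) • Δ.dlog m.1 := by
  rw [fn_single, Derivation.leibniz, D_const, smul_zero, add_zero, D_char, smul_smul]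

theorem exists_functional (φ : (Fin n → ℤ) →+ ℤ) :
    ∃ δ : Ω[Δ.toricScheme.functionField⁄ℤ] →ₗ[Δ.toricScheme.functionField] Δ.toricScheme.functionField,
      ∀ m, δ (Δ.dlog m) = φ m := by
  obtain ⟨δ, hδ⟩ := Δ.exists_derivation φ
  refine ⟨δ.liftKaehlerDifferential, fun m => ?_⟩
  change δ.liftKaehlerDifferential ((Δ.char m)⁻¹ • _) = _
  rw [map_smul, Derivation.liftKaehlerDifferential_comp_D, hδ, smul_eq_mul]
  have := Δ.char_ne_zero m
  field_simp

theorem dlog_eq_sum (e : Module.Basis (Fin n) ℤ (Fin n → ℤ)) (m : Fin n → ℤ) :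
    Δ.dlog m = ∑ i, (e.repr m i : Δ.toricScheme.functionField) • Δ.dlog (e i) := by
  conv_lhs => rw [← e.sum_repr m, map_sum]
  refine Finset.sum_congr rfl fun i _ => ?_
  rw [map_zsmul, Int.cast_smul_eq_zsmul]

/-- The logarithmic differentials of a basis of the character lattice form a basis. -/
noncomputable def dlogBasis (e : Module.Basis (Fin n) ℤ (Fin n → ℤ)) :
    Module.Basis (Fin n) Δ.toricScheme.functionField Ω[Δ.toricScheme.functionField⁄ℤ] :=
  Module.Basis.mk (v := fun i => Δ.dlog (e i))
    (by
      rw [Fintype.linearIndependent_iff]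
      intro g hg i
      -- The functional attached to the `i`-th coordinate of the character lattice extracts the
      -- coefficient `g i` from the relation.
      obtain ⟨δ, hδ⟩ := Δ.exists_functional (e.coord i).toAddMonoidHom
      have h := congrArg δ hg
      rw [map_sum, map_zero, Finset.sum_eq_single i] at h
      · rw [map_smul, hδ] at h
        simpa using h
      · intro j _ hj
        rw [map_smul, hδ]
        simp [hj]
      · simp)
    (by
      set S := Submodule.span Δ.toricScheme.functionField (Set.range fun i => Δ.dlog (e i))
      have hlog : ∀ m, Δ.dlog m ∈ S := fun m => by
        rw [Δ.dlog_eq_sum e]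
        exact sum_mem fun i _ => Submodule.smul_mem _ _ (Submodule.subset_span ⟨i, rfl⟩)
      have hfn : ∀ f, KaehlerDifferential.D ℤ _ (Δ.fn Δ.torus f) ∈ S := fun f => by
        induction f using AddMonoidAlgebra.induction_linear with
        | zero => rw [map_zero, map_zero]; exact zero_mem _
        | add f g hf hg => rw [map_add, map_add]; exact add_mem hf hg
        | single m c => rw [D_fn_single]; exact Submodule.smul_mem _ _ (hlog _)
      rw [← KaehlerDifferential.span_range_derivation, Submodule.span_le]
      rintro _ ⟨z, rfl⟩
      -- Every rational function is a quotient of Laurent polynomials, so the quotient rule reduces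
      -- spanning to these.
      obtain ⟨f, s, hs, h⟩ := exists_toFunctionField_mul_eq (Δ.chartMap Δ.torus) z
      have hs0 : Δ.fn Δ.torus s ≠ 0 := (map_ne_zero_iff _ (Δ.fn_injective Δ.torus)).2 hs
      replace h : z = Δ.fn Δ.torus f / Δ.fn Δ.torus s := (eq_div_iff hs0).2 h
      rw [h, Derivation.leibniz_div]
      exact Submodule.smul_mem _ _ (sub_mem (Submodule.smul_mem _ _ (hfn f))
        (Submodule.smul_mem _ _ (hfn s))))

theorem dlogBasis_apply (e : Module.Basis (Fin n) ℤ (Fin n → ℤ)) (i : Fin n) :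
    Δ.dlogBasis e i = Δ.dlog (e i) := by
  rw [dlogBasis, Module.Basis.mk_apply]

theorem dlogBasis_repr_dlog (e : Module.Basis (Fin n) ℤ (Fin n → ℤ)) (m : Fin n → ℤ) (i : Fin n) :
    (Δ.dlogBasis e).repr (Δ.dlog m) i = e.repr m i := by
  rw [Δ.dlog_eq_sum e]
  simp only [← dlogBasis_apply]
  rw [Module.Basis.repr_sum_self]

end LogPair.SmoothFan

namespace LogPair

/-! ### Local frames -/

section Frame

variable {X : Scheme.{0}} [IsIntegral X]

/-- If the differentials of `h` form a basis in which differentials of regular functions have regular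
coordinates, then `h` is a local frame. -/
theorem isLocalFrame_of_basis {n : ℕ} (z : X) (h : Fin n → X.presheaf.stalk z)
    (B : Module.Basis (Fin n) X.functionField Ω[X.functionField⁄ℤ])
    (hB : ∀ i, B i = KaehlerDifferential.D ℤ X.functionField
      (algebraMap (X.presheaf.stalk z) X.functionField (h i)))
    (hreg : ∀ a : X.presheaf.stalk z, ∀ i, B.repr (KaehlerDifferential.D ℤ X.functionField
      (algebraMap (X.presheaf.stalk z) X.functionField a)) i ∈
        (algebraMap (X.presheaf.stalk z) X.functionField).range) : IsLocalFrame z h := by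
  have hw : wedgeD z h = exteriorPower.ιMulti X.functionField n B :=
    congrArg (exteriorPower.ιMulti X.functionField n) (funext fun i => (hB i).symm)
  refine ⟨hw ▸ exteriorPower.ιMulti_basis_ne_zero B, fun h' => ?_⟩
  choose r hr using fun j i => hreg (h' j) i
  -- The two forms differ by the determinant of the coordinate matrix, which is regular because its
  -- entries are.
  refine ⟨(Matrix.of fun i j => r j i).det, ?_⟩
  rw [wedgeD, exteriorPower.ιMulti_eq_det_smul B, hw, Module.Basis.det_apply, RingHom.map_det]
  congr 2
  ext i j
  exact (hr j i).symm

variable [IsLocallyNoetherian X]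

/-- Each frame is a regular multiple of the other. The two factors are inverse to each other, hence
units of the local ring. -/
theorem exists_ord_eq_of_isLocalFrame {n : ℕ} {z : X} {h h' : Fin n → X.presheaf.stalk z}
    (hh : IsLocalFrame z h) (hh' : IsLocalFrame z h') :
    ∃ u : X.functionField, u ≠ 0 ∧ wedgeD z h' = u • wedgeD z h ∧ Scheme.ord u z = 0 := by
  obtain ⟨u, hu⟩ := hh.2 h'
  obtain ⟨v, hv⟩ := hh'.2 h
  have h1 : algebraMap (X.presheaf.stalk z) X.functionField (v * u) = 1 := by
    rw [hu, smul_smul, ← map_mul] at hv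
    refine sub_eq_zero.1 ((smul_eq_zero.1 ?_).resolve_right hh.1)
    rw [sub_smul, one_smul, ← hv, sub_self]
  have h2 : v * u = 1 := by
    refine FaithfulSMul.algebraMap_injective (X.presheaf.stalk z) X.functionField ?_
    rw [h1, map_one]
  have h3 : IsUnit u := IsUnit.of_mul_eq_one_right _ h2
  exact ⟨_, (h3.map (algebraMap _ X.functionField)).ne_zero, hu, ord_eq_zero_of_isUnit h3⟩

/-- Canonical divisors are linearly equivalent. -/
theorem IsCanonicalDivisor.exists_eq_add {n : ℕ}
    (B : Module.Basis (Fin n) X.functionField Ω[X.functionField⁄ℤ]) {W W' : WeilDiv X}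
    (hW : IsCanonicalDivisor n W) (hW' : IsCanonicalDivisor n W') :
    ∃ f : X.functionField, f ≠ 0 ∧ ∀ E, (W - W') E = Scheme.ord f E.1 := by
  obtain ⟨ω, hω, hE⟩ := hW
  obtain ⟨ω', hω', hE'⟩ := hW'
  obtain ⟨c, hc⟩ := exteriorPower.exists_eq_smul_ιMulti B ω
  obtain ⟨c', hc'⟩ := exteriorPower.exists_eq_smul_ιMulti B ω'
  have hc0 : c ≠ 0 := by rintro rfl; exact hω (by rw [hc, zero_smul])
  have hc0' : c' ≠ 0 := by rintro rfl; exact hω' (by rw [hc', zero_smul])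
  -- Top forms are a one-dimensional space over the function field, and the ratio of the two forms
  -- is the function sought.
  have hf : ω = (c / c') • ω' := by rw [hc, hc', smul_smul, div_mul_cancel₀ _ hc0']
  refine ⟨c / c', div_ne_zero hc0 hc0', fun E => ?_⟩
  obtain ⟨h, g, hh, hg, hWE⟩ := hE E
  obtain ⟨h', g', hh', hg', hWE'⟩ := hE' E
  obtain ⟨u, hu0, hu, hord⟩ := exists_ord_eq_of_isLocalFrame hh hh'
  have hg0' : g' ≠ 0 := by rintro rfl; exact hω' (by rw [hg', zero_smul])
  have h1 : g = c / c' * (g' * u) := by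
    have h2 : g • wedgeD E.1 h = (c / c' * (g' * u)) • wedgeD E.1 h := by
      rw [← hg, hf, hg', hu, smul_smul, smul_smul, mul_assoc]
    refine sub_eq_zero.1 ((smul_eq_zero.1 ?_).resolve_right hh.1)
    rw [sub_smul, h2, sub_self]
  have h3 : Scheme.ord g E.1 = Scheme.ord (c / c') E.1 + (Scheme.ord g' E.1 + 0) := by
    rw [h1, Scheme.ord_mul (div_ne_zero hc0 hc0') (mul_ne_zero hg0' hu0), Scheme.ord_mul hg0' hu0, hord]
  rw [Finsupp.sub_apply, hWE, hWE']
  linarith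

end Frame

namespace SmoothFan

variable {n : ℕ} {ι : Type} [DecidableEq ι] (Δ : SmoothFan n ι)

/-- A basis of characters adapted to a chart gives local frames on the chart. -/
theorem exists_isLocalFrame (σ : Δ.Cone) (e : Module.Basis (Fin n) ℤ (Fin n → ℤ))
    (he : ∀ i, e i ∈ Δ.dual σ.1)
    (hsub : ∀ m ∈ Δ.dual σ.1, ∀ i, e.repr m i ≠ 0 → m - e i ∈ Δ.dual σ.1)
    (p : Spec (.of (Δ.CoordRing σ.1))) :
    ∃ h : Fin n → Δ.toricScheme.presheaf.stalk (Δ.chartMap σ p),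
      IsLocalFrame (Δ.chartMap σ p) h ∧
        exteriorPower.ιMulti _ n (Δ.dlogBasis e) = Δ.char (-∑ i, e i) • wedgeD _ h := by
  let φ := (toStalk (Δ.chartMap σ) (Δ.chartMap σ p) (Set.mem_range_self p)).hom
  have hφ : ∀ f, algebraMap _ Δ.toricScheme.functionField (φ f) = Δ.fn σ f := fun f =>
    algebraMap_toStalk (Δ.chartMap σ) _ _ f
  let h : Fin n → Δ.toricScheme.presheaf.stalk (Δ.chartMap σ p) := fun i =>
    φ (Δ.monomial (e i) (he i))
  have hh : ∀ i, algebraMap _ Δ.toricScheme.functionField (h i) = Δ.char (e i) := fun i => by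
    rw [hφ, fn_monomial]
  let w : Fin n → Δ.toricScheme.functionFieldˣ := fun i => Units.mk0 _ (Δ.char_ne_zero (e i))
  let B := (Δ.dlogBasis e).unitsSMul w
  have hB : ∀ i, B i = KaehlerDifferential.D ℤ _
      (algebraMap _ Δ.toricScheme.functionField (h i)) := fun i => by
    rw [hh, D_char, Module.Basis.unitsSMul_apply, dlogBasis_apply]
    rfl
  have hrepr : ∀ v i, B.repr v i = (Δ.char (e i))⁻¹ * (Δ.dlogBasis e).repr v i := fun v i => by
    rw [Module.Basis.repr_unitsSMul]
    rfl
  let R := (algebraMap (Δ.toricScheme.presheaf.stalk (Δ.chartMap σ p))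
    Δ.toricScheme.functionField).range
  -- For the character `m`, the coefficient at `dχ^{e i}` is an integer times `χ^{m - e i}`. The
  -- hypothesis `hsub` says that this is regular whenever the integer is nonzero.
  have hfn : ∀ f i, B.repr (KaehlerDifferential.D ℤ _ (Δ.fn σ f)) i ∈ R := fun f i => by
    induction f using AddMonoidAlgebra.induction_linear with
    | zero => simp only [map_zero, Finsupp.coe_zero, Pi.zero_apply]; exact zero_mem _
    | add f g hf hg => simp only [map_add, Finsupp.coe_add, Pi.add_apply]; exact add_mem hf hg
    | single m c =>
      rw [D_fn_single, map_smul, Finsupp.smul_apply, hrepr, dlogBasis_repr_dlog, smul_eq_mul]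
      by_cases h0 : e.repr m.1 i = 0
      · rw [h0, Int.cast_zero, mul_zero, mul_zero]; exact zero_mem _
      · have h1 : Δ.fn σ (AddMonoidAlgebra.single m c) * ((Δ.char (e i))⁻¹ * (e.repr m.1 i : _)) =
            Δ.fn σ (AddMonoidAlgebra.single ⟨m.1 - e i, hsub _ m.2 i h0⟩ c) * (e.repr m.1 i : _) := by
          rw [fn_single, fn_single]
          have h2 := Δ.char_add (m.1 - e i) (e i)
          rw [sub_add_cancel] at h2
          rw [h2]
          have := Δ.char_ne_zero (e i)
          field_simp
        rw [h1]
        exact mul_mem ⟨_, hφ _⟩ (intCast_mem _ _)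
  refine ⟨h, isLocalFrame_of_basis _ h B hB fun a i => ?_, ?_⟩
  · obtain ⟨f, s, hs, hfs⟩ := exists_toStalk_mul_eq (Δ.chartMap σ) a
    obtain ⟨t, ht⟩ := (isUnit_toStalk (Δ.chartMap σ) hs).exists_right_inv
    have h1 : algebraMap _ Δ.toricScheme.functionField a * Δ.fn σ s = Δ.fn σ f := by
      rw [← hφ, ← hφ, ← map_mul]
      exact congrArg _ hfs
    have h2 : Δ.fn σ s * algebraMap _ Δ.toricScheme.functionField t = 1 := by
      rw [← hφ, ← map_mul, ← map_one (algebraMap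
        (Δ.toricScheme.presheaf.stalk (Δ.chartMap σ p)) Δ.toricScheme.functionField)]
      exact congrArg _ ht
    -- A germ is a fraction `f / s` with `s` invertible at the point. Leibniz applied to `a * s = f`
    -- is solved for the differential of `a`, with `t` the inverse of `s`.
    have h3 := congrArg (fun v => algebraMap _ Δ.toricScheme.functionField t *
      B.repr (KaehlerDifferential.D ℤ _ v) i) h1
    simp only [Derivation.leibniz, map_add, map_smul, Finsupp.add_apply, Finsupp.smul_apply,
      smul_eq_mul] at h3
    have h4 : B.repr (KaehlerDifferential.D ℤ _ (algebraMap _ Δ.toricScheme.functionField a)) i =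
        algebraMap _ Δ.toricScheme.functionField t * B.repr (KaehlerDifferential.D ℤ _ (Δ.fn σ f)) i -
        algebraMap _ Δ.toricScheme.functionField t * (algebraMap _ Δ.toricScheme.functionField a *
          B.repr (KaehlerDifferential.D ℤ _ (Δ.fn σ s)) i) := by
      rw [← h3]
      linear_combination (-(B.repr (KaehlerDifferential.D ℤ _
        (algebraMap _ Δ.toricScheme.functionField a)) i)) * h2
    rw [h4]
    exact sub_mem (mul_mem ⟨_, rfl⟩ (hfn f i)) (mul_mem ⟨_, rfl⟩ (mul_mem ⟨_, rfl⟩ (hfn s i)))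
  · have h1 : wedgeD _ h = (∏ i, Δ.char (e i)) • exteriorPower.ιMulti _ n (Δ.dlogBasis e) := by
      rw [wedgeD]
      simp only [← hB]
      rw [← AlternatingMap.map_smul_univ]
      congr 1
      ext i
      rw [Module.Basis.unitsSMul_apply]
      rfl
    have h2 : ∀ s : Finset (Fin n), ∏ i ∈ s, Δ.char (e i) = Δ.char (∑ i ∈ s, e i) := fun s => by
      induction s using Finset.cons_induction with
      | empty => rw [Finset.prod_empty, Finset.sum_empty, char_zero]
      | cons a s ha ih => rw [Finset.prod_cons, Finset.sum_cons, ih, char_add]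
    rw [h1, h2, smul_smul, ← char_add, neg_add_cancel, char_zero, one_smul]

/-- A primitive vector is dual to a member of a basis whose other members vanish on it. -/
theorem exists_basis_of_dotProduct_eq_one {v w : Fin n → ℤ} (h : w ⬝ᵥ v = 1) :
    ∃ (e : Module.Basis (Fin n) ℤ (Fin n → ℤ)) (i : Fin n),
      e i ⬝ᵥ v = 1 ∧ ∀ j ≠ i, e j ⬝ᵥ v = 0 := by
  let f : (Fin n → ℤ) →ₗ[ℤ] ℤ :=
    AddMonoidHom.toIntLinearMap (AddMonoidHom.mk' (· ⬝ᵥ v) fun a b => add_dotProduct a b v)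
  have hf : ∀ u, f u = u ⬝ᵥ v := fun _ => rfl
  -- Since `w` pairs to `1` with `v`, it splits off the kernel of the pairing, and a basis of the
  -- kernel together with `w` is a basis of the lattice.
  obtain ⟨k, b⟩ := Submodule.basisOfPid (Pi.basisFun ℤ (Fin n)) (LinearMap.ker f)
  let e' := Module.Basis.mkFinCons w b
    (fun c u hu hc => by
      have := congrArg f hc
      rw [map_add, map_smul, LinearMap.mem_ker.1 hu, map_zero, hf, h] at this
      simpa using this)
    (fun z => ⟨-f z, by
      rw [LinearMap.mem_ker, map_add, map_smul, hf w, h]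
      simp⟩)
  have hcard : k + 1 = n := by
    have := Module.finrank_eq_card_basis e'
    rw [Module.finrank_fin_fun, Fintype.card_fin] at this
    exact this.symm
  subst hcard
  refine ⟨e', 0, ?_, fun j hj => ?_⟩
  · rw [Module.Basis.coe_mkFinCons, Fin.cons_zero, h]
  · obtain ⟨j, rfl⟩ := Fin.exists_succ_eq.2 hj
    rw [Module.Basis.coe_mkFinCons, Fin.cons_succ]
    exact (hf _).symm.trans (LinearMap.mem_ker.1 (b j).2)

/-- Up to a sign, the invariant form does not depend on the basis. -/
theorem ιMulti_dlogBasis (e e' : Module.Basis (Fin n) ℤ (Fin n → ℤ)) :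
    ∃ u : ℤˣ, exteriorPower.ιMulti Δ.toricScheme.functionField n (Δ.dlogBasis e') =
      ((u : ℤ) : Δ.toricScheme.functionField) • exteriorPower.ιMulti _ n (Δ.dlogBasis e) := by
  refine ⟨(e.isUnit_det e').unit, ?_⟩
  rw [exteriorPower.ιMulti_eq_det_smul (Δ.dlogBasis e)]
  congr 1
  rw [IsUnit.unit_spec, Module.Basis.det_apply, Module.Basis.det_apply, Int.cast_det]
  congr 1
  ext i j
  rw [Module.Basis.toMatrix_apply, dlogBasis_apply, dlogBasis_repr_dlog]
  rfl

theorem ord_intUnit (u : ℤˣ) (z : Δ.toricScheme) :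
    Scheme.ord ((u : ℤ) : Δ.toricScheme.functionField) z = 0 := by
  have h := ord_eq_zero_of_isUnit (x := z)
    (u.isUnit.map (Int.castRingHom (Δ.toricScheme.presheaf.stalk z)))
  rwa [eq_intCast, map_intCast] at h

variable [Fintype ι] (hΔ : ∀ ρ, {ρ} ∈ Δ.cones)

/-- The sum of the invariant prime divisors. -/
noncomputable def boundary : WeilDiv Δ.toricScheme := ∑ ρ, Finsupp.single (Δ.divisor (hΔ ρ)) 1

theorem boundary_divisor (ρ : ι) : Δ.boundary hΔ (Δ.divisor (hΔ ρ)) = 1 := by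
  rw [boundary, Finsupp.finsetSum_apply, Finset.sum_eq_single ρ]
  · rw [Finsupp.single_eq_same]
  · intro ρ' _ hne
    exact Finsupp.single_eq_of_ne fun h => hne (Δ.divisor_injective _ _ h.symm)
  · simp

theorem boundary_torus {E : PrimeDivisor Δ.toricScheme}
    (hE : E.1 ∈ Set.range (Δ.chartMap Δ.torus)) : Δ.boundary hΔ E = 0 := by
  rw [boundary, Finsupp.finsetSum_apply]
  exact Finset.sum_eq_zero fun ρ _ =>
    Finsupp.single_eq_of_ne fun h => Δ.divisor_notMem_torus (hΔ ρ) (h ▸ hE)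

/-- The invariant form `dlog ∧ ⋯ ∧ dlog` is `χ^{-∑ e i}` times a local frame for an adapted basis
`e`. On the torus this factor is a unit. At the divisor of `ρ` exactly one `e i` has value `1` and
the others `0`, so the form has a simple pole. -/
theorem isCanonicalDivisor_neg_boundary : IsCanonicalDivisor n (-Δ.boundary hΔ) := by
  let e₀ := Pi.basisFun ℤ (Fin n)
  refine ⟨exteriorPower.ιMulti _ n (Δ.dlogBasis e₀), exteriorPower.ιMulti_basis_ne_zero _, ?_⟩
  intro E
  by_cases hE : E.1 ∈ Set.range (Δ.chartMap Δ.torus)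
  · have h0 : (-Δ.boundary hΔ) E = 0 := by
      rw [Finsupp.neg_apply, boundary_torus _ _ hE, neg_zero]
    obtain ⟨z, hz⟩ := E
    obtain ⟨p, rfl⟩ := hE
    obtain ⟨h, hh, hω⟩ := Δ.exists_isLocalFrame Δ.torus e₀ (fun i => Δ.mem_dual_torus _)
      (fun m _ i _ => Δ.mem_dual_torus _) p
    exact ⟨h, _, hh, hω, h0.trans (Δ.ord_char_torus _ p).symm⟩
  · obtain ⟨ρ, hρ, h⟩ := Δ.exists_eq_divisor hE
    obtain ⟨w, hw, -⟩ := Δ.unimodular _ hρ ρ (Finset.mem_singleton_self ρ)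
    obtain ⟨e, i, hi, hj⟩ := exists_basis_of_dotProduct_eq_one hw
    have hdot : ∀ m, m ⬝ᵥ Δ.ray ρ = e.repr m i := fun m => by
      conv_lhs => rw [← e.sum_repr m, sum_dotProduct]
      rw [Finset.sum_eq_single i (fun j _ h => by rw [smul_dotProduct, hj j h, smul_zero]) (by simp),
        smul_dotProduct, hi, smul_eq_mul, mul_one]
    have he : ∀ j, 0 ≤ e j ⬝ᵥ Δ.ray ρ := fun j => by
      by_cases h : j = i
      · rw [h, hi]; exact zero_le_one
      · rw [hj j h]
    have hsub : ∀ m ∈ Δ.dual {ρ}, ∀ j, e.repr m j ≠ 0 → m - e j ∈ Δ.dual {ρ} := by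
      intro m hm j hne r hr
      obtain rfl := Finset.mem_singleton.1 hr
      have h1 := hm r hr
      rw [sub_dotProduct]
      by_cases h : j = i
      · subst h
        rw [← hdot] at hne
        rw [hi]
        omega
      · rw [hj j h]
        omega
    obtain ⟨h', hh, hω⟩ := Δ.exists_isLocalFrame ⟨{ρ}, hρ⟩ e
      (fun j r hr => Finset.mem_singleton.1 hr ▸ he j) hsub ⟨Δ.rayIdeal ρ, inferInstance⟩
    -- The form was fixed using the standard basis; passing to the basis adapted to `ρ` costs only a
    -- sign.
    obtain ⟨u, hu⟩ := Δ.ιMulti_dlogBasis e e₀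
    rw [h]
    refine ⟨h', ((u : ℤ) : Δ.toricScheme.functionField) * Δ.char (-∑ i, e i), hh, ?_, ?_⟩
    · rw [hu, mul_smul, hω]
      rfl
    · rw [Finsupp.neg_apply, boundary_divisor, Scheme.ord_mul (by simp) (Δ.char_ne_zero _),
        ord_intUnit, zero_add, ord_char_divisor, neg_dotProduct, sum_dotProduct,
        Finset.sum_eq_single i (fun j _ h => hj j h) (by simp), hi]

end SmoothFan
end LogPair

namespace ToricThreefold

open LogPair Ray

theorem exists_isCanonicalDivisor : ∃ W : WeilDiv X, IsCanonicalDivisor 3 W :=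
  ⟨_, fan.isCanonicalDivisor_neg_boundary singleton_mem_cones⟩

/-- Canonical divisors are linearly equivalent, so `W` may be taken to be minus the sum of the
invariant divisors. Removing `D` from that sum leaves `a1`, `b0`, `b1`, `c0`, `c1`, whose weights
add up to `(1, 2, 2)`. -/
theorem degree_of_isCanonicalDivisor {W : WeilDiv X} (hW : IsCanonicalDivisor 3 W) :
    dataM.degree (-(W + reducedDivisor D)) = ![1, 2, 2] := by
  obtain ⟨f, hf, h⟩ := hW.exists_eq_add (fan.dlogBasis (Pi.basisFun ℤ (Fin 3)))
    (fan.isCanonicalDivisor_neg_boundary singleton_mem_cones)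
  have h1 : dataM.degree W = dataM.degree (-fan.boundary singleton_mem_cones) := by
    rw [← sub_eq_zero, ← map_sub, ← AddMonoidHom.mem_ker, dataM.ker_degree, AddMonoidHom.mem_ker,
      classOf_eq_zero_iff]
    exact ⟨f, hf, fun E _ => h E⟩
  have h2 : ∀ ρ, dataM.degree (Finsupp.single (rayDivisor ρ) 1) = wtM ρ := fun ρ =>
    dataM.degree_divisor ρ
  have h3 : dataM.degree (fan.boundary singleton_mem_cones) = ∑ ρ, wtM ρ := by
    refine (map_sum dataM.degree (fun ρ => Finsupp.single (rayDivisor ρ) 1) Finset.univ).trans ?_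
    exact Finset.sum_congr rfl fun ρ _ => h2 ρ
  have h4 : dataM.degree (reducedDivisor D) = wtM x + wtM y + wtM a0 := by
    have h5 : reducedDivisor D = ∑ ρ ∈ ({x, y, a0} : Finset Ray), Finsupp.single (rayDivisor ρ) 1 := by
      rw [reducedDivisor, D_eq, Finset.sum_image rayDivisor_injective.injOn]
    rw [h5, map_sum]
    simp only [h2]
    rw [Finset.sum_insert (by decide), Finset.sum_insert (by decide), Finset.sum_singleton, add_assoc]
  rw [map_neg, map_add, h1, map_neg, h3, h4, sum_ray]
  ext i
  fin_cases i <;> simp [wtM]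

theorem alpha_M {W : WeilDiv X} (hW : IsCanonicalDivisor 3 W) {ι : Type} [Fintype ι]
    (b : Module.Basis ι ℤ (APic (complement D) {M})) : alpha D {M} b W = 1 / 8 :=
  alpha_eq_of_degree b W (degree_of_isCanonicalDivisor hW)

end ToricThreefold

namespace LogPair.SmoothFan

variable {n : ℕ} {ι : Type} [DecidableEq ι] (Δ : SmoothFan n ι)

/-! ### Orbit closures -/

/-- All these ideals are monomial, and a monomial lies in the ideal of `A` exactly if it lies in the
ideal of some ray of `A`; the former ideal is the sum of the latter. -/
theorem orbitPoint_le_iff {A σ : Finset ι} (h : A ⊆ σ) (p : Spec (.of (Δ.CoordRing σ))) :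
    (Δ.orbitPoint A σ h).asIdeal ≤ p.asIdeal ↔ ∀ ρ, ∀ hρ : ρ ∈ A,
      (Δ.orbitPoint {ρ} σ (Finset.singleton_subset_iff.2 (h hρ))).asIdeal ≤ p.asIdeal := by
  constructor
  · intro hp ρ hρ f hf
    refine hp ((Δ.orbitRes_eq_zero_iff h f).2 fun m hm => ⟨ρ, hρ, ?_⟩)
    obtain ⟨r, hr, h0⟩ := (Δ.orbitRes_eq_zero_iff _ f).1 hf m hm
    rwa [Finset.mem_singleton.1 hr] at h0
  · intro hp f hf
    rw [← AddMonoidAlgebra.sum_coeff_single f]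
    refine Ideal.sum_mem _ fun m hm => ?_
    obtain ⟨ρ, hρ, h0⟩ := (Δ.orbitRes_eq_zero_iff h f).1 hf m hm
    refine hp ρ hρ ((Δ.orbitRes_eq_zero_iff _ _).2 fun m' hm' => ⟨ρ, Finset.mem_singleton_self ρ, ?_⟩)
    rw [AddMonoidAlgebra.coeff_single] at hm'
    obtain rfl := Finset.mem_singleton.1 (Finsupp.support_single_subset hm')
    exact h0

/-- The morphism from a torus onto the orbit of a cone. -/
noncomputable def orbitMap (σ : Δ.Cone) :
    Spec (.of (AddMonoidAlgebra ℚ (Fin n → ℤ))) ⟶ Δ.toricScheme :=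
  Spec.map (CommRingCat.ofHom (Δ.orbitRes σ.1 σ.1 subset_rfl).toRingHom) ≫ Δ.chartMap σ

theorem orbitMap_structureMap (σ : Δ.Cone) : Δ.orbitMap σ ≫ Δ.structureMap =
    Spec.map (CommRingCat.ofHom (algebraMap ℚ (AddMonoidAlgebra ℚ (Fin n → ℤ)))) := by
  have h : Δ.chartMap σ ≫ Δ.structureMap =
      Spec.map (CommRingCat.ofHom (algebraMap ℚ (Δ.CoordRing σ.1))) := colimit.ι_desc _ _
  rw [orbitMap, Category.assoc, h, ← Spec.map_comp, ← CommRingCat.ofHom_comp]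
  congr 2
  exact Subsingleton.elim _ _

/-- The generic point of the source torus maps to the point given by the kernel of `orbitRes`, and
every other image is a specialization of it. -/
theorem closure_range_orbitMap (σ : Δ.Cone) : closure (Set.range (Δ.orbitMap σ)) =
    closure {Δ.chartMap σ (Δ.orbitPoint σ.1 σ.1 subset_rfl)} := by
  have hmap : ∀ q, Δ.orbitMap σ q = Δ.chartMap σ
      (Spec.map (CommRingCat.ofHom (Δ.orbitRes σ.1 σ.1 subset_rfl).toRingHom) q) := fun _ => rfl
  apply subset_antisymm
  · refine closure_minimal ?_ isClosed_closure
    rintro _ ⟨q, rfl⟩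
    rw [hmap, ← specializes_iff_mem_closure]
    refine Specializes.map ?_ (Δ.chartMap σ).continuous
    refine (PrimeSpectrum.le_iff_specializes _ _).1 ?_
    intro f hf
    change Δ.orbitRes σ.1 σ.1 subset_rfl f ∈ q.asIdeal
    rw [show Δ.orbitRes σ.1 σ.1 subset_rfl f = 0 from hf]
    exact zero_mem _
  · refine closure_mono (Set.singleton_subset_iff.2 ⟨(⟨⊥, Ideal.isPrime_bot⟩ : PrimeSpectrum _), ?_⟩)
    exact (hmap _).trans (congrArg (Δ.chartMap σ) (PrimeSpectrum.ext rfl))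

/-- A chart around a common point of the divisors contains all rays of `τ`, and in that chart
`orbitPoint_le_iff` identifies their intersection with one orbit closure. -/
theorem mem_closure_rayPoint_forall_iff (hΔ : ∀ ρ, {ρ} ∈ Δ.cones) (τ : Δ.Cone) (x : Δ.toricScheme) :
    (∀ ρ ∈ τ.1, x ∈ closure {Δ.rayPoint (hΔ ρ)}) ↔ x ∈ closure (Set.range (Δ.orbitMap τ)) := by
  rw [closure_range_orbitMap]
  constructor
  · intro h
    obtain ⟨σ, p, rfl⟩ := Δ.exists_chartMap_eq x
    have hτ : τ.1 ⊆ σ.1 := fun ρ hρ => ((Δ.chartMap_mem_closure_rayPoint _ _ _).1 (h ρ hρ)).1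
    rw [← Δ.chartMap_orbitPoint hτ subset_rfl, ← specializes_iff_mem_closure]
    refine Specializes.map ((PrimeSpectrum.le_iff_specializes _ _).1 ?_) (Δ.chartMap σ).continuous
    exact (Δ.orbitPoint_le_iff _ p).2 fun ρ hρ =>
      ((Δ.chartMap_mem_closure_rayPoint _ _ _).1 (h ρ hρ)).2
  · intro h ρ hρ
    refine closure_minimal (Set.singleton_subset_iff.2 ?_) isClosed_closure h
    exact (Δ.chartMap_mem_closure_rayPoint _ _ _).2
      ⟨hρ, (Δ.orbitPoint_le_iff subset_rfl _).1 le_rfl ρ hρ⟩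

theorem mem_cones_of_mem_closure (hΔ : ∀ ρ, {ρ} ∈ Δ.cones) {T : Finset ι} {x : Δ.toricScheme}
    (h : ∀ ρ ∈ T, x ∈ closure {Δ.rayPoint (hΔ ρ)}) : T ∈ Δ.cones := by
  obtain ⟨σ, p, rfl⟩ := Δ.exists_chartMap_eq x
  exact Δ.mem_of_subset _ σ.2 _ fun ρ hρ => ((Δ.chartMap_mem_closure_rayPoint _ _ _).1 (h ρ hρ)).1

/-! ### Complex points of orbit closures -/

/-- The tensor product is the Laurent polynomial ring over `ℂ`: the torus is geometrically integral.
-/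
instance : IsDomain (AddMonoidAlgebra ℚ (Fin n → ℤ) ⊗[ℚ] ℂ) :=
  have : IsDomain (AddMonoidAlgebra ℂ (Fin n → ℤ)) := IsDomain.mk
  ((Algebra.TensorProduct.comm ℚ (AddMonoidAlgebra ℚ (Fin n → ℤ)) ℂ).toMulEquiv.trans
    (AddMonoidAlgebra.scalarTensorEquiv ℚ ℂ (M := Fin n → ℤ)).toMulEquiv).isDomain _

instance : UniversallyOpen (Spec.map (CommRingCat.ofHom (algebraMap ℚ ℂ))) := inferInstance

/-- The preimage of the range of `orbitMap` is an image of the irreducible complex torus. As the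
projection from the complexification is open, taking preimages commutes with closure. -/
theorem isIrreducible_preimage (σ : Δ.Cone) :
    IsIrreducible ((pullback.fst Δ.structureMap _ : complexification Δ.structureMap ⟶ Δ.toricScheme) ⁻¹'
      closure (Set.range (Δ.orbitMap σ))) := by
  let c := Spec.map (CommRingCat.ofHom (algebraMap ℚ ℂ))
  let π := pullback.fst Δ.structureMap c
  have e : pullback (Δ.orbitMap σ) π ≅
      Spec (.of (AddMonoidAlgebra ℚ (Fin n → ℤ) ⊗[ℚ] ℂ)) :=
    pullbackRightPullbackFstIso _ _ _ ≪≫ pullback.congrHom (Δ.orbitMap_structureMap σ) rfl ≪≫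
      pullbackSpecIso ℚ (AddMonoidAlgebra ℚ (Fin n → ℤ)) ℂ
  have hirr : IrreducibleSpace ↥(pullback (Δ.orbitMap σ) π) :=
    e.schemeIsoToHomeo.symm.surjective.irreducibleSpace e.schemeIsoToHomeo.symm.continuous
  have h1 : IsIrreducible (π ⁻¹' Set.range (Δ.orbitMap σ)) := by
    rw [← Scheme.Pullback.range_snd, ← Set.image_univ]
    exact IsIrreducible.image (IrreducibleSpace.isIrreducible_univ _) _
      (pullback.snd (Δ.orbitMap σ) π).continuous.continuousOn
  have h2 : IsOpenMap π := Scheme.Hom.isOpenMap π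
  rw [h2.preimage_closure_eq_closure_preimage π.continuous]
  exact h1.closure

theorem hasRealPoint_preimage (σ : Δ.Cone) : HasRealPoint Δ.structureMap
    ((pullback.fst Δ.structureMap _ : complexification Δ.structureMap ⟶ Δ.toricScheme) ⁻¹'
      closure (Set.range (Δ.orbitMap σ))) := by
  -- The real point is the image of the identity of the torus, where every character takes the value
  -- `1`.
  let ev : AddMonoidAlgebra ℚ (Fin n → ℤ) →+* ℝ :=
    (AddMonoidAlgebra.lift ℚ ℝ (Fin n → ℤ) 1).toRingHom
  let p := Spec.map (CommRingCat.ofHom ev) ≫ Δ.orbitMap σ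
  have h : (Spec.map (CommRingCat.ofHom (algebraMap ℝ ℂ)) ≫ p) ≫ Δ.structureMap =
      𝟙 _ ≫ Spec.map (CommRingCat.ofHom (algebraMap ℚ ℂ)) := by
    rw [Category.assoc, Category.assoc, orbitMap_structureMap, ← Spec.map_comp, ← Spec.map_comp,
      Category.id_comp, ← CommRingCat.ofHom_comp, ← CommRingCat.ofHom_comp]
    congr 2
    exact Subsingleton.elim _ _
  refine ⟨p, pullback.lift _ _ h, pullback.lift_snd _ _ _, pullback.lift_fst _ _ _, ?_⟩
  rintro _ ⟨x, rfl⟩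
  refine subset_closure ?_
  rw [← Scheme.Hom.comp_apply, pullback.lift_fst]
  exact ⟨_, rfl⟩

end LogPair.SmoothFan

namespace LogPair

theorem complexConj_fst {X : Scheme.{0}} (s : X ⟶ Spec (.of ℚ)) :
    complexConj s ≫ pullback.fst _ _ = pullback.fst _ _ := by
  rw [complexConj, pullback.lift_fst, Category.comp_id]

/-- Conjugation commutes with the projection to `X`, so every set pulled back from `X` is defined
over `ℝ`. -/
theorem preimage_complexConj {X : Scheme.{0}} (s : X ⟶ Spec (.of ℚ)) (S : Set X) :
    complexConj s ⁻¹' ((pullback.fst s _ : complexification s ⟶ X) ⁻¹' S) =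
      (pullback.fst s _ : complexification s ⟶ X) ⁻¹' S := by
  ext z
  have h := congr($(complexConj_fst s) z)
  rw [Scheme.Hom.comp_apply] at h
  rw [Set.mem_preimage, Set.mem_preimage, Set.mem_preimage, h]

end LogPair

namespace ToricThreefold

open LogPair Ray

/-! ### The analytic Clemens complex -/

theorem mem_stratum_image {T : Finset Ray} {z : X} : z ∈ stratum (T.image rayDivisor) ↔
    ∀ ρ ∈ T, z ∈ closure {fan.rayPoint (singleton_mem_cones ρ)} := by
  rw [stratum, Set.mem_iInter₂, Finset.forall_mem_image]
  rfl

theorem stratum_image {T : Finset Ray} (hT : T ∈ fan.cones) : stratum (T.image rayDivisor) =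
    closure (Set.range (fan.orbitMap ⟨T, hT⟩)) :=
  Set.ext fun z => mem_stratum_image.trans
    (fan.mem_closure_rayPoint_forall_iff singleton_mem_cones ⟨T, hT⟩ z)

theorem isIrreducible_preimage_stratum {T : Finset Ray} (hT : T ∈ fan.cones) :
    IsIrreducible ((pullback.fst toSpec _ : complexification toSpec ⟶ X) ⁻¹'
      stratum (T.image rayDivisor)) := by
  rw [stratum_image hT]
  exact fan.isIrreducible_preimage _

/-- The face of the Clemens complex belonging to a cone. -/
noncomputable def face (T : Finset Ray) (hT : T ∈ fan.cones) (h : T.image rayDivisor ⊆ D) :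
    AnalyticFace toSpec D where
  vertices := T.image rayDivisor
  carrier := (pullback.fst toSpec _ : complexification toSpec ⟶ X) ⁻¹' stratum (T.image rayDivisor)
  subset := h
  isComponent := ⟨⟨isIrreducible_preimage_stratum hT, subset_rfl⟩, fun _ hT _ => hT.2⟩
  conj_invariant := preimage_complexConj _ _
  hasRealPoint := by
    rw [stratum_image hT]
    exact fan.hasRealPoint_preimage _

/-- A component is nonempty, so the rays of its vertices span a cone. The complexified stratum is
then irreducible, and the component can only be the whole of it. -/
theorem exists_eq_face (F : AnalyticFace toSpec D) :
    ∃ (T : Finset Ray) (hT : T ∈ fan.cones) (h : T.image rayDivisor ⊆ D),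
      T ⊆ {x, y, a0} ∧ F = face T hT h := by
  obtain ⟨A, Z, hA, hZ, hc, hr⟩ := F
  have hA' := hA
  rw [D_eq] at hA'
  obtain ⟨T, hT, rfl⟩ := Finset.subset_image_iff.1 hA'
  obtain ⟨z, hz⟩ := hZ.1.1.1
  have hcone : T ∈ fan.cones :=
    fan.mem_cones_of_mem_closure singleton_mem_cones (mem_stratum_image.1 (hZ.1.2 hz))
  refine ⟨T, hcone, hA, hT, ?_⟩
  have : Z = (pullback.fst toSpec _ : complexification toSpec ⟶ X) ⁻¹'
      stratum (T.image rayDivisor) :=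
    hZ.eq_of_subset ⟨isIrreducible_preimage_stratum hcone, subset_rfl⟩ hZ.1.2
  subst this
  rfl

theorem face_le_iff {T T' : Finset Ray} (hT : T ∈ fan.cones) (hT' : T' ∈ fan.cones)
    (h : T.image rayDivisor ⊆ D) (h' : T'.image rayDivisor ⊆ D) :
    face T hT h ≤ face T' hT' h' ↔ T ⊆ T' := by
  constructor
  · intro hle
    exact (Finset.image_subset_image_iff rayDivisor_injective).1 hle.1
  · intro hle
    refine ⟨Finset.image_subset_image hle, Set.preimage_mono fun z hz => ?_⟩
    exact mem_stratum_image.2 fun ρ hρ => mem_stratum_image.1 hz ρ (hle hρ)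

/-- Geometrically, both exceptional divisors lie over `V(a₁)`, which is disjoint from `V(a₀)`; hence
`M` meets neither of them. -/
theorem cones_of_subset : ∀ T ∈ ({x, y, a0} : Finset Ray).powerset, T ∈ cones →
    T ⊆ {x, y} ∨ T = {a0} := by decide +kernel

theorem xy_mem_cones : ({x, y} : Finset Ray) ∈ fan.cones := by
  change _ ∈ cones
  decide +kernel

/-- Faces are ordered as the cones with rays among `x`, `y`, `a0`. By `cones_of_subset` these are
subsets of `{x, y}`, itself a cone, or equal to `{a0}`. -/
theorem exists_maximal_faces :
    ∃ FA FM : AnalyticFace toSpec D, FA.vertices = {E₁, E₂} ∧ FM.vertices = {M} ∧ FA ≠ FM ∧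
      (∀ F : AnalyticFace toSpec D, IsMax F ↔ F = FA ∨ F = FM) ∧
      ∀ F : AnalyticFace toSpec D, F ≠ FA → F.dim < FA.dim := by
  have hxy : ({x, y} : Finset Ray).image rayDivisor ⊆ D := by
    rw [D_eq]
    exact Finset.image_subset_image (by decide)
  have ha0 : ({a0} : Finset Ray).image rayDivisor ⊆ D := by
    rw [D_eq]
    exact Finset.image_subset_image (by decide)
  have hinj : ∀ {T T' : Finset Ray} {hT hT' h h'}, face T hT h = face T' hT' h' → T = T' :=
    fun h => Finset.image_injective rayDivisor_injective (congrArg AnalyticFace.vertices h)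
  refine ⟨face {x, y} xy_mem_cones hxy, face {a0} (singleton_mem_cones a0) ha0, E_eq.symm, M_eq.symm,
    fun h => absurd (hinj h) (by decide), fun F => ?_, fun F hF => ?_⟩
  · obtain ⟨T, hT, h, hsub, rfl⟩ := exists_eq_face F
    have hcase := cones_of_subset T (Finset.mem_powerset.2 hsub) hT
    constructor
    · intro hmax
      rcases hcase with h1 | rfl
      · have h2 := (face_le_iff _ _ _ _).1 (hmax ((face_le_iff hT xy_mem_cones h hxy).2 h1))
        obtain rfl := h1.antisymm h2
        exact Or.inl rfl
      · exact Or.inr rfl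
    · intro hF G hG
      obtain ⟨S, hS, h', hsub', rfl⟩ := exists_eq_face G
      have hTS := (face_le_iff _ _ _ _).1 hG
      refine (face_le_iff _ _ _ _).2 ?_
      rcases cones_of_subset S (Finset.mem_powerset.2 hsub') hS with h1 | rfl
      · rcases hF with hF | hF
        · rwa [hinj hF]
        · obtain rfl := hinj hF
          exact absurd (h1 (hTS (Finset.mem_singleton_self a0))) (by decide)
      · rcases hF with hF | hF
        · obtain rfl := hinj hF
          exact absurd (hTS (Finset.mem_insert_self x {y})) (by decide)
        · rw [hinj hF]
  · obtain ⟨T, hT, h, hsub, rfl⟩ := exists_eq_face F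
    have hcard : ∀ S h1 h2, (face S h1 h2).dim = S.card - 1 := fun S _ _ => by
      change ((S.image rayDivisor).card : ℤ) - 1 = _
      rw [Finset.card_image_of_injective _ rayDivisor_injective]
    have hlt : T.card < ({x, y} : Finset Ray).card := by
      rcases cones_of_subset T (Finset.mem_powerset.2 hsub) hT with h1 | rfl
      · refine Finset.card_lt_card (h1.ssubset_of_ne ?_)
        rintro rfl
        exact hF rfl
      · decide
    rw [hcard, hcard]
    omega

end ToricThreefold

open LogPair ToricThreefold in
theorem proposition3p6 :
    -- The analytic Clemens complex has exactly two maximal faces, with vertices `{E₁, E₂}` and `{M}`,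
    -- and the former is its unique face of maximal dimension.
    (∃ FA FM : AnalyticFace toSpec D, FA.vertices = {E₁, E₂} ∧ FM.vertices = {M} ∧ FA ≠ FM ∧
      (∀ F : AnalyticFace toSpec D, IsMax F ↔ F = FA ∨ F = FM) ∧
      ∀ F : AnalyticFace toSpec D, F ≠ FA → F.dim < FA.dim) ∧
    -- (1) `Pic(U; A)` is canonically `Pic(X ∖ M)`, identifying `Eff_A` with the closed effective cone
    -- of `X ∖ M`, and this cone is not strictly convex.
    (∃ e : APic (complement D) {E₁, E₂} ≃+ APic (complement {M}) ∅,
      (∀ κ : Pic X, e (toAPic (complement D) {E₁, E₂} κ) = toAPic (complement {M}) ∅ κ) ∧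
      (e.toAddMonoidHom.toIntLinearMap.baseChange ℝ) '' (Eff (complement D) {E₁, E₂}) =
        closedEff (complement {M})) ∧
    ¬ StrictlyConvex (Eff (complement D) {E₁, E₂}) ∧
    -- (2) `Eff_M` is smooth and strictly convex, `b_M = b'_M = 3` and `α_M = 1/8`.
    IsSmoothCone (Eff (complement D) {M}) ∧
    StrictlyConvex (Eff (complement D) {M}) ∧
    (Module.Finite ℤ (APic (complement D) ∅) ∧
      Module.Finite ℤ (UnitsModConstants toSpec (complement D)) ∧
      bExp toSpec D {M} = 3) ∧
    (Module.Finite ℤ (APic (complement D) {M}) ∧ bExp' D {M} = 3) ∧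
    (∃ W : WeilDiv X, IsCanonicalDivisor 3 W) ∧
    ∀ W : WeilDiv X, IsCanonicalDivisor 3 W →
      ∀ {ι : Type} [Fintype ι] (b : Module.Basis ι ℤ (APic (complement D) {M})),
        alpha D {M} b W = 1 / 8 :=
  ⟨exists_maximal_faces, ⟨picEquiv, picEquiv_toAPic, image_Eff⟩, not_strictlyConvex_Eff,
    isSmoothCone_Eff_M, strictlyConvex_Eff_M, ⟨dataU.moduleFinite, inferInstance, bExp_M⟩,
    ⟨dataM.moduleFinite, bExp'_M⟩, exists_isCanonicalDivisor, fun _ hW _ _ b => alpha_M hW b⟩
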